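/- All graphs are finite, simple and undirected. Given a colouring of the edges of a graph (adjacent edges may have the same colour), a path is called *proper* if any two consecutive edges of it have different colours. The proper connection number $pc(G)$ of a connected graph $G$ is the least number of colours in an edge-colouring of $G$ such that every two distinct vertices are joined by a proper path. Let $G_1$ (6 vertices) consist of two triangles sharing a vertex $v$ together with a pendant edge at $v$; let $G_2$ (7 vertices) consist of three triangles sharing one common vertex; let $G_3$ (8 vertices) consist of two triangles sharing a vertex $v$, a third triangle disjoint from them, and one edge joining $v$ to a vertex of the third triangle. (i) Let $G$ be a connected noncomplete graph on $n\ge 5$ vertices that is not isomorphic to $G_1$, $G_2$ or $G_3$. If $d(x)+d(y)\ge \frac n2$ for every pair of distinct nonadjacent vertices $x,y$ of $G$, then $pc(G)=2$. (ii) The bound is best possible in the following sense. For $m\ge 1$ let $S_m$ be the graph on $n=2m+3$ vertices obtained from the disjoint union of a triangle and two copies of $K_m$ by choosing one vertex in each of these three graphs and joining the chosen vertex of the triangle by an edge to the chosen vertex of each copy of $K_m$. Then $S_m$ is connected and noncomplete, $pc(S_m)=3$, and, if $m\neq 2$, $d(x)+d(y)\ge \frac n2-1$ for every pair of distinct nonadjacent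 vertices $x,y$ of $S_m$. -/

import Mathlib

namespace ProperConnection

/-- A walk is a proper path of the edge-coloured graph `(G, c)` if it is a path and any two
consecutive edges of it have different colours. -/
def IsProperPath {V K : Type*} {G : SimpleGraph V} (c : G.EdgeLabeling K) {u v : V}
    (p : G.Walk u v) : Prop :=
  p.IsPath ∧ p.darts.IsChain (fun d e => c ⟨d.edge, d.edge_mem⟩ ≠ c ⟨e.edge, e.edge_mem⟩)

/-- The edge-colouring `c` (adjacent edges may share a colour) makes `G` proper connected. -/
def IsProperConnected {V K : Type*} {G : SimpleGraph V} (c : G.EdgeLabeling K) : Prop :=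
  ∀ u v : V, u ≠ v → ∃ p : G.Walk u v, IsProperPath c p

/-- The proper connection number: the minimum number of colours that make `G` proper connected.
(For a finite connected graph the set is nonempty.) -/
noncomputable def pc {V : Type*} (G : SimpleGraph V) : ℕ :=
  sInf {k : ℕ | ∃ c : G.EdgeLabeling (Fin k), IsProperConnected c}

/-- Six vertices: two triangles `0 2 3` and `0 4 5` sharing the vertex `0`, and a pendant
edge `0 1`. -/
def exceptional₁ : SimpleGraph (Fin 6) :=
  SimpleGraph.fromEdgeSet
    {s(0, 1), s(0, 2), s(0, 3), s(2, 3), s(0, 4), s(0, 5), s(4, 5)}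

/-- Seven vertices: three triangles sharing the vertex `0`. -/
def exceptional₂ : SimpleGraph (Fin 7) :=
  SimpleGraph.fromEdgeSet
    {s(0, 1), s(0, 2), s(1, 2), s(0, 3), s(0, 4), s(3, 4), s(0, 5), s(0, 6), s(5, 6)}

/-- Eight vertices: two triangles `0 1 2` and `0 3 4` sharing the vertex `0`, and the edge `0 5`
that joins `0` to a third triangle `5 6 7`. -/
def exceptional₃ : SimpleGraph (Fin 8) :=
  SimpleGraph.fromEdgeSet
    {s(0, 1), s(0, 2), s(1, 2), s(0, 3), s(0, 4), s(3, 4), s(0, 5), s(5, 6), s(5, 7), s(6, 7)}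

/-- The disjoint union of a triangle and two copies of the complete graph on `m` vertices,
in which one vertex of the triangle is joined by an edge to one vertex of each copy. -/
def sharpGraph (m : ℕ) [NeZero m] : SimpleGraph (Fin 3 ⊕ (Fin m ⊕ Fin m)) :=
  SimpleGraph.sum (⊤ : SimpleGraph (Fin 3))
      (SimpleGraph.sum (⊤ : SimpleGraph (Fin m)) (⊤ : SimpleGraph (Fin m)))
    ⊔ SimpleGraph.edge (Sum.inl 0) (Sum.inr (Sum.inl 0))
    ⊔ SimpleGraph.edge (Sum.inl 0) (Sum.inr (Sum.inr 0))

end ProperConnection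

namespace ProperConnection

open Finset Relation

variable {V : Type*}

/-! ### Orientations of a connected graph in which any two vertices are joined one way -/

section Orientation

/-! Two colours come from an orientation. Let `H` be a spanning bipartite subgraph of `G`, oriented
without two-way edges, and colour each edge by the side that contains its tail. A directed path
alternates between the sides, so it is proper, and so is its reverse. Hence two colours suffice once
any two vertices are joined by a directed path in at least one direction
(`exists_isProperConnected_of_orientation`). Such an orientation exists when `H` is connected and
every bridge of `H` separates two fixed vertices `s` and `t`: the bridgeless pieces are oriented
strongly, in the manner of Robbins' theorem, and the bridges point from `s` towards `t`
(`exists_unilateral_orientation`). `Linked` records this property, and `Linked.glue` chains linked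
sets along edges.

To find `H`, take a maximum cut of `G` that has the fewest vertices of degree one. Flipping the
signs on a set shows that at least half of the edges leaving any set belong to the cut. So `H` is
connected, and a set left by one edge of `H` is left by at most two edges of `G`. If `H` has bridges
that do not all lie between two vertices, submodularity of the cut function produces three disjoint
minimal sets left by one edge of `H`, the ends (`exists_three_isEnd`). An end is either a single
vertex, of degree at most two in `G`, or a block on at least four vertices, which contains a vertex
with no neighbour outside the end.

If some end is large, the degree condition, applied to vertices taken from the ends, leaves at most
two vertices outside them, and `G` is linked in a different way. If all three ends are single
vertices, they are pairwise nonadjacent because the number of leaves is minimal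
(`IsOptimalCut.not_adj`). Then `G` has at most eight vertices, and the possible patterns of the
three neighbourhoods give either a linked structure or one of the three exceptions.

For the sharpness example, a proper path between the two copies forces different colours on the two
edges that join the triangle to them. With only two colours, the paths that start at the two other
triangle vertices then make contradictory demands on the triangle. -/

/-- The cut `(T, Tᶜ)` of `H` consists of the single edge `u v`, with `u ∈ T` and `v ∉ T`. -/
def IsBridgeCut (H : SimpleGraph V) (T : Set V) (u v : V) : Prop :=
  u ∈ T ∧ v ∉ T ∧ ∀ x ∈ T, ∀ y ∉ T, H.Adj x y → x = u ∧ y = v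

lemma IsBridgeCut.compl {H : SimpleGraph V} {T : Set V} {u v : V} (h : IsBridgeCut H T u v) :
    IsBridgeCut H Tᶜ v u := by
  refine ⟨h.2.1, fun h' => h' h.1, fun x hx y hy hxy => ?_⟩
  exact (h.2.2 y (not_not.1 hy) x hx hxy.symm).symm

lemma reflTransGen_of_forall_exists {H : SimpleGraph V}
    (hc : ∀ S : Set V, S.Nonempty → S ≠ Set.univ → ∃ x ∈ S, ∃ y ∉ S, H.Adj x y) (u v : V) :
    ReflTransGen H.Adj u v := by
  by_contra hv
  obtain ⟨x, hx, y, hy, hxy⟩ := hc {w | ReflTransGen H.Adj u w} ⟨u, .refl⟩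
    (fun h => hv (h ▸ Set.mem_univ v : v ∈ {w | ReflTransGen H.Adj u w}))
  exact hy (ReflTransGen.tail hx hxy)

/-- Every use of the arc from `u` to `v` can be replaced by a detour, so dropping it costs no
reachability. This is what makes a redundant arc removable from a strong orientation. -/
lemma reflTransGen_of_replace {D D' : V → V → Prop} {u v : V}
    (hD : ∀ x y, D x y → D' x y ∨ (x = u ∧ y = v)) (huv : ReflTransGen D' u v) {x y : V}
    (h : ReflTransGen D x y) : ReflTransGen D' x y := by
  induction h with
  | refl => exact .refl
  | tail _ hbc ih =>
    rcases hD _ _ hbc with h | ⟨rfl, rfl⟩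
    · exact ih.tail h
    · exact ih.trans huv

/-- If neither direction of an edge can be dropped from a strongly connected orientation,
then that edge is a bridge. -/
lemma exists_isBridgeCut_of_irredundant {H : SimpleGraph V} {D : V → V → Prop}
    (hcov : ∀ x y, H.Adj x y → D x y ∨ D y x) (hstr : ∀ x y, ReflTransGen D x y) {u v : V}
    (huv : ¬ ReflTransGen (fun x y => D x y ∧ ¬ (x = u ∧ y = v)) u v)
    (hvu : ¬ ReflTransGen (fun x y => D x y ∧ ¬ (x = v ∧ y = u)) v u) :
    ∃ T : Set V, IsBridgeCut H T u v := by
  set D' : V → V → Prop := fun x y => D x y ∧ ¬ (x = u ∧ y = v) ∧ ¬ (x = v ∧ y = u) with hD'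
  have hv : ¬ ReflTransGen D' u v := fun h => huv (ReflTransGen.mono (fun x y hxy => ⟨hxy.1, hxy.2.1⟩) _ _ h)
  have hu : ¬ ReflTransGen D' v u := fun h => hvu (ReflTransGen.mono (fun x y hxy => ⟨hxy.1, hxy.2.2⟩) _ _ h)
  -- Whenever a directed path uses one of the two dropped arcs, it lands at `u` or at `v`. What
  -- follows the last such arc is a path in `D'`.
  have hfrom : ∀ w, ReflTransGen D' u w ∨ ReflTransGen D' v w := by
    intro w
    induction hstr u w with
    | refl => exact .inl .refl
    | @tail b c _ hbc ih =>
      by_cases h1 : b = u ∧ c = v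
      · exact .inr (h1.2 ▸ .refl)
      by_cases h2 : b = v ∧ c = u
      · exact .inl (h2.2 ▸ .refl)
      exact ih.imp (·.tail ⟨hbc, h1, h2⟩) (·.tail ⟨hbc, h1, h2⟩)
  have hto : ∀ w, ReflTransGen D' w u ∨ ReflTransGen D' w v := by
    intro w
    induction hstr w u using ReflTransGen.head_induction_on with
    | refl => exact .inl .refl
    | @head a c hac _ ih =>
      by_cases h1 : a = u ∧ c = v
      · exact .inl (h1.1 ▸ .refl)
      by_cases h2 : a = v ∧ c = u
      · exact .inr (h2.1 ▸ .refl)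
      exact ih.imp (.head ⟨hac, h1, h2⟩) (.head ⟨hac, h1, h2⟩)
  -- A vertex reached from both `u` and `v` could be continued to `u` or to `v`, which would connect
  -- the two after all. So the sets reached from `u` and from `v` partition the vertices, and the
  -- first one is the side of the cut.
  have hdisj : ∀ w, ReflTransGen D' u w → ¬ ReflTransGen D' v w := fun w h1 h2 =>
    (hto w).elim (fun h => hu (h2.trans h)) (fun h => hv (h1.trans h))
  refine ⟨{w | ReflTransGen D' u w}, .refl, hv, fun x hx y hy hxy => ?_⟩
  have hy' : ReflTransGen D' v y := (hfrom y).resolve_left hy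
  by_contra hne
  have hne' : ¬ (x = v ∧ y = u) := fun h => hv (h.1 ▸ hx)
  rcases hcov x y hxy with h | h
  · exact hy (ReflTransGen.tail hx ⟨h, hne, hne'⟩)
  · exact hdisj x hx (hy'.tail ⟨h, fun h => hne' h.symm, fun h => hne h.symm⟩)

/-- A connected finite graph can be oriented so that it is strongly connected, where only
bridges keep both directions. -/
lemma exists_strong_orientation [Finite V] (H : SimpleGraph V)
    (hc : ∀ x y, ReflTransGen H.Adj x y) :
    ∃ D : V → V → Prop, (∀ x y, D x y → H.Adj x y) ∧ (∀ x y, ReflTransGen D x y) ∧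
      ∀ u v, D u v → D v u → ∃ T : Set V, IsBridgeCut H T u v := by
  -- Robbins' theorem by minimality: start with all edges in both directions, and delete arcs as
  -- long as each edge keeps an arc and strong connectivity survives.
  let P : Set (V → V → Prop) := {D | (∀ x y, D x y → H.Adj x y) ∧
    (∀ x y, H.Adj x y → D x y ∨ D y x) ∧ ∀ x y, ReflTransGen D x y}
  have hP : P.Nonempty := ⟨H.Adj, fun _ _ h => h, fun _ _ h => .inl h, hc⟩
  obtain ⟨D, hD⟩ := (Set.toFinite P).exists_minimal hP
  obtain ⟨⟨hle, hcov, hstr⟩, hmin⟩ := hD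
  refine ⟨D, hle, hstr, fun u v huv hvu => ?_⟩
  have key : ∀ u v, D u v → D v u →
      ¬ ReflTransGen (fun x y => D x y ∧ ¬ (x = u ∧ y = v)) u v := by
    intro u v huv hvu h
    have hne : u ≠ v := (hle _ _ huv).ne
    have hmem : (fun x y => D x y ∧ ¬ (x = u ∧ y = v)) ∈ P := by
      refine ⟨fun x y hxy => hle _ _ hxy.1, fun x y hxy => ?_, fun x y => ?_⟩
      · by_cases h1 : x = u ∧ y = v
        · exact .inr ⟨by rw [h1.1, h1.2]; exact hvu, fun h2 => hne (h1.1.symm.trans h2.2)⟩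
        by_cases h2 : y = u ∧ x = v
        · exact .inl ⟨by rw [h2.1, h2.2]; exact hvu, h1⟩
        exact (hcov x y hxy).imp (⟨·, h1⟩) (⟨·, h2⟩)
      · refine reflTransGen_of_replace (fun a b hab => ?_) h (hstr x y)
        by_cases h1 : a = u ∧ b = v
        · exact .inr h1
        · exact .inl ⟨hab, h1⟩
    exact (hmin hmem (fun x y h => h.1) u v huv).2 ⟨rfl, rfl⟩
  exact exists_isBridgeCut_of_irredundant hcov hstr (key u v huv hvu) (key v u hvu huv)

lemma exists_walk_of_reflTransGen {G : SimpleGraph V} {D : V → V → Prop}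
    (hD : ∀ x y, D x y → G.Adj x y) {x y : V} (h : ReflTransGen D x y) :
    ∃ p : G.Walk x y, p.IsPath ∧ ∀ d ∈ p.darts, D d.fst d.snd := by
  classical
  obtain ⟨p, hp⟩ : ∃ p : G.Walk x y, ∀ d ∈ p.darts, D d.fst d.snd := by
    induction h using ReflTransGen.head_induction_on with
    | refl => exact ⟨.nil, by simp⟩
    | head hac _ ih =>
      obtain ⟨p, hp⟩ := ih
      refine ⟨.cons (hD _ _ hac) p, fun d hd => ?_⟩
      rw [SimpleGraph.Walk.darts_cons, List.mem_cons] at hd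
      rcases hd with rfl | hd
      · exact hac
      · exact hp d hd
  exact ⟨p.bypass, p.bypass_isPath, fun d hd => hp d (p.darts_bypass_subset_darts hd)⟩

lemma exists_dart_leaving {G : SimpleGraph V} {x y : V} (p : G.Walk x y) {T : Set V}
    (hx : x ∈ T) (hy : y ∉ T) : ∃ d ∈ p.darts, d.fst ∈ T ∧ d.snd ∉ T := by
  obtain ⟨d, hd, h⟩ := p.exists_boundary_dart T hx hy
  exact ⟨d, hd, h⟩

/-- A path crosses a single-edge cut at most once. -/
lemma endpoints_of_mem_darts {G H : SimpleGraph V} {T : Set V} {u v : V}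
    (hT : IsBridgeCut H T u v) {x y : V} (p : G.Walk x y) (hp : p.IsPath)
    (hpH : ∀ d ∈ p.darts, H.Adj d.fst d.snd)
    {d : G.Dart} (hd : d ∈ p.darts) (hd1 : d.fst = v) (hd2 : d.snd = u) : x ∉ T ∧ y ∈ T := by
  induction p with
  | nil => simp at hd
  | @cons a b c h q ih =>
    rw [SimpleGraph.Walk.cons_isPath_iff] at hp
    have hqH : ∀ d ∈ q.darts, H.Adj d.fst d.snd := fun d hd => hpH d (by simp [hd])
    rw [SimpleGraph.Walk.darts_cons, List.mem_cons] at hd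
    rcases hd with rfl | hd
    · simp only at hd1 hd2
      subst hd1 hd2
      refine ⟨hT.2.1, ?_⟩
      -- The rest of the path starts at `u` in `T`. Leaving `T` again would mean returning to `v`.
      by_contra hy
      obtain ⟨e, he, h1, h2⟩ := exists_dart_leaving q hT.1 hy
      have := hT.2.2 _ h1 _ h2 (hqH e he)
      exact hp.2 (this.2 ▸ q.dart_snd_mem_support_of_mem_darts he)
    · obtain ⟨h1, h2⟩ := ih hp.1 hqH hd
      refine ⟨fun ha => ?_, h2⟩
      have := hT.2.2 _ ha _ h1 (hpH ⟨(a, b), h⟩ (by simp))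
      exact hp.2 (by rw [this.1, ← hd2]; exact q.dart_snd_mem_support_of_mem_darts hd)

/-- If every single-edge cut of `H` separates `s` from `t`, there is an antisymmetric
orientation of `H` in which any two vertices are joined by a directed path, one way or the
other. -/
lemma exists_unilateral_orientation [Finite V] {G H : SimpleGraph V} (hHG : H ≤ G) {s t : V}
    (h1 : ∀ S : Set V, S.Nonempty → S ≠ Set.univ → ∃ x ∈ S, ∃ y ∉ S, H.Adj x y)
    (h2 : ∀ S : Set V, S.Nonempty → s ∉ S → t ∉ S → ∃ x ∈ S, ∃ y ∉ S, ∃ x' ∈ S, ∃ y' ∉ S,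
      H.Adj x y ∧ H.Adj x' y' ∧ ¬ (x = x' ∧ y = y')) :
    ∃ E : V → V → Prop, (∀ x y, E x y → H.Adj x y) ∧ (∀ x y, E x y → ¬ E y x) ∧
      ∀ x y, (∃ p : G.Walk x y, p.IsPath ∧ ∀ d ∈ p.darts, E d.fst d.snd) ∨
        ∃ p : G.Walk y x, p.IsPath ∧ ∀ d ∈ p.darts, E d.fst d.snd := by
  obtain ⟨D, hDH, hstr, hbr⟩ := exists_strong_orientation H (reflTransGen_of_forall_exists h1)
  -- An arc is a back arc if it crosses a bridge from the `t` side to the `s` side. The orientation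
  -- keeps the arcs of `D` that are not back arcs.
  let back : V → V → Prop := fun u v => ∃ T : Set V, IsBridgeCut H T v u ∧ s ∈ T ∧ t ∉ T
  have hsep : ∀ T u v, IsBridgeCut H T u v → s ∈ T ∨ t ∈ T := by
    intro T u v hT
    by_contra! hst
    obtain ⟨x, hx, y, hy, x', hx', y', hy', hxy, hxy', hne⟩ := h2 T ⟨u, hT.1⟩ hst.1 hst.2
    have e1 := hT.2.2 x hx y hy hxy
    have e2 := hT.2.2 x' hx' y' hy' hxy'
    exact hne ⟨e1.1.trans e2.1.symm, e1.2.trans e2.2.symm⟩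
  refine ⟨fun u v => D u v ∧ ¬ back u v, fun u v h => hDH _ _ h.1, fun u v huv hvu => ?_,
    fun x y => ?_⟩
  · obtain ⟨T, hT⟩ := hbr u v huv.1 hvu.1
    by_cases hs : s ∈ T
    · by_cases ht : t ∈ T
      · exact (hsep _ _ _ hT.compl).elim (fun h => h hs) (fun h => h ht)
      · exact hvu.2 ⟨T, hT, hs, ht⟩
    · have ht : t ∈ T := (hsep _ _ _ hT).resolve_left hs
      exact huv.2 ⟨Tᶜ, hT.compl, hs, fun h => h ht⟩
  · obtain ⟨p, hp, hpD⟩ := exists_walk_of_reflTransGen (fun x y h => hHG (hDH x y h)) (hstr x y)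
    obtain ⟨q, hq, hqD⟩ := exists_walk_of_reflTransGen (fun x y h => hHG (hDH x y h)) (hstr y x)
    by_contra! hcon
    obtain ⟨d, hd, hdE⟩ := hcon.1 p hp
    obtain ⟨e, he, heE⟩ := hcon.2 q hq
    obtain ⟨T, hT, hsT, htT⟩ : back d.fst d.snd := hdE (hpD d hd)
    obtain ⟨T', hT', hsT', htT'⟩ : back e.fst e.snd := heE (hqD e he)
    obtain ⟨hxT, hyT⟩ := endpoints_of_mem_darts hT p hp (fun d hd => hDH _ _ (hpD d hd)) hd rfl rfl
    obtain ⟨hyT', hxT'⟩ :=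
      endpoints_of_mem_darts hT' q hq (fun d hd => hDH _ _ (hqD d hd)) he rfl rfl
    -- The set `A \ B` avoids `s` and `t`, so two edges leave it. Each of them is the single edge of
    -- one of the two cuts, so both of these edges leave it.
    have key : ∀ {A B : Set V} {a b a' b' z : V}, IsBridgeCut H A a b → IsBridgeCut H B a' b' →
        s ∈ B → t ∉ A → z ∈ A → z ∉ B → a ∉ B ∧ a' ∈ A := by
      intro A B a b a' b' z hA hB hs ht hzA hzB
      obtain ⟨x, hx, y, hy, x', hx', y', hy', hxy, hxy', hne⟩ :=
        h2 (A \ B) ⟨z, hzA, hzB⟩ (fun h => h.2 hs) (fun h => ht h.1)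
      have type : ∀ x ∈ A \ B, ∀ y ∉ A \ B, H.Adj x y →
          (x = a ∧ y = b ∧ a ∉ B) ∨ (x = b' ∧ y = a' ∧ a' ∈ A) := by
        intro x hx y hy hxy
        by_cases hyA : y ∈ A
        · have hyB : y ∈ B := by by_contra h; exact hy ⟨hyA, h⟩
          have := hB.2.2 y hyB x hx.2 hxy.symm
          exact .inr ⟨this.2, this.1, this.1 ▸ hyA⟩
        · have := hA.2.2 x hx.1 y hyA hxy
          exact .inl ⟨this.1, this.2, this.1 ▸ hx.2⟩
      rcases type x hx y hy hxy with h | h <;> rcases type x' hx' y' hy' hxy' with h' | h'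
      · exact absurd ⟨h.1.trans h'.1.symm, h.2.1.trans h'.2.1.symm⟩ hne
      · exact ⟨h.2.2, h'.2.2⟩
      · exact ⟨h'.2.2, h.2.2⟩
      · exact absurd ⟨h.1.trans h'.1.symm, h.2.1.trans h'.2.1.symm⟩ hne
    -- A back arc on `p` and one on `q` put `y` in `T \ T'` and `x` in `T' \ T`. The two set
    -- differences then disagree on whether `e.snd` lies in `T`.
    exact (key hT' hT hsT htT' hxT' hxT).1 (key hT hT' hsT' htT hyT hyT').2

end Orientation

/-! ### From an orientation of a bipartite subgraph to a colouring with two colours -/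

section Colouring

lemma IsProperPath.reverse {K : Type*} {G : SimpleGraph V} {c : G.EdgeLabeling K} {u v : V}
    {p : G.Walk u v} (hp : IsProperPath c p) : IsProperPath c p.reverse := by
  refine ⟨hp.1.reverse, ?_⟩
  rw [SimpleGraph.Walk.darts_reverse, List.isChain_reverse, List.isChain_map]
  refine hp.2.imp fun d e h => ?_
  simpa only [SimpleGraph.Dart.edge_symm] using h.symm

/-- The bipartite subgraph of `G` formed by the edges whose ends get different signs. -/
def cutGraph (G : SimpleGraph V) (σ : V → Bool) : SimpleGraph V where
  Adj u v := G.Adj u v ∧ σ u ≠ σ v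
  symm := ⟨fun _ _ h => ⟨h.1.symm, h.2.symm⟩⟩
  loopless := ⟨fun _ h => h.2 rfl⟩

lemma cutGraph_le (G : SimpleGraph V) (σ : V → Bool) : cutGraph G σ ≤ G := fun _ _ h => h.1

/-- In an oriented bipartite graph, directed paths alternate between arcs leaving one side and
arcs leaving the other. -/
lemma exists_isProperConnected_of_orientation {G : SimpleGraph V} {σ : V → Bool}
    {E : V → V → Prop} (hE : ∀ x y, E x y → (cutGraph G σ).Adj x y) (hanti : ∀ x y, E x y → ¬ E y x)
    (hpath : ∀ x y, (∃ p : G.Walk x y, p.IsPath ∧ ∀ d ∈ p.darts, E d.fst d.snd) ∨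
        ∃ p : G.Walk y x, p.IsPath ∧ ∀ d ∈ p.darts, E d.fst d.snd) :
    ∃ c : G.EdgeLabeling (Fin 2), IsProperConnected c := by
  classical
  -- Edges that carry no arc also receive colour 1. No path that is used contains them.
  let c : G.EdgeLabeling (Fin 2) := fun e =>
    if ∃ u v, e.1 = s(u, v) ∧ σ u = true ∧ E u v then 0 else 1
  have hc : ∀ d : G.Dart, E d.fst d.snd →
      c ⟨d.edge, d.edge_mem⟩ = if σ d.fst = true then 0 else 1 := by
    intro d hd
    by_cases hσ : σ d.fst = true
    · simp only [c, hσ, if_true]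
      exact if_pos ⟨d.fst, d.snd, rfl, hσ, hd⟩
    · simp only [c, hσ]
      refine if_neg ?_
      rintro ⟨u, v, huv, hu, he⟩
      have huv' : s(d.fst, d.snd) = s(u, v) := huv
      rw [Sym2.eq_iff] at huv'
      rcases huv' with ⟨h1, h2⟩ | ⟨h1, h2⟩
      · exact hσ (h1 ▸ hu)
      · rw [← h1, ← h2] at he
        exact hanti _ _ hd he
  have hproper : ∀ {x y : V} (p : G.Walk x y), p.IsPath → (∀ d ∈ p.darts, E d.fst d.snd) →
      IsProperPath c p := by
    intro x y p hp hpE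
    refine ⟨hp, ?_⟩
    have hchain := p.isChain_dartAdj_darts
    have : p.darts.IsChain fun d e => (E d.fst d.snd ∧ E e.fst e.snd) ∧ G.DartAdj d e := by
      clear hp
      induction p with
      | nil => simp
      | cons h q ih =>
        cases q with
        | nil => simp
        | cons h' q' =>
          simp only [SimpleGraph.Walk.darts_cons, List.isChain_cons_cons] at hchain ih ⊢
          refine ⟨⟨⟨hpE ⟨(_, _), h⟩ (by simp), hpE ⟨(_, _), h'⟩ (by simp)⟩, hchain.1⟩, ?_⟩
          exact ih (fun d hd => hpE d (by simp at hd ⊢; tauto)) hchain.2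
    refine this.imp fun d e ⟨⟨hd, he⟩, hadj⟩ => ?_
    rw [hc d hd, hc e he]
    have h1 : d.snd = e.fst := hadj
    have h2 := (hE _ _ hd).2
    rw [h1] at h2
    cases hde : σ d.fst <;> cases hee : σ e.fst <;> simp_all
  refine ⟨c, fun u v _ => ?_⟩
  rcases hpath u v with ⟨p, hp, hpE⟩ | ⟨p, hp, hpE⟩
  · exact ⟨p, hproper p hp hpE⟩
  · exact ⟨p.reverse, (hproper p hp hpE).reverse⟩

end Colouring

end ProperConnection

namespace ProperConnection

open Finset

variable {V : Type*}

/-! ### Counting adjacent pairs between vertex sets -/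

section Counting

open scoped Classical in
/-- The number of pairs in `S × T` that are adjacent in `H`. -/
noncomputable def cnt (H : SimpleGraph V) (S T : Finset V) : ℕ :=
  #{p ∈ S ×ˢ T | H.Adj p.1 p.2}

variable {H : SimpleGraph V} {S S' T T' : Finset V}

lemma cnt_comm (H : SimpleGraph V) (S T : Finset V) : cnt H S T = cnt H T S := by
  classical
  refine card_bij (fun p _ => p.swap) ?_ ?_ ?_
  · rintro ⟨a, b⟩ h
    simp only [mem_filter, mem_product] at h ⊢
    exact ⟨⟨h.1.2, h.1.1⟩, h.2.symm⟩
  · rintro ⟨a, b⟩ _ ⟨c, d⟩ _ h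
    simpa [and_comm] using h
  · rintro ⟨a, b⟩ h
    simp only [mem_filter, mem_product] at h
    exact ⟨(b, a), by simp [h.1, h.2.symm], rfl⟩

lemma cnt_union_left [DecidableEq V] (H : SimpleGraph V) (h : Disjoint S S') (T : Finset V) :
    cnt H (S ∪ S') T = cnt H S T + cnt H S' T := by
  classical
  rw [cnt, cnt, cnt, ← card_union_of_disjoint]
  · congr 1; ext p; simp; tauto
  · rw [Finset.disjoint_left]
    intro p hp hp'
    simp only [mem_filter, mem_product] at hp hp'
    exact Finset.disjoint_left.1 h hp.1.1 hp'.1.1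

lemma cnt_union_right [DecidableEq V] (H : SimpleGraph V) (S : Finset V) (h : Disjoint T T') :
    cnt H S (T ∪ T') = cnt H S T + cnt H S T' := by
  rw [cnt_comm, cnt_union_left H h, cnt_comm H T, cnt_comm H T']

lemma cnt_mono {H' : SimpleGraph V} (hS : S ⊆ S') (hT : T ⊆ T')
    (h : ∀ x ∈ S, ∀ y ∈ T, H.Adj x y → H'.Adj x y) : cnt H S T ≤ cnt H' S' T' := by
  classical
  refine card_le_card fun p hp => ?_
  simp only [mem_filter, mem_product] at hp ⊢
  exact ⟨⟨hS hp.1.1, hT hp.1.2⟩, h _ hp.1.1 _ hp.1.2 hp.2⟩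

lemma cnt_congr {H' : SimpleGraph V} (h : ∀ x ∈ S, ∀ y ∈ T, H.Adj x y ↔ H'.Adj x y) :
    cnt H S T = cnt H' S T :=
  le_antisymm (cnt_mono subset_rfl subset_rfl fun x hx y hy => (h x hx y hy).1)
    (cnt_mono subset_rfl subset_rfl fun x hx y hy => (h x hx y hy).2)

lemma cnt_pos_iff : 1 ≤ cnt H S T ↔ ∃ x ∈ S, ∃ y ∈ T, H.Adj x y := by
  classical
  rw [cnt, Nat.one_le_iff_ne_zero, Finset.card_ne_zero]
  constructor
  · rintro ⟨p, hp⟩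
    simp only [mem_filter, mem_product] at hp
    exact ⟨p.1, hp.1.1, p.2, hp.1.2, hp.2⟩
  · rintro ⟨x, hx, y, hy, h⟩
    exact ⟨(x, y), by simp [hx, hy, h]⟩

lemma two_le_cnt_iff : 2 ≤ cnt H S T ↔ ∃ x ∈ S, ∃ y ∈ T, ∃ x' ∈ S, ∃ y' ∈ T,
    H.Adj x y ∧ H.Adj x' y' ∧ ¬ (x = x' ∧ y = y') := by
  classical
  rw [cnt, show 2 = 1 + 1 from rfl, Nat.add_one_le_iff, Finset.one_lt_card]
  constructor
  · rintro ⟨p, hp, q, hq, hne⟩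
    simp only [mem_filter, mem_product] at hp hq
    exact ⟨p.1, hp.1.1, p.2, hp.1.2, q.1, hq.1.1, q.2, hq.1.2, hp.2, hq.2,
      fun h => hne (Prod.ext h.1 h.2)⟩
  · rintro ⟨x, hx, y, hy, x', hx', y', hy', h, h', hne⟩
    exact ⟨(x, y), by simp [hx, hy, h], (x', y'), by simp [hx', hy', h'],
      fun h => hne ⟨congrArg Prod.fst h, congrArg Prod.snd h⟩⟩

lemma three_le_cnt {x y x' y' x'' y'' : V} (hx : x ∈ S) (hy : y ∈ T) (hx' : x' ∈ S) (hy' : y' ∈ T)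
    (hx'' : x'' ∈ S) (hy'' : y'' ∈ T) (h : H.Adj x y) (h' : H.Adj x' y') (h'' : H.Adj x'' y'')
    (h1 : ¬ (x = x' ∧ y = y')) (h2 : ¬ (x = x'' ∧ y = y'')) (h3 : ¬ (x' = x'' ∧ y' = y'')) :
    3 ≤ cnt H S T := by
  classical
  have : ({(x, y), (x', y'), (x'', y'')} : Finset (V × V)) ⊆ {p ∈ S ×ˢ T | H.Adj p.1 p.2} := by
    intro p hp
    simp only [mem_insert, mem_singleton] at hp
    rcases hp with rfl | rfl | rfl <;> simp [*]
  have hcard := card_le_card this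
  rw [card_eq_three.2 ⟨(x, y), (x', y'), (x'', y''), by simpa using h1, by simpa using h2,
    by simpa using h3, rfl⟩] at hcard
  exact hcard

/-- Submodularity of the cut function. -/
lemma cnt_inter_add_cnt_union_le [Fintype V] [DecidableEq V] (H : SimpleGraph V)
    (A B : Finset V) :
    cnt H (A ∩ B) (A ∩ B)ᶜ + cnt H (A ∪ B) (A ∪ B)ᶜ ≤ cnt H A Aᶜ + cnt H B Bᶜ := by
  set I := A ∩ B with hI
  set P := A \ B with hP
  set Q := B \ A with hQ
  set O := (A ∪ B)ᶜ with hO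
  have d1 : Disjoint I P := by rw [Finset.disjoint_left]; simp +contextual [hI, hP]
  have d2 : Disjoint I Q := by rw [Finset.disjoint_left]; simp +contextual [hI, hQ]
  have d3 : Disjoint Q O := by rw [Finset.disjoint_left]; simp +contextual [hQ, hO]
  have d4 : Disjoint P O := by rw [Finset.disjoint_left]; simp +contextual [hP, hO]
  have d5 : Disjoint P (Q ∪ O) := by
    rw [Finset.disjoint_left]; simp +contextual [hP, hQ, hO]
  have d6 : Disjoint I (P ∪ Q) := by
    rw [Finset.disjoint_left]; simp +contextual [hI, hP, hQ]
  have d7 : Disjoint P Q := by rw [Finset.disjoint_left]; simp +contextual [hP, hQ]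
  have eA : A = I ∪ P := by ext x; simp [hI, hP]; tauto
  have eB : B = I ∪ Q := by ext x; simp [hI, hQ]; tauto
  have eAc : Aᶜ = Q ∪ O := by ext x; simp [hQ, hO]; tauto
  have eBc : Bᶜ = P ∪ O := by ext x; simp [hP, hO]; tauto
  have eIc : Iᶜ = P ∪ (Q ∪ O) := by ext x; simp [hI, hP, hQ, hO]; tauto
  have eU : A ∪ B = I ∪ (P ∪ Q) := by ext x; simp [hI, hP, hQ]; tauto
  rw [eIc, eAc, eBc, eU, cnt_union_right H I d5, cnt_union_right H I d3, cnt_union_left H d6,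
    cnt_union_left H d7, eA, eB, cnt_union_left H d1, cnt_union_left H d2,
    cnt_union_right H _ d3, cnt_union_right H _ d3, cnt_union_right H _ d4,
    cnt_union_right H _ d4]
  omega

end Counting

/-! ### Linked sets, blocks and gluing -/

section Linked

variable [DecidableEq V] {G : SimpleGraph V}

/-- The cut graph of `σ` on `U` is connected and each of its bridges separates `s` from `t`. -/
def LinkedBy (G : SimpleGraph V) (σ : V → Bool) (U : Finset V) (s t : V) : Prop :=
  (∀ S ⊆ U, S.Nonempty → S ≠ U → 1 ≤ cnt (cutGraph G σ) S (U \ S)) ∧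
  ∀ S ⊆ U, S.Nonempty → s ∉ S → t ∉ S → 2 ≤ cnt (cutGraph G σ) S (U \ S)

/-- On the vertex set `U`, some spanning bipartite subgraph of `G` is connected and has all its
bridges between `s` and `t`. -/
def Linked (G : SimpleGraph V) (U : Finset V) (s t : V) : Prop :=
  s ∈ U ∧ t ∈ U ∧ ∃ σ : V → Bool, LinkedBy G σ U s t

/-- Some spanning bipartite subgraph of `G` on `U` is connected and bridgeless. -/
def Block (G : SimpleGraph V) (U : Finset V) : Prop :=
  ∃ σ : V → Bool, ∀ S ⊆ U, S.Nonempty → S ≠ U → 2 ≤ cnt (cutGraph G σ) S (U \ S)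

/-- Without bridges there is nothing to separate, so both terminals are free. Hence a block can be
entered and left anywhere when sets are chained. -/
lemma Block.linked {U : Finset V} (h : Block G U) {s t : V} (hs : s ∈ U) (ht : t ∈ U) :
    Linked G U s t := by
  obtain ⟨σ, h⟩ := h
  exact ⟨hs, ht, σ, fun S hS h1 h2 => one_le_two.trans (h S hS h1 h2),
    fun S hS h1 h2 _ => h S hS h1 (fun h => h2 (h ▸ hs))⟩

lemma Linked.symm {U : Finset V} {s t : V} (h : Linked G U s t) : Linked G U t s := by
  obtain ⟨hs, ht, σ, h1, h2⟩ := h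
  exact ⟨ht, hs, σ, h1, fun S hS hne h h' => h2 S hS hne h' h⟩

lemma linked_singleton (G : SimpleGraph V) (v : V) : Linked G {v} v v := by
  refine ⟨by simp, by simp, fun _ => true, fun S hS h1 h2 => ?_, fun S hS h1 h2 => ?_⟩
  · exact absurd ((subset_singleton_iff.1 hS).resolve_left h1.ne_empty) h2
  · rw [(subset_singleton_iff.1 hS).resolve_left h1.ne_empty] at h2
    simp at h2

/-- Two linked vertex sets joined by an edge are linked. -/
theorem Linked.glue {U U' : Finset V} {s t s' t' : V} (h : Linked G U s t)
    (h' : Linked G U' s' t') (hd : Disjoint U U') (hadj : G.Adj t s') :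
    Linked G (U ∪ U') s t' := by
  obtain ⟨hs, ht, σ, h1, h2⟩ := h
  obtain ⟨hs', ht', σ', h1', h2'⟩ := h'
  have hU' : ∀ x ∈ U', x ∉ U := fun x hx hx' => Finset.disjoint_left.1 hd hx' hx
  -- On `U'` the signs of `σ'` are kept or all reversed, whichever makes `t` and `s'` get opposite
  -- signs. Cut edges inside `U'` stay cut edges.
  let τ : V → Bool := fun v => if v ∈ U then σ v else ((σ' v).xor ((σ t).xor (σ' s')).not)
  have hτ : ∀ x ∈ U, ∀ y ∈ U, (cutGraph G σ).Adj x y → (cutGraph G τ).Adj x y := by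
    intro x hx y hy hxy
    exact ⟨hxy.1, by simpa [τ, hx, hy] using hxy.2⟩
  have hτ' : ∀ x ∈ U', ∀ y ∈ U', (cutGraph G σ').Adj x y → (cutGraph G τ).Adj x y := by
    intro x hx y hy hxy
    exact ⟨hxy.1, by simpa [τ, hU' x hx, hU' y hy] using hxy.2⟩
  have hτt : (cutGraph G τ).Adj t s' := by
    refine ⟨hadj, ?_⟩
    simp only [τ, ht, hU' s' hs', if_true, if_false]
    cases σ t <;> cases σ' s' <;> simp
  set K := cutGraph G τ
  -- The edges leaving `S` split into those inside `U`, those inside `U'` and those between the two.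
  have hsub : ∀ S ⊆ U ∪ U', cnt (cutGraph G σ) (S ∩ U) (U \ (S ∩ U)) +
      cnt (cutGraph G σ') (S ∩ U') (U' \ (S ∩ U')) + cnt K (S ∩ U) (U' \ (S ∩ U')) +
      cnt K (S ∩ U') (U \ (S ∩ U)) ≤ cnt K S ((U ∪ U') \ S) := by
    intro S hS
    have e1 : S = (S ∩ U) ∪ (S ∩ U') := by
      rw [← Finset.inter_union_distrib_left, Finset.inter_eq_left.2 hS]
    have e2 : (U ∪ U') \ S = (U \ (S ∩ U)) ∪ (U' \ (S ∩ U')) := by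
      ext x; simp; tauto
    have d1 : Disjoint (S ∩ U) (S ∩ U') := hd.mono inter_subset_right inter_subset_right
    have d2 : Disjoint (U \ (S ∩ U)) (U' \ (S ∩ U')) := hd.mono sdiff_subset sdiff_subset
    have hA := cnt_mono (H := cutGraph G σ) (H' := K) (Subset.refl (S ∩ U))
      (Subset.refl (U \ (S ∩ U))) (fun x hx y hy =>
        hτ x (inter_subset_right hx) y (sdiff_subset hy))
    have hB := cnt_mono (H := cutGraph G σ') (H' := K) (Subset.refl (S ∩ U'))
      (Subset.refl (U' \ (S ∩ U'))) (fun x hx y hy =>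
        hτ' x (inter_subset_right hx) y (sdiff_subset hy))
    have : cnt K S ((U ∪ U') \ S) = cnt K ((S ∩ U) ∪ (S ∩ U'))
        ((U \ (S ∩ U)) ∪ (U' \ (S ∩ U'))) := by rw [← e1, e2]
    rw [this, cnt_union_left K d1, cnt_union_right K _ d2, cnt_union_right K _ d2]
    omega
  have hcross : ∀ S, t ∈ S → s' ∉ S → 1 ≤ cnt K (S ∩ U) (U' \ (S ∩ U')) := fun S h h' =>
    cnt_pos_iff.2 ⟨t, by simp [h, ht], s', by simp [h', hs'], hτt⟩
  have hcross' : ∀ S, t ∉ S → s' ∈ S → 1 ≤ cnt K (S ∩ U') (U \ (S ∩ U)) := fun S h h' =>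
    cnt_pos_iff.2 ⟨s', by simp [h', hs'], t, by simp [h, ht], hτt.symm⟩
  have hpos : ∀ S x y, x ∈ U → y ∈ U → x ∈ S → y ∉ S →
      1 ≤ cnt (cutGraph G σ) (S ∩ U) (U \ (S ∩ U)) := fun S x y hx hy hxS hyS =>
    h1 _ inter_subset_right ⟨x, by simp [hx, hxS]⟩ (fun h => hyS (by
      rw [← h] at hy; exact inter_subset_left hy))
  have hpos' : ∀ S x y, x ∈ U' → y ∈ U' → x ∈ S → y ∉ S →
      1 ≤ cnt (cutGraph G σ') (S ∩ U') (U' \ (S ∩ U')) := fun S x y hx hy hxS hyS =>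
    h1' _ inter_subset_right ⟨x, by simp [hx, hxS]⟩ (fun h => hyS (by
      rw [← h] at hy; exact inter_subset_left hy))
  refine ⟨by simp [hs], by simp [ht'], τ, fun S hS hne hne' => ?_, fun S hS hne hsS htS => ?_⟩
  · change 1 ≤ cnt K S _
    have := hsub S hS
    by_contra hlt
    have hz1 : ∀ x ∈ U, ∀ y ∈ U, x ∈ S → y ∈ S := by
      intro x hx y hy hxS
      by_contra hyS
      have := hpos S x y hx hy hxS hyS
      omega
    have hz2 : ∀ x ∈ U', ∀ y ∈ U', x ∈ S → y ∈ S := by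
      intro x hx y hy hxS
      by_contra hyS
      have := hpos' S x y hx hy hxS hyS
      omega
    have hts : t ∈ S ↔ s' ∈ S := by
      by_contra hcon
      by_cases h3 : t ∈ S
      · have := hcross S h3 (by tauto); omega
      · have := hcross' S h3 (by tauto); omega
    obtain ⟨x, hx⟩ := hne
    have hall : t ∈ S := by
      rcases mem_union.1 (hS hx) with h3 | h3
      · exact hz1 x h3 t ht hx
      · exact hts.2 (hz2 x h3 s' hs' hx)
    refine hne' (Subset.antisymm hS fun y hy => ?_)
    rcases mem_union.1 hy with h3 | h3
    · exact hz1 t ht y h3 hall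
    · exact hz2 s' hs' y h3 (hts.1 hall)
  · change 2 ≤ cnt K S _
    have hle := hsub S hS
    -- If `t` is in `S` and `s` is not, one edge leaves inside `U`. A second one is found inside
    -- `U'` or is the gluing edge, according to whether `s'` is in `S`.
    by_cases h3 : t ∈ S
    · have e1 := hpos S t s ht hs h3 hsS
      by_cases h4 : s' ∈ S
      · have := hpos' S s' t' hs' ht' h4 htS
        omega
      · have := hcross S h3 h4
        omega
    · by_cases h5 : (S ∩ U).Nonempty
      · have := h2 (S ∩ U) inter_subset_right h5 (by simp [hsS]) (by simp [h3])
        omega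
      · have h6 : (S ∩ U').Nonempty := by
          obtain ⟨x, hx⟩ := hne
          rcases mem_union.1 (hS hx) with h7 | h7
          · exact absurd ⟨x, by simp [hx, h7]⟩ h5
          · exact ⟨x, by simp [hx, h7]⟩
        by_cases h4 : s' ∈ S
        · have := hpos' S s' t' hs' ht' h4 htS
          have := hcross' S h3 h4
          omega
        · have := h2' (S ∩ U') inter_subset_right h6 (by simp [h4]) (by simp [htS])
          omega

lemma Linked.extend {U : Finset V} {s t y : V} (h : Linked G U s t) (hy : y ∉ U)
    (hadj : G.Adj t y) : Linked G (insert y U) s y := by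
  have := h.glue (linked_singleton G y) (by simpa using hy) hadj
  rwa [union_comm, ← insert_eq] at this

/-- A complete bipartite graph with parts `{p, q}` and `Y`, where `2 ≤ |Y|`, is a block. -/
lemma block_of_common_neighbors {p q : V} {Y : Finset V} (hpq : p ≠ q) (hY : 2 ≤ #Y)
    (hp : ∀ y ∈ Y, G.Adj p y) (hq : ∀ y ∈ Y, G.Adj q y) : Block G (insert p (insert q Y)) := by
  have hpY : p ∉ Y := fun h => (hp p h).ne rfl
  have hqY : q ∉ Y := fun h => (hq q h).ne rfl
  set σ : V → Bool := fun v => decide (v = p ∨ v = q)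
  have hy : ∀ y ∈ Y, σ y = false := by
    intro y hy
    have h1 : y ≠ p := fun h => hpY (h ▸ hy)
    have h2 : y ≠ q := fun h => hqY (h ▸ hy)
    simp [σ, h1, h2]
  have hpa : ∀ y ∈ Y, (cutGraph G σ).Adj p y := fun y h => ⟨hp y h, by rw [hy y h]; simp [σ]⟩
  have hqa : ∀ y ∈ Y, (cutGraph G σ).Adj q y := fun y h => ⟨hq y h, by rw [hy y h]; simp [σ]⟩
  -- It suffices to treat sets containing `p`, since the number of crossing edges is the same for
  -- the complement. If `q` is in `S` too, a missing vertex of `Y` sends edges to both. Otherwise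
  -- each vertex of `Y` contributes an edge of its own.
  have main : ∀ S ⊆ insert p (insert q Y), p ∈ S → S ≠ insert p (insert q Y) →
      2 ≤ cnt (cutGraph G σ) S (insert p (insert q Y) \ S) := by
    intro S hS hpS hne
    rw [two_le_cnt_iff]
    by_cases hqS : q ∈ S
    · obtain ⟨y, hyU, hyS⟩ := Finset.exists_of_ssubset (lt_of_le_of_ne hS hne)
      have hyY : y ∈ Y := by
        simp only [mem_insert] at hyU
        rcases hyU with rfl | rfl | h
        · exact absurd hpS hyS
        · exact absurd hqS hyS
        · exact h
      exact ⟨p, hpS, y, by simp [hyY, hyS], q, hqS, y, by simp [hyY, hyS], hpa y hyY, hqa y hyY,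
        fun h => hpq h.1⟩
    · obtain ⟨y, hyY, z, hzY, hyz⟩ := Finset.one_lt_card.1 hY
      have aux : ∀ y ∈ Y, ∃ x ∈ S, ∃ x' ∈ insert p (insert q Y) \ S, (cutGraph G σ).Adj x x' ∧
          (x = y ∨ x' = y) := by
        intro y hyY
        by_cases hyS : y ∈ S
        · exact ⟨y, hyS, q, by simp [hqS], (hqa y hyY).symm, .inl rfl⟩
        · exact ⟨p, hpS, y, by simp [hyY, hyS], hpa y hyY, .inr rfl⟩
      obtain ⟨a, ha, a', ha', haa, h1⟩ := aux y hyY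
      obtain ⟨b, hb, b', hb', hbb, h2⟩ := aux z hzY
      refine ⟨a, ha, a', ha', b, hb, b', hb', haa, hbb, ?_⟩
      rintro ⟨rfl, rfl⟩
      have := haa.2
      rcases h1 with rfl | rfl <;> rcases h2 with rfl | rfl
      · exact hyz rfl
      · exact this ((hy _ hyY).trans (hy _ hzY).symm)
      · exact this ((hy _ hzY).trans (hy _ hyY).symm)
      · exact hyz rfl
  refine ⟨σ, fun S hS hne hne' => ?_⟩
  by_cases hpS : p ∈ S
  · exact main S hS hpS hne'
  · have := main (insert p (insert q Y) \ S) sdiff_subset (by simp [hpS]) (by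
      intro h
      obtain ⟨x, hx⟩ := hne
      have := hS hx
      rw [← h] at this
      simp [hx] at this)
    rwa [Finset.sdiff_sdiff_eq_self hS, cnt_comm] at this

/-- A `6`-cycle is a block. -/
lemma block_hexagon {f : Fin 6 → V} (hf : Function.Injective f)
    (hadj : ∀ i, G.Adj (f i) (f (i + 1))) : Block G (univ.image f) := by
  set σ : V → Bool := fun x => decide (∃ i, f i = x ∧ i.val % 2 = 0) with hσ
  have hσf : ∀ i, σ (f i) = decide (i.val % 2 = 0) := by
    intro i
    simp only [hσ, decide_eq_decide]
    exact ⟨fun ⟨j, hj, h⟩ => hf hj ▸ h, fun h => ⟨i, rfl, h⟩⟩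
  have hcut : ∀ i, (cutGraph G σ).Adj (f i) (f (i + 1)) := by
    refine fun i => ⟨hadj i, ?_⟩
    rw [hσf, hσf]
    revert i; decide
  -- A non-constant cyclic sequence of two values changes at least twice.
  have hcyc : ∀ m : Fin 6 → Bool, (∀ i, m i = m 0) ∨
      ∃ i j, i ≠ j ∧ m i ≠ m (i + 1) ∧ m j ≠ m (j + 1) := by decide
  -- Adjacent pairs are ordered, so two steps of the cycle must not be the same edge read in
  -- opposite directions. That would need `2 = 0` modulo 6.
  have hedge : ∀ i j : Fin 6, i ≠ j → ¬ (i = j + 1 ∧ i + 1 = j) := by decide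
  refine ⟨σ, fun S hS hne hne' => ?_⟩
  have hmem : ∀ i, f i ∈ univ.image f := fun i => mem_image_of_mem f (mem_univ i)
  rcases hcyc (fun i => decide (f i ∈ S)) with hall | ⟨i, j, hij, hi, hj⟩
  · simp only [decide_eq_decide] at hall
    obtain ⟨x, hx⟩ := hne
    obtain ⟨i, -, rfl⟩ := mem_image.1 (hS hx)
    refine absurd (Subset.antisymm hS fun y hy => ?_) hne'
    obtain ⟨j, -, rfl⟩ := mem_image.1 hy
    exact (hall j).2 ((hall i).1 hx)
  · have aux : ∀ i, decide (f i ∈ S) ≠ decide (f (i + 1) ∈ S) → ∃ z ∈ S,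
        ∃ z' ∈ univ.image f \ S, (cutGraph G σ).Adj z z' ∧
          (z = f i ∧ z' = f (i + 1) ∨ z = f (i + 1) ∧ z' = f i) := by
      intro i hi
      by_cases h : f i ∈ S
      · have h' : f (i + 1) ∉ S := by simpa [h] using hi
        exact ⟨_, h, _, mem_sdiff.2 ⟨hmem _, h'⟩, hcut i, .inl ⟨rfl, rfl⟩⟩
      · have h' : f (i + 1) ∈ S := by simpa [h] using hi
        exact ⟨_, h', _, mem_sdiff.2 ⟨hmem _, h⟩, (hcut i).symm, .inr ⟨rfl, rfl⟩⟩
    obtain ⟨z, hz, z', hz', hzz, h1⟩ := aux i hi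
    obtain ⟨t, ht, t', ht', htt, h2⟩ := aux j hj
    refine two_le_cnt_iff.2 ⟨z, hz, z', hz', t, ht, t', ht', hzz, htt, ?_⟩
    rintro ⟨rfl, rfl⟩
    rcases h1 with ⟨e1, e2⟩ | ⟨e1, e2⟩ <;> rcases h2 with ⟨e3, e4⟩ | ⟨e3, e4⟩
    · exact hij (hf (e1.symm.trans e3))
    · exact hedge i j hij ⟨hf (e1.symm.trans e3), hf (e2.symm.trans e4)⟩
    · exact hedge i j hij ⟨hf (e2.symm.trans e4), hf (e1.symm.trans e3)⟩
    · exact hij (hf (e2.symm.trans e4))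

variable [Fintype V]

/-- A linked graph has a proper connected edge-colouring with two colours. -/
theorem Linked.exists_isProperConnected {s t : V} (h : Linked G univ s t) :
    ∃ c : G.EdgeLabeling (Fin 2), IsProperConnected c := by
  classical
  obtain ⟨-, -, σ, h1, h2⟩ := h
  obtain ⟨E, hE, hanti, hpath⟩ := exists_unilateral_orientation (cutGraph_le G σ) (s := s) (t := t)
    (fun S hS hS' => by
      have := h1 S.toFinset (subset_univ _) (by simpa using hS) (by simpa using hS')
      obtain ⟨x, hx, y, hy, hxy⟩ := cnt_pos_iff.1 this
      exact ⟨x, by simpa using hx, y, by simpa using hy, hxy⟩)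
    (fun S hS hs ht => by
      have := h2 S.toFinset (subset_univ _) (by simpa using hS) (by simpa using hs)
        (by simpa using ht)
      obtain ⟨x, hx, y, hy, x', hx', y', hy', hh⟩ := two_le_cnt_iff.1 this
      exact ⟨x, by simpa using hx, y, by simpa using hy, x', by simpa using hx', y',
        by simpa using hy', hh⟩)
  exact exists_isProperConnected_of_orientation hE hanti hpath

end Linked

end ProperConnection

namespace ProperConnection

open Finset

variable {V : Type*} [DecidableEq V]

/-! ### Maximum cuts -/

section MaxCut

/-- Change the sign of all vertices in `S`. -/
def flipOn (σ : V → Bool) (S : Finset V) (v : V) : Bool := if v ∈ S then !σ v else σ v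

variable {G : SimpleGraph V} {σ : V → Bool}

lemma cutGraph_flipOn_adj_iff_of_mem_iff {S : Finset V} {x y : V} (h : x ∈ S ↔ y ∈ S) :
    (cutGraph G (flipOn σ S)).Adj x y ↔ (cutGraph G σ).Adj x y := by
  by_cases hx : x ∈ S
  · simp [cutGraph, flipOn, hx, h.1 hx]
  · simp [cutGraph, flipOn, hx, mt h.2 hx]

lemma cutGraph_flipOn_adj_iff_of_mem {S : Finset V} {x y : V} (hx : x ∈ S) (hy : y ∉ S) :
    (cutGraph G (flipOn σ S)).Adj x y ↔ G.Adj x y ∧ ¬ (cutGraph G σ).Adj x y := by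
  simp only [cutGraph, flipOn, hx, hy, if_true, if_false]
  cases σ x <;> cases σ y <;> simp

lemma cnt_flipOn_add_cnt (S T : Finset V) (hST : Disjoint S T) :
    cnt (cutGraph G (flipOn σ S)) S T + cnt (cutGraph G σ) S T = cnt G S T := by
  classical
  rw [cnt, cnt, cnt, ← card_union_of_disjoint]
  · congr 1
    ext ⟨x, y⟩
    simp only [mem_union, mem_filter, mem_product]
    constructor
    · rintro (h | h)
      · exact ⟨h.1, h.2.1⟩
      · exact ⟨h.1, h.2.1⟩
    · rintro ⟨⟨hx, hy⟩, h⟩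
      rw [cutGraph_flipOn_adj_iff_of_mem hx (fun h => Finset.disjoint_left.1 hST h hy)]
      tauto
  · rw [Finset.disjoint_left]
    rintro ⟨x, y⟩ h h'
    simp only [mem_filter, mem_product] at h h'
    rw [cutGraph_flipOn_adj_iff_of_mem h.1.1 (fun h'' => Finset.disjoint_left.1 hST h'' h.1.2)] at h
    exact h.2.2 h'.2

variable [Fintype V]

/-- The count runs over ordered pairs, so an edge between `S` and its complement is seen twice. -/
lemma cnt_univ (H : SimpleGraph V) (S : Finset V) :
    cnt H univ univ = cnt H S S + 2 * cnt H S Sᶜ + cnt H Sᶜ Sᶜ := by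
  have hd : Disjoint S Sᶜ := disjoint_compl_right
  have : cnt H univ univ = cnt H (S ∪ Sᶜ) (S ∪ Sᶜ) := by rw [union_compl]
  rw [this, cnt_union_left H hd, cnt_union_right H _ hd, cnt_union_right H _ hd, cnt_comm H Sᶜ S]
  omega

/-- The cut of `G` given by `σ` has the maximum number of edges. -/
def IsMaxCut (G : SimpleGraph V) (σ : V → Bool) : Prop :=
  ∀ τ : V → Bool, cnt (cutGraph G τ) univ univ ≤ cnt (cutGraph G σ) univ univ

/-- Flipping `S` exchanges cut and non-cut edges between `S` and its complement and changes nothing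
else. The factors 4 and 2 come from counting ordered pairs. -/
lemma cnt_univ_flipOn (S : Finset V) :
    cnt (cutGraph G (flipOn σ S)) univ univ + 4 * cnt (cutGraph G σ) S Sᶜ =
      cnt (cutGraph G σ) univ univ + 2 * cnt G S Sᶜ := by
  have h1 := cnt_univ (cutGraph G (flipOn σ S)) S
  have h2 := cnt_univ (cutGraph G σ) S
  have h3 := cnt_flipOn_add_cnt (G := G) (σ := σ) S Sᶜ disjoint_compl_right
  have h4 : cnt (cutGraph G (flipOn σ S)) S S = cnt (cutGraph G σ) S S :=
    cnt_congr fun x hx y hy => cutGraph_flipOn_adj_iff_of_mem_iff (by simp [hx, hy])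
  have h5 : cnt (cutGraph G (flipOn σ S)) Sᶜ Sᶜ = cnt (cutGraph G σ) Sᶜ Sᶜ :=
    cnt_congr fun x hx y hy => cutGraph_flipOn_adj_iff_of_mem_iff (by
      rw [mem_compl] at hx hy; simp [hx, hy])
  omega

/-- If fewer than half of the edges leaving `S` were cut edges, flipping `S` would enlarge the cut.
-/
lemma IsMaxCut.cnt_le (h : IsMaxCut G σ) (S : Finset V) :
    cnt G S Sᶜ ≤ 2 * cnt (cutGraph G σ) S Sᶜ := by
  have h1 := h (flipOn σ S)
  have h2 := cnt_univ_flipOn (G := G) (σ := σ) S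
  omega

/-- If no more than half of the edges leaving `S` are cut edges, flipping `S` loses nothing. This
gives the freedom to choose among maximum cuts. -/
lemma IsMaxCut.flipOn (h : IsMaxCut G σ) {S : Finset V}
    (hS : 2 * cnt (cutGraph G σ) S Sᶜ ≤ cnt G S Sᶜ) : IsMaxCut G (flipOn σ S) := by
  intro τ
  have h1 := h τ
  have h2 := cnt_univ_flipOn (G := G) (σ := σ) S
  omega

open scoped Classical in
/-- The vertices of degree one in the cut graph. -/
noncomputable def leafSet (G : SimpleGraph V) (σ : V → Bool) : Finset V :=
  {v | ∃! w, (cutGraph G σ).Adj v w}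

/-- A maximum cut with as few vertices of degree one as possible. -/
def IsOptimalCut (G : SimpleGraph V) (σ : V → Bool) : Prop :=
  IsMaxCut G σ ∧ ∀ τ, IsMaxCut G τ → #(leafSet G σ) ≤ #(leafSet G τ)

lemma exists_isOptimalCut (G : SimpleGraph V) : ∃ σ, IsOptimalCut G σ := by
  classical
  obtain ⟨σ, hσ⟩ := Finite.exists_max fun σ : V → Bool => cnt (cutGraph G σ) univ univ
  obtain ⟨τ, hτ, hmin⟩ := Finset.exists_min_image (univ.filter (IsMaxCut G))
    (fun τ => #(leafSet G τ)) ⟨σ, by simpa [IsMaxCut] using hσ⟩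
  exact ⟨τ, by simpa using hτ, fun ρ hρ => hmin ρ (by simpa using hρ)⟩

lemma one_le_cnt_of_connected (hG : G.Connected) {S : Finset V} (hne : S.Nonempty)
    (hne' : S ≠ univ) : 1 ≤ cnt G S Sᶜ := by
  obtain ⟨x, hx⟩ := hne
  obtain ⟨y, hy⟩ : ∃ y, y ∉ S := by
    by_contra! h; exact hne' (eq_univ_iff_forall.2 h)
  obtain ⟨p⟩ := hG.preconnected x y
  obtain ⟨d, -, h1, h2⟩ := p.exists_boundary_dart (S : Set V) hx hy
  exact cnt_pos_iff.2 ⟨d.fst, h1, d.snd, by simpa using h2, d.adj⟩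

lemma IsMaxCut.one_le_cnt (h : IsMaxCut G σ) (hG : G.Connected) {S : Finset V}
    (hne : S.Nonempty) (hne' : S ≠ univ) : 1 ≤ cnt (cutGraph G σ) S Sᶜ := by
  have h1 := one_le_cnt_of_connected hG hne hne'
  have h2 := h.cnt_le S
  omega

end MaxCut

/-! ### Ends of the cut graph -/

section Ends

variable [Fintype V] {G H : SimpleGraph V} {σ : V → Bool}

/-- A minimal nonempty vertex set that only one edge of `H` leaves. -/
structure IsEnd (H : SimpleGraph V) (L : Finset V) : Prop where
  nonempty : L.Nonempty
  cnt_eq : cnt H L Lᶜ = 1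
  two_le : ∀ T ⊂ L, T.Nonempty → 2 ≤ cnt H T Tᶜ

lemma exists_isEnd_subset (hH : ∀ S : Finset V, S.Nonempty → S ≠ univ → 1 ≤ cnt H S Sᶜ)
    {S : Finset V} (hS : S.Nonempty) (hcnt : cnt H S Sᶜ = 1) : ∃ L ⊆ S, IsEnd H L := by
  induction S using Finset.strongInduction with
  | H S ih =>
    by_cases h : ∀ T ⊂ S, T.Nonempty → 2 ≤ cnt H T Tᶜ
    · exact ⟨S, subset_rfl, hS, hcnt, h⟩
    · push Not at h
      obtain ⟨T, hTS, hT, hlt⟩ := h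
      have := hH T hT (fun h => hTS.2 (h ▸ subset_univ S))
      obtain ⟨L, hL, hend⟩ := ih T hTS hT (by omega)
      exact ⟨L, hL.trans hTS.1, hend⟩

/-- If the ends met, at least two edges would leave the intersection, by minimality of `A`, and at
least one the union. Submodularity allows only `1 + 1` in total. -/
lemma IsEnd.disjoint (hH : ∀ S : Finset V, S.Nonempty → S ≠ univ → 1 ≤ cnt H S Sᶜ)
    {A B : Finset V} (hA : IsEnd H A) (hB : IsEnd H B) (hAB : ¬ A ⊆ B) (hu : A ∪ B ≠ univ) :
    Disjoint A B := by
  by_contra hd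
  have hne : (A ∩ B).Nonempty := by
    rwa [Finset.nonempty_iff_ne_empty, Ne, ← Finset.disjoint_iff_inter_eq_empty]
  have h1 := hA.two_le (A ∩ B) ⟨inter_subset_left, fun h => hAB (h.trans inter_subset_right)⟩ hne
  have h2 := hH (A ∪ B) (hA.nonempty.mono subset_union_left) hu
  have h3 := cnt_inter_add_cnt_union_le H A B
  have := hA.cnt_eq
  have := hB.cnt_eq
  omega

/-- If the cut graph of a maximum cut does not link `G`, then it has three disjoint ends. -/
lemma exists_three_isEnd (hG : G.Connected) (hσ : IsMaxCut G σ)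
    (hno : ∀ s t, ¬ Linked G univ s t) : ∃ A B C, IsEnd (cutGraph G σ) A ∧
      IsEnd (cutGraph G σ) B ∧ IsEnd (cutGraph G σ) C ∧ Disjoint A B ∧ Disjoint A C ∧
      Disjoint B C := by
  set H := cutGraph G σ
  have hH : ∀ S : Finset V, S.Nonempty → S ≠ univ → 1 ≤ cnt H S Sᶜ :=
    fun S h h' => hσ.one_le_cnt hG h h'
  have hfail : ∀ s t, ∃ S : Finset V, S.Nonempty ∧ s ∉ S ∧ t ∉ S ∧ cnt H S Sᶜ = 1 := by
    intro s t
    by_contra! hcon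
    refine hno s t ⟨mem_univ s, mem_univ t, σ, fun S _ h1 h2 => ?_, fun S _ h1 h2 h3 => ?_⟩
    · rw [← compl_eq_univ_sdiff]; exact hH S h1 h2
    · rw [← compl_eq_univ_sdiff]
      have h4 := hH S h1 (fun h => h2 (h ▸ mem_univ s))
      have h5 := hcon S h1 h2 h3
      change 2 ≤ cnt H S Sᶜ
      omega
  obtain ⟨v⟩ := hG.nonempty
  -- The choice `s = t = v` gives any bridge at all. Each of its two sides contains an end, and the
  -- failure for a pair of terminals in these ends provides the third.
  obtain ⟨S, hS, hvS, -, hcnt⟩ := hfail v v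
  obtain ⟨A, hAS, hA⟩ := exists_isEnd_subset hH hS hcnt
  obtain ⟨B, hBS, hB⟩ := exists_isEnd_subset hH (S := Sᶜ) ⟨v, by simpa using hvS⟩
    (by rw [compl_compl, cnt_comm]; exact hcnt)
  obtain ⟨s, hs⟩ := hA.nonempty
  obtain ⟨t, ht⟩ := hB.nonempty
  have hAB : Disjoint A B := disjoint_compl_right.mono hAS hBS
  obtain ⟨T, hT, hsT, htT, hcntT⟩ := hfail s t
  obtain ⟨C, hCT, hC⟩ := exists_isEnd_subset hH hT hcntT
  refine ⟨A, B, C, hA, hB, hC, hAB, hA.disjoint hH hC (fun h => hsT (hCT (h hs))) ?_,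
    hB.disjoint hH hC (fun h => htT (hCT (h ht))) ?_⟩
  · intro h
    have : t ∈ A ∪ C := h ▸ mem_univ t
    rcases mem_union.1 this with h' | h'
    · exact Finset.disjoint_left.1 hAB h' ht
    · exact htT (hCT h')
  · intro h
    have : s ∈ B ∪ C := h ▸ mem_univ s
    rcases mem_union.1 this with h' | h'
    · exact Finset.disjoint_left.1 hAB hs h'
    · exact hsT (hCT h')

/-- There is no edge between two disjoint sets that are both left by a single edge, unless they
cover everything. -/
lemma not_adj_of_cnt_eq_one (hH : ∀ S : Finset V, S.Nonempty → S ≠ univ → 1 ≤ cnt H S Sᶜ)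
    {A B : Finset V} (hA : cnt H A Aᶜ = 1) (hB : cnt H B Bᶜ = 1) (hd : Disjoint A B) {z : V}
    (hzA : z ∉ A) (hzB : z ∉ B) {x y : V} (hx : x ∈ A) (hy : y ∈ B) : ¬ H.Adj x y := by
  intro hxy
  set O := (A ∪ B)ᶜ with hO
  have dBO : Disjoint B O := by rw [Finset.disjoint_left]; simp +contextual [hO]
  have dAO : Disjoint A O := by rw [Finset.disjoint_left]; simp +contextual [hO]
  have eA : Aᶜ = B ∪ O := by
    ext v; have : v ∈ A → v ∉ B := fun h => Finset.disjoint_left.1 hd h; simp [hO]; tauto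
  have eB : Bᶜ = A ∪ O := by
    ext v; have : v ∈ A → v ∉ B := fun h => Finset.disjoint_left.1 hd h; simp [hO]; tauto
  rw [eA, cnt_union_right H _ dBO] at hA
  rw [eB, cnt_union_right H _ dAO, cnt_comm H B A] at hB
  have h1 : 1 ≤ cnt H A B := cnt_pos_iff.2 ⟨x, hx, y, hy, hxy⟩
  -- An edge from `A` to `B` would be the only one to leave either set, so none would leave the
  -- union.
  have h2 := hH (A ∪ B) ⟨x, by simp [hx]⟩ (fun h => by
    have : z ∈ A ∪ B := h ▸ mem_univ z
    simp [hzA, hzB] at this)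
  rw [← hO, cnt_union_left H hd] at h2
  omega

/-- The edge that leaves one of three disjoint ends goes to none of the others. -/
lemma IsEnd.exists_adj (hH : ∀ S : Finset V, S.Nonempty → S ≠ univ → 1 ≤ cnt H S Sᶜ)
    {A B C : Finset V} (hA : IsEnd H A) (hB : IsEnd H B) (hC : IsEnd H C) (hAB : Disjoint A B)
    (hAC : Disjoint A C) (hBC : Disjoint B C) :
    ∃ x ∈ A, ∃ r, r ∉ A ∧ r ∉ B ∧ r ∉ C ∧ H.Adj x r := by
  obtain ⟨x, hx, r, hr, hxr⟩ := cnt_pos_iff.1 hA.cnt_eq.ge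
  obtain ⟨b, hb⟩ := hB.nonempty
  obtain ⟨c, hc⟩ := hC.nonempty
  refine ⟨x, hx, r, by simpa using hr, fun h => ?_, fun h => ?_, hxr⟩
  · exact not_adj_of_cnt_eq_one hH hA.cnt_eq hB.cnt_eq hAB
      (fun h' => Finset.disjoint_left.1 hAC h' hc) (fun h' => Finset.disjoint_left.1 hBC h' hc)
      hx h hxr
  · exact not_adj_of_cnt_eq_one hH hA.cnt_eq hC.cnt_eq hAC
      (fun h' => Finset.disjoint_left.1 hAB h' hb) (fun h' => Finset.disjoint_left.1 hBC hb h')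
      hx h hxr

/-- At least two edges leave `T` and at least two leave `L \ T`, but only one edge leaves `L`. So
one of the two parts sends all its leaving edges to the other. -/
lemma IsEnd.two_le_inside {L : Finset V} (hL : IsEnd H L) {T : Finset V} (hT : T ⊆ L)
    (hne : T.Nonempty) (hne' : T ≠ L) : 2 ≤ cnt H T (L \ T) := by
  have hne2 : (L \ T).Nonempty := by
    rw [sdiff_nonempty]; exact fun h => hne' (Subset.antisymm hT h)
  have h1 := hL.two_le T (ssubset_of_subset_of_ne hT hne') hne
  have h2 := hL.two_le (L \ T) (sdiff_ssubset hT hne) hne2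
  have h3 := hL.cnt_eq
  have d1 : Disjoint (L \ T) Lᶜ := disjoint_compl_right.mono_left sdiff_subset
  have d2 : Disjoint T Lᶜ := disjoint_compl_right.mono_left hT
  have e1 : Tᶜ = (L \ T) ∪ Lᶜ := by
    ext v; have := @hT v; simp; tauto
  have e2 : (L \ T)ᶜ = T ∪ Lᶜ := by
    ext v; have := @hT v; simp; tauto
  have e3 : cnt H L Lᶜ = cnt H T Lᶜ + cnt H (L \ T) Lᶜ := by
    rw [← cnt_union_left H disjoint_sdiff, union_sdiff_of_subset hT]
  rw [e1, cnt_union_right H _ d1] at h1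
  rw [e2, cnt_union_right H _ d2, cnt_comm H _ T] at h2
  omega

lemma IsEnd.block {L : Finset V} (hL : IsEnd (cutGraph G σ) L) : Block G L :=
  ⟨σ, fun _ hS hne hne' => hL.two_le_inside hS hne hne'⟩

/-- In an end with more than one vertex, every vertex has two neighbours inside, all on the opposite
side of the bipartition. So each side has at least two vertices. -/
lemma IsEnd.card_eq_one_or {L : Finset V} (hL : IsEnd (cutGraph G σ) L) :
    (∃ a, L = {a}) ∨ 4 ≤ #L := by
  by_cases h : ∃ a, L = {a}
  · exact .inl h
  refine .inr ?_
  have hnb : ∀ x ∈ L, ∃ y ∈ L, ∃ z ∈ L, y ≠ z ∧ σ x ≠ σ y ∧ σ x ≠ σ z := by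
    intro x hx
    have h2 := hL.two_le_inside (T := {x}) (by simpa using hx) (by simp)
      (fun h' => h ⟨x, h'.symm⟩)
    obtain ⟨a, ha, y, hy, b, hb, z, hz, hay, hbz, hne⟩ := two_le_cnt_iff.1 h2
    rw [mem_singleton] at ha hb
    subst ha hb
    exact ⟨y, (mem_sdiff.1 hy).1, z, (mem_sdiff.1 hz).1, fun h => hne ⟨rfl, h⟩, hay.2, hbz.2⟩
  obtain ⟨x, hx⟩ := hL.nonempty
  obtain ⟨y, hy, z, hz, hyz, hxy, hxz⟩ := hnb x hx
  obtain ⟨p, hp, q, hq, hpq, hyp, hyq⟩ := hnb y hy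
  have hsub : ({y, z, p, q} : Finset V) ⊆ L := by
    intro v hv
    simp only [mem_insert, mem_singleton] at hv
    rcases hv with rfl | rfl | rfl | rfl <;> assumption
  refine le_trans (le_of_eq ?_) (card_le_card hsub)
  have hzy : σ z = σ y := by cases hh : σ x <;> simp_all
  have h1 : y ≠ p := fun h => hyp (h ▸ rfl)
  have h2 : y ≠ q := fun h => hyq (h ▸ rfl)
  have h3 : z ≠ p := fun h => hyp (by rw [← h, hzy])
  have h4 : z ≠ q := fun h => hyq (by rw [← h, hzy])
  simp [*]

lemma degree_eq_cnt [DecidableRel G.Adj] (a : V) : G.degree a = cnt G {a} {a}ᶜ := by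
  classical
  rw [← G.card_neighborFinset_eq_degree, cnt]
  refine card_bij (fun y _ => (a, y)) ?_ ?_ ?_
  · intro y hy
    rw [SimpleGraph.mem_neighborFinset] at hy
    simp [hy, hy.ne']
  · intro y _ z _ h
    exact congrArg Prod.snd h
  · rintro ⟨x, y⟩ h
    simp only [mem_filter, mem_product, mem_singleton, mem_compl] at h
    obtain ⟨⟨rfl, -⟩, h⟩ := h
    exact ⟨y, by simpa using h, rfl⟩

/-- A set with more vertices than edges leaving it has a vertex without outside neighbours. -/
lemma exists_interior {L : Finset V} (h : cnt G L Lᶜ < #L) :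
    ∃ x ∈ L, ∀ y, G.Adj x y → y ∈ L := by
  classical
  by_contra! hcon
  have : L ⊆ (((L ×ˢ Lᶜ).filter fun p : V × V => G.Adj p.1 p.2).image Prod.fst) := by
    intro x hx
    obtain ⟨y, hxy, hy⟩ := hcon x hx
    exact mem_image.2 ⟨(x, y), by simp [hx, hy, hxy], rfl⟩
  have h1 := (card_le_card this).trans card_image_le
  rw [cnt] at h
  have : #L ≤ #{p ∈ L ×ˢ Lᶜ | G.Adj p.1 p.2} := by convert h1
  exact absurd h (not_lt.2 (by convert this))

lemma degree_lt_card_of_interior {W : Type*} [Fintype W] {G : SimpleGraph W}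
    [DecidableRel G.Adj] {L : Finset W} {x : W} (hx : x ∈ L)
    (h : ∀ y, G.Adj x y → y ∈ L) : G.degree x < #L := by
  rw [← G.card_neighborFinset_eq_degree]
  refine card_lt_card ⟨fun y hy => h y (by simpa using hy), fun hL => ?_⟩
  simpa using hL hx

/-- In an optimal cut, two one-vertex ends are not adjacent if there is a third end. -/
lemma IsOptimalCut.not_adj (hσ : IsOptimalCut G σ) (hG : G.Connected) {a b : V} {L : Finset V}
    (ha : IsEnd (cutGraph G σ) {a}) (hb : IsEnd (cutGraph G σ) {b}) (hL : IsEnd (cutGraph G σ) L)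
    (hab : a ≠ b) (haL : a ∉ L) (hbL : b ∉ L) : ¬ G.Adj a b := by
  classical
  intro hadj
  set H := cutGraph G σ with hHdef
  have hH : ∀ S : Finset V, S.Nonempty → S ≠ univ → 1 ≤ cnt H S Sᶜ :=
    fun S h h' => hσ.1.one_le_cnt hG h h'
  obtain ⟨l, hl⟩ := hL.nonempty
  have hal : l ≠ a := fun h => haL (h ▸ hl)
  have hbl : l ≠ b := fun h => hbL (h ▸ hl)
  have habH : ¬ H.Adj a b := not_adj_of_cnt_eq_one hH ha.cnt_eq hb.cnt_eq (by simpa using hab)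
    (z := l) (by simpa using hal) (by simpa using hbl) (by simp) (by simp)
  -- A largest such set `S` pushes its bridge `x y` away from `a` until `y` has two cut neighbours
  -- beyond `S`. Then `y` does not become a leaf when `x y` is lost.
  let F : Finset (Finset V) :=
    univ.filter fun S => cnt H S Sᶜ = 1 ∧ a ∈ S ∧ b ∉ S ∧ Disjoint S L
  obtain ⟨S, hSF, hmax⟩ := Finset.exists_max_image F card
    ⟨{a}, by simp [F, ha.cnt_eq, hab.symm, haL]⟩
  simp only [F, mem_filter, mem_univ, true_and] at hSF
  obtain ⟨hS1, haS, hbS, hSL⟩ := hSF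
  obtain ⟨x, hx, y, hy, hxy⟩ := cnt_pos_iff.1 hS1.ge
  rw [mem_compl] at hy
  have huniq : ∀ x' ∈ S, ∀ y' ∉ S, H.Adj x' y' → x' = x ∧ y' = y := by
    intro x' hx' y' hy' h'
    by_contra hne
    have : 2 ≤ cnt H S Sᶜ := two_le_cnt_iff.2 ⟨x', hx', y', by simpa using hy', x, hx, y,
      by simpa using hy, h', hxy, hne⟩
    omega
  have hyb : y ≠ b := by
    rintro rfl
    exact not_adj_of_cnt_eq_one hH hS1 hb.cnt_eq (by simpa using hbS) (z := l)
      (fun h => Finset.disjoint_left.1 hSL h hl) (by simpa using hbl) hx (by simp) hxy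
  have hyL : y ∉ L := fun h =>
    not_adj_of_cnt_eq_one hH hS1 hL.cnt_eq hSL (z := b) hbS hbL hx h hxy
  obtain ⟨p, q, hp, hq, hpq⟩ : ∃ p q, H.Adj y p ∧ H.Adj y q ∧ p ≠ q ∧ p ≠ x ∧ q ≠ x := by
    have hne1 : cnt H (insert y S) (insert y S)ᶜ ≠ 1 := by
      intro h1
      have := hmax (insert y S) (by
        refine mem_filter.2 ⟨mem_univ _, h1, ?_⟩
        simp [haS, hbS, hyb.symm, Finset.disjoint_insert_left, hyL, hSL])
      rw [card_insert_of_notMem hy] at this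
      omega
    have h1 := hH (insert y S) ⟨y, by simp⟩ (fun h => by
      have : b ∈ insert y S := h ▸ mem_univ b
      simp [hbS, hyb.symm] at this)
    have h2 : 2 ≤ cnt H (insert y S) (insert y S)ᶜ := by omega
    obtain ⟨c, hc, p, hp, d, hd, q, hq, hcp, hdq, hne⟩ := two_le_cnt_iff.1 h2
    simp only [mem_insert, mem_compl, not_or] at hc hd hp hq
    have hcy : c = y := hc.resolve_right fun h => hp.1 (huniq c h p hp.2 hcp).2
    have hdy : d = y := hd.resolve_right fun h => hq.1 (huniq d h q hq.2 hdq).2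
    subst hcy hdy
    exact ⟨p, q, hcp, hdq, fun h => hne ⟨rfl, h⟩, fun h => hp.2 (h ▸ hx), fun h => hq.2 (h ▸ hx)⟩
  have hG2 : 2 ≤ cnt G S Sᶜ := two_le_cnt_iff.2 ⟨x, hx, y, by simpa using hy, a, haS, b,
    by simpa using hbS, hxy.1, hadj, fun h => hyb h.2⟩
  -- The edges of `G` leaving `S` are just `x y` and `a b`. Flipping `S` trades the first for the
  -- second and keeps the cut maximum.
  have hmaxcut : IsMaxCut G (flipOn σ S) := hσ.1.flipOn (by rw [hS1]; exact hG2)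
  have hcnt' : cnt (cutGraph G (flipOn σ S)) S Sᶜ ≤ 1 := by
    have h1 := hσ.1.cnt_le S
    have h2 := cnt_flipOn_add_cnt (G := G) (σ := σ) S Sᶜ disjoint_compl_right
    change _ + cnt H S Sᶜ = _ at h2
    change _ ≤ 2 * cnt H S Sᶜ at h1
    omega
  set H' := cutGraph G (flipOn σ S) with hH'
  have habH' : H'.Adj a b := (cutGraph_flipOn_adj_iff_of_mem haS hbS).2 ⟨hadj, habH⟩
  have huniq' : ∀ x' ∈ S, ∀ y' ∉ S, H'.Adj x' y' → x' = a ∧ y' = b := by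
    intro x' hx' y' hy' h'
    by_contra hne
    have : 2 ≤ cnt H' S Sᶜ := two_le_cnt_iff.2 ⟨x', hx', y', by simpa using hy', a, haS, b,
      by simpa using hbS, h', habH', hne⟩
    omega
  have hsame : ∀ v w, H.Adj v w → ¬ (v = x ∧ w = y) → ¬ (v = y ∧ w = x) → H'.Adj v w := by
    intro v w hvw h1 h2
    refine (cutGraph_flipOn_adj_iff_of_mem_iff ?_).2 hvw
    by_contra hcon
    by_cases hv : v ∈ S
    · exact h1 (huniq v hv w (by tauto) hvw)
    · exact h2 (huniq w (by tauto) v hv hvw.symm).symm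
  have hsame' : ∀ v w, H'.Adj v w → ¬ (v = a ∧ w = b) → ¬ (v = b ∧ w = a) → H.Adj v w := by
    intro v w hvw h1 h2
    refine (cutGraph_flipOn_adj_iff_of_mem_iff ?_).1 hvw
    by_contra hcon
    by_cases hv : v ∈ S
    · exact h1 (huniq' v hv w (by tauto) hvw)
    · exact h2 (huniq' w (by tauto) v hv hvw.symm).symm
  have hleaf : ∀ c, IsEnd H {c} → ∃! w, H.Adj c w := by
    intro c hc
    obtain ⟨c', hc', w, hw, hcw⟩ := cnt_pos_iff.1 hc.cnt_eq.ge
    rw [mem_singleton] at hc'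
    subst hc'
    refine ⟨w, hcw, fun w' hw' => ?_⟩
    by_contra hne
    have : 2 ≤ cnt H {c'} {c'}ᶜ := two_le_cnt_iff.2 ⟨c', by simp, w, hw, c', by simp, w',
      by simpa using hw'.ne', hcw, hw', fun h => hne h.2.symm⟩
    have := hc.cnt_eq
    omega
  obtain ⟨α, hα, -⟩ := hleaf a ha
  obtain ⟨β, hβ, -⟩ := hleaf b hb
  have hya : y ≠ a := fun h => hy (h ▸ haS)
  have hxb : x ≠ b := fun h => hbS (h ▸ hx)
  -- Only `x` can become a leaf, because `y` keeps `p` and `q`. Since `b` gains the edge to `a`, it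
  -- stops being a leaf, and so does `a` unless `a = x`. So the number of leaves drops, against
  -- optimality.
  have hsub : leafSet G (flipOn σ S) ⊆ insert x (((leafSet G σ).erase a).erase b) := by
    intro v hv
    simp only [leafSet, mem_filter, mem_univ, true_and] at hv
    simp only [mem_insert, mem_erase, leafSet, mem_filter, mem_univ, true_and]
    by_cases hvx : v = x
    · exact .inl hvx
    refine .inr ?_
    have hvb : v ≠ b := by
      rintro rfl
      have h1 := hsame v β hβ (fun h => hxb h.1.symm) (fun h => hyb h.1.symm)
      have h2 := hv.unique h1 habH'.symm
      exact habH (h2 ▸ hβ.symm)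
    have hva : v ≠ a := by
      rintro rfl
      have h1 := hsame v α hα (fun h => hvx h.1) (fun h => hya h.1.symm)
      have h2 := hv.unique h1 habH'
      exact habH (h2 ▸ hα)
    have hvy : v ≠ y := by
      rintro rfl
      have h1 := hsame v p hp (fun h => hvx h.1) (fun h => hpq.2.1 h.2)
      have h2 := hsame v q hq (fun h => hvx h.1) (fun h => hpq.2.2 h.2)
      exact hpq.1 (hv.unique h1 h2)
    refine ⟨hvb, hva, ?_⟩
    obtain ⟨w, hw, hw'⟩ := hv
    refine ⟨w, hsame' v w hw (fun h => hva h.1) (fun h => hvb h.1), fun w' hw'' => ?_⟩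
    exact hw' w' (hsame v w' hw'' (fun h => hvx h.1) (fun h => hvy h.1))
  have hc1 := hσ.2 _ hmaxcut
  have hc2 := (card_le_card hsub).trans (card_insert_le _ _)
  have ma : a ∈ leafSet G σ := by simpa [leafSet] using hleaf a ha
  have mb : b ∈ (leafSet G σ).erase a := by
    simp only [mem_erase, leafSet, mem_filter, mem_univ, true_and]
    exact ⟨hab.symm, hleaf b hb⟩
  rw [card_erase_of_mem mb, card_erase_of_mem ma] at hc2
  have h3 : 0 < #((leafSet G σ).erase a) := card_pos.2 ⟨b, mb⟩
  rw [card_erase_of_mem ma] at h3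
  omega

end Ends

end ProperConnection

namespace ProperConnection

open Finset

variable {V : Type*} [DecidableEq V] [Fintype V] {G : SimpleGraph V} {σ : V → Bool}

lemma Linked.exists_linked_univ {U : Finset V} {s t : V} (h : Linked G U s t)
    (hU : ∀ v, v ∈ U) : ∃ s t, Linked G univ s t :=
  ⟨s, t, eq_univ_iff_forall.2 hU ▸ h⟩

/-! ### At least one end is a block -/

section LargeEnds

lemma cnt_le_card_mul {W : Type*} (H : SimpleGraph W) (S T : Finset W) :
    cnt H S T ≤ #S * #T := by
  classical
  rw [cnt, ← card_product]
  exact card_filter_le _ _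

/-- If the set `A`, which only two edges leave, both to `r`, is almost complete, then `A` and `r`
form a block that links `B` and `C`. -/
lemma exists_linked_of_absorb [DecidableRel G.Adj] {A B C : Finset V} {r b c : V}
    (hB : Block G B) (hC : Block G C) (hAB : Disjoint A B) (hAC : Disjoint A C)
    (hBC : Disjoint B C) (hrA : r ∉ A) (hrB : r ∉ B) (hrC : r ∉ C)
    (hcov : ∀ v, v = r ∨ v ∈ A ∨ v ∈ B ∨ v ∈ C) (hA2 : cnt G A Aᶜ ≤ 2) (hrA2 : 2 ≤ cnt G {r} A)
    (hA3 : 3 ≤ #A) (hinner : ∀ x ∈ A, (∀ y, G.Adj x y → y ∈ A) → #A ≤ G.degree x + 1)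
    (hb : b ∈ B) (hc : c ∈ C) (hrb : G.Adj r b) (hrc : G.Adj r c) :
    ∃ s t, Linked G univ s t := by
  obtain ⟨r₁, hr₁, p, hp, r₂, hr₂, q, hq, hrp, hrq, hne⟩ := two_le_cnt_iff.1 hrA2
  rw [mem_singleton] at hr₁ hr₂
  subst r₁ r₂
  have hpq : p ≠ q := fun h => hne ⟨rfl, h⟩
  -- The two edges leaving `A` start at `p` and `q`, so any other vertex of `A` has all its
  -- neighbours in `A`. The degree bound then makes it adjacent to all the rest of `A`.
  have hfull : ∀ y ∈ A, y ≠ p → y ≠ q → ∀ z ∈ A, z ≠ y → G.Adj z y := by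
    intro y hy hyp hyq z hz hzy
    have hyint : ∀ w, G.Adj y w → w ∈ A := by
      intro w hw
      by_contra hwA
      have := three_le_cnt (H := G) (S := A) (T := Aᶜ) hp (y := r) (by simpa using hrA) hq
        (y' := r) (by simpa using hrA) hy (y'' := w) (by simpa using hwA) hrp.symm hrq.symm hw
        (fun h => hpq h.1) (fun h => hyp h.1.symm) (fun h => hyq h.1.symm)
      omega
    have h1 := hinner y hy hyint
    have hsub : G.neighborFinset y ⊆ A.erase y := by
      intro w hw
      rw [SimpleGraph.mem_neighborFinset] at hw
      exact mem_erase.2 ⟨hw.ne', hyint w hw⟩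
    have heq := Finset.eq_of_subset_of_card_le hsub (by
      rw [card_erase_of_mem hy, G.card_neighborFinset_eq_degree]; omega)
    have : z ∈ G.neighborFinset y := heq ▸ mem_erase.2 ⟨hzy, hz⟩
    exact ((G.mem_neighborFinset y z).1 this).symm
  have hrY : r ∉ (A.erase p).erase q := fun h => hrA (mem_of_mem_erase (mem_of_mem_erase h))
  have hblock : Block G (insert p (insert q (insert r ((A.erase p).erase q)))) := by
    refine block_of_common_neighbors hpq ?_ ?_ ?_
    · rw [card_insert_of_notMem hrY, card_erase_of_mem (mem_erase.2 ⟨hpq.symm, hq⟩),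
        card_erase_of_mem hp]
      omega
    · intro y hy
      rcases mem_insert.1 hy with rfl | hy
      · exact hrp.symm
      · simp only [mem_erase] at hy
        exact hfull y hy.2.2 hy.2.1 hy.1 p hp (Ne.symm hy.2.1)
    · intro y hy
      rcases mem_insert.1 hy with rfl | hy
      · exact hrq.symm
      · simp only [mem_erase] at hy
        exact hfull y hy.2.2 hy.2.1 hy.1 q hq (Ne.symm hy.1)
  have heq : insert p (insert q (insert r ((A.erase p).erase q))) = insert r A := by
    ext v
    simp only [mem_insert, mem_erase]
    constructor
    · rintro (rfl | rfl | rfl | h) <;> tauto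
    · tauto
  rw [heq] at hblock
  -- Both `B` and `C` are attached to the block at `r`.
  have h1 := (hB.linked hb hb).glue (hblock.linked (mem_insert_self r A) (mem_insert_self r A))
    (by rw [Finset.disjoint_insert_right]; exact ⟨hrB, hAB.symm⟩) hrb.symm
  have h2 := h1.glue (hC.linked hc hc) (by
    rw [Finset.disjoint_union_left, Finset.disjoint_insert_left]
    exact ⟨hBC, hrC, hAC⟩) hrc
  refine h2.exists_linked_univ fun v => ?_
  have := hcov v
  simp only [mem_union, mem_insert]
  tauto

/-- If this smallest degree is `#L - 1`, then every vertex with all its neighbours in `L` is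
adjacent to all the rest of `L`, as `exists_linked_of_absorb` requires. -/
lemma exists_min_interior [DecidableRel G.Adj] {L : Finset V} (h : cnt G L Lᶜ < #L) :
    ∃ x ∈ L, (∀ y, G.Adj x y → y ∈ L) ∧
      ∀ x' ∈ L, (∀ y, G.Adj x' y → y ∈ L) → G.degree x ≤ G.degree x' := by
  classical
  obtain ⟨x, hx, hx'⟩ := exists_interior h
  obtain ⟨z, hz, hmin⟩ := Finset.exists_min_image (L.filter fun x => ∀ y, G.Adj x y → y ∈ L)
    (fun x => G.degree x) ⟨x, mem_filter.2 ⟨hx, hx'⟩⟩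
  rw [mem_filter] at hz
  exact ⟨z, hz.1, hz.2, fun x' h1 h2 => hmin x' (mem_filter.2 ⟨h1, h2⟩)⟩

/-- Three disjoint ends that are all blocks. -/
lemma exists_linked_of_three_blocks [DecidableRel G.Adj] (hG : G.Connected) (hσ : IsMaxCut G σ)
    (hdeg : ∀ x y, x ≠ y → ¬ G.Adj x y → Fintype.card V ≤ 2 * (G.degree x + G.degree y))
    {A B C : Finset V} (hA : IsEnd (cutGraph G σ) A) (hB : IsEnd (cutGraph G σ) B)
    (hC : IsEnd (cutGraph G σ) C) (hAB : Disjoint A B) (hAC : Disjoint A C) (hBC : Disjoint B C)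
    (hA4 : 4 ≤ #A) (hB4 : 4 ≤ #B) (hC4 : 4 ≤ #C) : ∃ s t, Linked G univ s t := by
  have hH : ∀ S : Finset V, S.Nonempty → S ≠ univ → 1 ≤ cnt (cutGraph G σ) S Sᶜ :=
    fun S h h' => hσ.one_le_cnt hG h h'
  have hA2 : cnt G A Aᶜ ≤ 2 := by have := hσ.cnt_le A; rw [hA.cnt_eq] at this; omega
  have hB2 : cnt G B Bᶜ ≤ 2 := by have := hσ.cnt_le B; rw [hB.cnt_eq] at this; omega
  have hC2 : cnt G C Cᶜ ≤ 2 := by have := hσ.cnt_le C; rw [hC.cnt_eq] at this; omega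
  obtain ⟨a, haA, hai, hamin⟩ := exists_min_interior (G := G) (L := A) (by omega)
  obtain ⟨b, hbB, hbi, hbmin⟩ := exists_min_interior (G := G) (L := B) (by omega)
  obtain ⟨c, hcC, hci, hcmin⟩ := exists_min_interior (G := G) (L := C) (by omega)
  have hda := degree_lt_card_of_interior haA hai
  have hdb := degree_lt_card_of_interior hbB hbi
  have hdc := degree_lt_card_of_interior hcC hci
  have nAB : ∀ {v}, v ∈ A → v ∉ B := fun h => Finset.disjoint_left.1 hAB h
  have nAC : ∀ {v}, v ∈ A → v ∉ C := fun h => Finset.disjoint_left.1 hAC h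
  have nBC : ∀ {v}, v ∈ B → v ∉ C := fun h => Finset.disjoint_left.1 hBC h
  have hab := hdeg a b (fun h => nAB haA (h ▸ hbB)) (fun h => nAB (hai b h) hbB)
  have hac := hdeg a c (fun h => nAC haA (h ▸ hcC)) (fun h => nAC (hai c h) hcC)
  have hbc := hdeg b c (fun h => nBC hbB (h ▸ hcC)) (fun h => nBC (hbi c h) hcC)
  set R : Finset V := (A ∪ B ∪ C)ᶜ with hR
  have memR : ∀ {v}, v ∈ R ↔ v ∉ A ∧ v ∉ B ∧ v ∉ C := by
    intro v; simp only [hR, mem_compl, mem_union, not_or, and_assoc]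
  have hcard : Fintype.card V = #A + #B + #C + #R := by
    rw [← card_add_card_compl (A ∪ B ∪ C), card_union_of_disjoint
      (disjoint_union_left.2 ⟨hAC, hBC⟩), card_union_of_disjoint hAB]
  have hdegR : ∀ r ∈ R, G.degree r + 1 ≤ #R + cnt G {r} A + cnt G {r} B + cnt G {r} C := by
    intro r hr
    have hr' := memR.1 hr
    have e : ({r} : Finset V)ᶜ = R.erase r ∪ (A ∪ B ∪ C) := by
      ext v
      simp only [mem_compl, mem_singleton, mem_union, mem_erase]
      constructor
      · intro h
        by_cases hv : v ∈ R
        · exact .inl ⟨h, hv⟩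
        · rw [memR] at hv; tauto
      · rintro (h | h)
        · exact h.1
        · rintro rfl; tauto
    have d : Disjoint (R.erase r) (A ∪ B ∪ C) := by
      rw [Finset.disjoint_left]
      intro v hv
      have := memR.1 (mem_of_mem_erase hv)
      simp only [mem_union]; tauto
    rw [degree_eq_cnt, e, cnt_union_right G _ d, cnt_union_right G _
      (disjoint_union_left.2 ⟨hAC, hBC⟩), cnt_union_right G _ hAB]
    have h1 := cnt_le_card_mul G {r} (R.erase r)
    rw [card_singleton, one_mul, card_erase_of_mem hr] at h1
    have := card_pos.2 ⟨r, hr⟩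
    omega
  have hR2 : ∀ r ∈ R, Fintype.card V ≤ 2 * (G.degree r + G.degree a) ∧
      Fintype.card V ≤ 2 * (G.degree r + G.degree b) ∧
      Fintype.card V ≤ 2 * (G.degree r + G.degree c) := by
    intro r hr
    have hr' := memR.1 hr
    exact ⟨hdeg r a (fun h => hr'.1 (h ▸ haA)) (fun h => hr'.1 (hai r h.symm)),
      hdeg r b (fun h => hr'.2.1 (h ▸ hbB)) (fun h => hr'.2.1 (hbi r h.symm)),
      hdeg r c (fun h => hr'.2.2 (h ▸ hcC)) (fun h => hr'.2.2 (hci r h.symm))⟩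
  have hle2 : ∀ {L : Finset V} {r : V}, r ∉ L → cnt G L Lᶜ ≤ 2 → cnt G {r} L ≤ 2 := by
    intro L r hr h2
    rw [cnt_comm] at h2
    exact (cnt_mono (by simpa using hr) subset_rfl (fun _ _ _ _ h => h)).trans h2
  obtain ⟨a', ha', r, hrA, hrB, hrC, har⟩ := hA.exists_adj hH hB hC hAB hAC hBC
  have hrR : r ∈ R := memR.2 ⟨hrA, hrB, hrC⟩
  -- Write `n` for the number of vertices. The conditions among `a`, `b`, `c` sum to `4 * #R + 12 ≤
  -- n`. With two vertices in `R`, those pairing each of them with `a`, `b`, `c` sum to `n ≤ 4 * #R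
  -- + 6`, as only two edges leave each end.
  have hRr : ∀ r' ∈ R, r' = r := by
    intro r' hr'
    by_contra hne
    have hadd : ∀ {L : Finset V}, r ∉ L → r' ∉ L → cnt G L Lᶜ ≤ 2 →
        cnt G {r} L + cnt G {r'} L ≤ 2 := by
      intro L h1 h2 h3
      rw [← cnt_union_left G (by simpa using Ne.symm hne)]
      rw [cnt_comm] at h3
      refine (cnt_mono ?_ subset_rfl (fun _ _ _ _ h => h)).trans h3
      intro v hv
      simp only [mem_union, mem_singleton] at hv
      rcases hv with rfl | rfl <;> simpa
    have m' := memR.1 hr'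
    have e1 := hadd hrA m'.1 hA2
    have e2 := hadd hrB m'.2.1 hB2
    have e3 := hadd hrC m'.2.2 hC2
    have e4 := hdegR r hrR
    have e5 := hdegR r' hr'
    have e6 := hR2 r hrR
    have e7 := hR2 r' hr'
    omega
  have hR1 : #R = 1 := card_eq_one.2 ⟨r, eq_singleton_iff_unique_mem.2 ⟨hrR, hRr⟩⟩
  have hcov : ∀ v, v = r ∨ v ∈ A ∨ v ∈ B ∨ v ∈ C := by
    intro v
    by_cases hv : v ∈ R
    · exact .inl (hRr v hv)
    · rw [memR] at hv; tauto
  obtain ⟨b', hb', r', m1, m2, m3, hbr⟩ := hB.exists_adj hH hA hC hAB.symm hBC hAC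
  obtain rfl : r' = r := hRr r' (memR.2 ⟨m2, m1, m3⟩)
  obtain ⟨c', hc', r'', m1, m2, m3, hcr⟩ := hC.exists_adj hH hA hB hAC.symm hBC.symm hAB
  obtain rfl : r'' = r' := hRr r'' (memR.2 ⟨m2, m3, m1⟩)
  have kA := hle2 hrA hA2
  have kB := hle2 hrB hB2
  have kC := hle2 hrC hC2
  have e1 := hdegR _ hrR
  have e2 := hR2 _ hrR
  -- Let `k` be the number of ends to which `r''` sends two edges. If in each of them the smallest
  -- inner degree were below `size - 1`, the conditions among `a`, `b`, `c` would give `n ≥ 16 + 4 *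
  -- k`, and those with `r''` would give `n ≤ 10 + 4 * k`.
  have hcase : (cnt G {r''} A = 2 ∧ #A ≤ G.degree a + 1) ∨
      (cnt G {r''} B = 2 ∧ #B ≤ G.degree b + 1) ∨ (cnt G {r''} C = 2 ∧ #C ≤ G.degree c + 1) := by
    omega
  rcases hcase with ⟨h1, h2⟩ | ⟨h1, h2⟩ | ⟨h1, h2⟩
  · exact exists_linked_of_absorb hB.block hC.block hAB hAC hBC hrA hrB hrC hcov hA2 h1.ge
      (by omega) (fun x hx hx' => by have := hamin x hx hx'; omega) hb' hc' hbr.1.symm hcr.1.symm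
  · exact exists_linked_of_absorb hA.block hC.block hAB.symm hBC hAC hrB hrA hrC
      (fun v => by have := hcov v; tauto) hB2 h1.ge
      (by omega) (fun x hx hx' => by have := hbmin x hx hx'; omega) ha' hc' har.1.symm hcr.1.symm
  · exact exists_linked_of_absorb hA.block hB.block hAC.symm hBC.symm hAB hrC hrA hrB
      (fun v => by have := hcov v; tauto) hC2 h1.ge
      (by omega) (fun x hx hx' => by have := hcmin x hx hx'; omega) ha' hb' har.1.symm hbr.1.symm

/-- A one-vertex end and two ends that are blocks. -/
lemma exists_linked_of_two_blocks [DecidableRel G.Adj] (hG : G.Connected) (hσ : IsMaxCut G σ)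
    (hdeg : ∀ x y, x ≠ y → ¬ G.Adj x y → Fintype.card V ≤ 2 * (G.degree x + G.degree y))
    {a : V} {B C : Finset V} (hA : IsEnd (cutGraph G σ) {a}) (hB : IsEnd (cutGraph G σ) B)
    (hC : IsEnd (cutGraph G σ) C) (haB : a ∉ B) (haC : a ∉ C) (hBC : Disjoint B C)
    (hB4 : 4 ≤ #B) (hC4 : 4 ≤ #C) : ∃ s t, Linked G univ s t := by
  have hH : ∀ S : Finset V, S.Nonempty → S ≠ univ → 1 ≤ cnt (cutGraph G σ) S Sᶜ :=
    fun S h h' => hσ.one_le_cnt hG h h'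
  have hA2 : G.degree a ≤ 2 := by
    have := hσ.cnt_le {a}; rw [hA.cnt_eq] at this; rw [degree_eq_cnt]; omega
  have hB2 : cnt G B Bᶜ ≤ 2 := by have := hσ.cnt_le B; rw [hB.cnt_eq] at this; omega
  have hC2 : cnt G C Cᶜ ≤ 2 := by have := hσ.cnt_le C; rw [hC.cnt_eq] at this; omega
  have hAB : Disjoint {a} B := by simpa using haB
  have hAC : Disjoint {a} C := by simpa using haC
  obtain ⟨b, hbB, hbi⟩ := exists_interior (G := G) (L := B) (by omega)
  obtain ⟨c, hcC, hci⟩ := exists_interior (G := G) (L := C) (by omega)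
  have hdb := degree_lt_card_of_interior hbB hbi
  have hdc := degree_lt_card_of_interior hcC hci
  have hab := hdeg a b (fun h => haB (h ▸ hbB)) (fun h => haB (hbi a h.symm))
  have hac := hdeg a c (fun h => haC (h ▸ hcC)) (fun h => haC (hci a h.symm))
  set R : Finset V := ({a} ∪ B ∪ C)ᶜ with hR
  have memR : ∀ {v}, v ∈ R ↔ v ≠ a ∧ v ∉ B ∧ v ∉ C := by
    intro v; simp only [hR, mem_compl, mem_union, mem_singleton, not_or, and_assoc, ne_eq]
  have hcard : Fintype.card V = 1 + #B + #C + #R := by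
    rw [← card_add_card_compl ({a} ∪ B ∪ C), card_union_of_disjoint
      (disjoint_union_left.2 ⟨hAC, hBC⟩), card_union_of_disjoint hAB, card_singleton]
  obtain ⟨a', ha', r, hrA, hrB, hrC, har⟩ := hA.exists_adj hH hB hC hAB hAC hBC
  rw [mem_singleton] at ha' hrA
  subst ha'
  have hrR : r ∈ R := memR.2 ⟨hrA, hrB, hrC⟩
  have hpos := card_pos.2 ⟨r, hrR⟩
  -- Adding the conditions for `a, b` and `a, c` gives `n ≤ #B + #C + 2`. This leaves room for just
  -- one vertex outside the ends, and later forces `a` to have degree two.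
  have hR1 : #R = 1 := by omega
  have hRr : ∀ r' ∈ R, r' = r := by
    obtain ⟨r₀, h0⟩ := card_eq_one.1 hR1
    intro r' hr'
    rw [h0, mem_singleton] at hr' hrR
    exact hr'.trans hrR.symm
  have hcov : ∀ v, v = r ∨ v = a' ∨ v ∈ B ∨ v ∈ C := by
    intro v
    by_cases hv : v ∈ R
    · exact .inl (hRr v hv)
    · rw [memR] at hv; tauto
  obtain ⟨b', hb', r', m1, m2, m3, hbr⟩ := hB.exists_adj hH hA hC hAB.symm hBC hAC
  obtain rfl : r' = r := hRr r' (memR.2 ⟨by simpa using m2, m1, m3⟩)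
  obtain ⟨c', hc', r'', m1, m2, m3, hcr⟩ := hC.exists_adj hH hA hB hAC.symm hBC.symm hAB
  obtain rfl : r'' = r' := hRr r'' (memR.2 ⟨by simpa using m2, m3, m1⟩)
  have hda : 2 ≤ cnt G {a'} {a'}ᶜ := by rw [← degree_eq_cnt]; omega
  obtain ⟨z, hza, hzr⟩ : ∃ z, G.Adj a' z ∧ z ≠ r'' := by
    obtain ⟨x, hx, y, hy, x', hx', y', hy', hxy, hxy', hne⟩ := two_le_cnt_iff.1 hda
    rw [mem_singleton] at hx hx'
    subst x x'
    by_cases h : y = r''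
    · exact ⟨y', hxy', fun h' => hne ⟨rfl, h.trans h'.symm⟩⟩
    · exact ⟨y, hxy, h⟩
  -- The second neighbour of `a'` lies in one of the blocks, so the pieces line up as block, `r''`,
  -- `a'`, block.
  have final : ∀ {B C : Finset V} {c' z : V}, Block G B → Block G C → Disjoint B C → a' ∉ B →
      a' ∉ C → r'' ∉ B → r'' ∉ C → z ∈ B → c' ∈ C → G.Adj a' z → G.Adj c' r'' →
      (∀ v, v = r'' ∨ v = a' ∨ v ∈ B ∨ v ∈ C) → ∃ s t, Linked G univ s t := by
    intro B C c' z hB hC hBC haB haC hrB hrC hz hc' haz hcr hcov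
    have h1 := ((hC.linked hc' hc').extend hrC hcr).extend (y := a')
      (by simp [haC, Ne.symm hrA]) har.1.symm
    have h2 := h1.glue (hB.linked hz hz) (by
      simp [Finset.disjoint_insert_left, haB, hrB, hBC.symm]) haz
    refine h2.exists_linked_univ fun v => ?_
    have := hcov v
    simp only [mem_union, mem_insert]
    tauto
  rcases hcov z with h | h | h | h
  · exact absurd h hzr
  · exact absurd h hza.ne'
  · exact final hB.block hC.block hBC haB haC hrB hrC h hc' hza hcr.1 hcov
  · exact final hC.block hB.block hBC.symm haC haB hrC hrB h hb' hza hbr.1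
      (fun v => by have := hcov v; tauto)

/-- Two nonadjacent one-vertex ends and an end that is a block. -/
lemma exists_linked_of_one_block [DecidableRel G.Adj] (hG : G.Connected) (hσ : IsMaxCut G σ)
    (hdeg : ∀ x y, x ≠ y → ¬ G.Adj x y → Fintype.card V ≤ 2 * (G.degree x + G.degree y))
    {a b : V} {C : Finset V} (hA : IsEnd (cutGraph G σ) {a}) (hB : IsEnd (cutGraph G σ) {b})
    (hC : IsEnd (cutGraph G σ) C) (hab : a ≠ b) (hnadj : ¬ G.Adj a b) (haC : a ∉ C) (hbC : b ∉ C)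
    (hC4 : 4 ≤ #C) : ∃ s t, Linked G univ s t := by
  have hH : ∀ S : Finset V, S.Nonempty → S ≠ univ → 1 ≤ cnt (cutGraph G σ) S Sᶜ :=
    fun S h h' => hσ.one_le_cnt hG h h'
  have hA2 : G.degree a ≤ 2 := by
    have := hσ.cnt_le {a}; rw [hA.cnt_eq] at this; rw [degree_eq_cnt]; omega
  have hB2 : G.degree b ≤ 2 := by
    have := hσ.cnt_le {b}; rw [hB.cnt_eq] at this; rw [degree_eq_cnt]; omega
  have hC2 : cnt G C Cᶜ ≤ 2 := by have := hσ.cnt_le C; rw [hC.cnt_eq] at this; omega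
  have hAB : Disjoint ({a} : Finset V) {b} := by simpa using hab
  have hAC : Disjoint {a} C := by simpa using haC
  have hBC : Disjoint {b} C := by simpa using hbC
  have h8 := hdeg a b hab hnadj
  set R : Finset V := ({a} ∪ {b} ∪ C)ᶜ with hR
  have memR : ∀ {v}, v ∈ R ↔ v ≠ a ∧ v ≠ b ∧ v ∉ C := by
    intro v; simp only [hR, mem_compl, mem_union, mem_singleton, not_or, and_assoc, ne_eq]
  have hcard : Fintype.card V = 2 + #C + #R := by
    rw [← card_add_card_compl ({a} ∪ {b} ∪ C), card_union_of_disjoint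
      (disjoint_union_left.2 ⟨hAC, hBC⟩), card_union_of_disjoint hAB, card_singleton,
      card_singleton]
  obtain ⟨c, hc, r, hrC, hra, hrb, hcr⟩ := hC.exists_adj hH hA hB hAC.symm hBC.symm hAB
  rw [mem_singleton] at hra hrb
  have hrR : r ∈ R := memR.2 ⟨hra, hrb, hrC⟩
  have hpos := card_pos.2 ⟨r, hrR⟩
  have two_nbrs : ∀ v, G.degree v = 2 → ∃ y z, y ≠ z ∧ ∀ w, G.Adj v w ↔ w = y ∨ w = z := by
    intro v hv
    rw [← G.card_neighborFinset_eq_degree, card_eq_two] at hv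
    obtain ⟨y, z, hyz, h⟩ := hv
    refine ⟨y, z, hyz, fun w => ?_⟩
    rw [← SimpleGraph.mem_neighborFinset, h]; simp
  -- There are at least `2 + 4 + 1 = 7` vertices, so two degrees of at most two must both equal two.
  -- The resulting bound of eight vertices leaves at most two in `R`.
  obtain ⟨a₁, a₂, ha12, hna⟩ := two_nbrs a (by omega)
  obtain ⟨b₁, b₂, hb12, hnb⟩ := two_nbrs b (by omega)
  -- besides the edge `c r`, at most one edge leaves `C`
  have hone : ∀ x ∈ C, ∀ y ∉ C, ∀ x' ∈ C, ∀ y' ∉ C, G.Adj y x → G.Adj y' x' → y ≠ r → y' ≠ r →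
      x = x' ∧ y = y' := by
    intro x hx y hy x' hx' y' hy' h h' hyr hyr'
    by_contra hne
    have := three_le_cnt (H := G) (S := C) (T := Cᶜ) hx (y := y) (by simpa using hy) hx'
      (y' := y') (by simpa using hy') hc (y'' := r) (by simpa using hrC) h.symm h'.symm hcr.1 hne
      (fun h => hyr h.2) (fun h => hyr' h.2)
    omega
  obtain ⟨r', hr'R⟩ | hR1 : (∃ r' ∈ R, r' ≠ r) ∨ ∀ r' ∈ R, r' = r := by
    by_cases h : ∃ r' ∈ R, r' ≠ r
    · exact .inl h
    · push Not at h; exact .inr h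
  · obtain ⟨hr'R, hr'⟩ := hr'R
    have hm' := memR.1 hr'R
    have hReq : R = {r, r'} := by
      refine (Finset.eq_of_subset_of_card_le ?_ ?_).symm
      · intro v hv
        simp only [mem_insert, mem_singleton] at hv
        rcases hv with rfl | rfl <;> assumption
      · rw [card_pair hr'.symm]; omega
    have hcov : ∀ v, v = a ∨ v = b ∨ v ∈ C ∨ v = r ∨ v = r' := by
      intro v
      by_cases hv : v ∈ R
      · rw [hReq] at hv; simp at hv; tauto
      · rw [memR] at hv; tauto
    have huniv : ∀ {U : Finset V} {s t : V}, Linked G U s t → a ∈ U → b ∈ U → C ⊆ U → r ∈ U →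
        r' ∈ U → ∃ s t, Linked G univ s t := by
      intro U s t h h1 h2 h3 h4 h5
      refine h.exists_linked_univ fun v => ?_
      rcases hcov v with rfl | rfl | h | rfl | rfl
      exacts [h1, h2, h3 h, h4, h5]
    have hnbr : ∀ {x y : V}, (x = a ∧ y = b ∨ x = b ∧ y = a) → (∀ w ∈ C, ¬ G.Adj x w) →
        ∀ x₁ x₂, x₁ ≠ x₂ → (∀ w, G.Adj x w ↔ w = x₁ ∨ w = x₂) → G.Adj x r ∧ G.Adj x r' := by
      intro x y hxy hxC x₁ x₂ h12 hx
      have hin : ∀ w, G.Adj x w → w = r ∨ w = r' := by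
        intro w hw
        have h3 : w ≠ x := hw.ne'
        have h4 : w ≠ y := by
          rcases hxy with ⟨rfl, rfl⟩ | ⟨rfl, rfl⟩
          · rintro rfl; exact hnadj hw
          · rintro rfl; exact hnadj hw.symm
        have h5 : w ∉ C := fun h => hxC w h hw
        have := hcov w
        rcases hxy with ⟨rfl, rfl⟩ | ⟨rfl, rfl⟩ <;> tauto
      have h1 := hin x₁ ((hx x₁).2 (.inl rfl))
      have h2 := hin x₂ ((hx x₂).2 (.inr rfl))
      rw [hx, hx]
      rcases h1 with h1 | h1 <;> rcases h2 with h2 | h2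
      · exact absurd (h1.trans h2.symm) h12
      · exact ⟨.inl h1.symm, .inr h2.symm⟩
      · exact ⟨.inr h2.symm, .inl h1.symm⟩
      · exact absurd (h1.trans h2.symm) h12
    -- one of the two vertices has a neighbour in `C`
    have side : ∀ {x y : V}, (x = a ∧ y = b ∨ x = b ∧ y = a) → ∀ z ∈ C, G.Adj x z →
        ∀ x₁ x₂, x₁ ≠ x₂ → (∀ w, G.Adj x w ↔ w = x₁ ∨ w = x₂) → G.Adj y r → G.Adj y r' →
        ∃ s t, Linked G univ s t := by
      intro x y hxy z hz hxz x₁ x₂ h12 hx hyr hyr'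
      have hxC : x ∉ C := by rcases hxy with ⟨rfl, rfl⟩ | ⟨rfl, rfl⟩ <;> assumption
      have hyC : y ∉ C := by rcases hxy with ⟨rfl, rfl⟩ | ⟨rfl, rfl⟩ <;> assumption
      have hxr : r ≠ x := by rcases hxy with ⟨rfl, rfl⟩ | ⟨rfl, rfl⟩ <;> assumption
      have hyr2 : r ≠ y := by rcases hxy with ⟨rfl, rfl⟩ | ⟨rfl, rfl⟩ <;> assumption
      have hxr' : r' ≠ x := by rcases hxy with ⟨rfl, rfl⟩ | ⟨rfl, rfl⟩ <;> tauto
      have hyr2' : r' ≠ y := by rcases hxy with ⟨rfl, rfl⟩ | ⟨rfl, rfl⟩ <;> tauto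
      have hxyne : x ≠ y := by rcases hxy with ⟨rfl, rfl⟩ | ⟨rfl, rfl⟩ <;> tauto
      obtain ⟨w, hw, hwz⟩ : ∃ w, G.Adj x w ∧ w ≠ z := by
        by_cases h : x₁ = z
        · exact ⟨x₂, (hx x₂).2 (.inr rfl), fun h' => h12 (h.trans h'.symm)⟩
        · exact ⟨x₁, (hx x₁).2 (.inl rfl), h⟩
      have hwC : w ∉ C := fun h => hwz (hone w h x hxC z hz x hxC hw hxz hxr.symm hxr.symm).1
      have hl := (hC.block.linked hz hz).extend hxC hxz.symm
      have hwr : w = r ∨ w = r' := by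
        have h3 : w ≠ x := hw.ne'
        have h4 : w ≠ y := by
          rcases hxy with ⟨rfl, rfl⟩ | ⟨rfl, rfl⟩
          · rintro rfl; exact hnadj hw
          · rintro rfl; exact hnadj hw.symm
        have := hcov w
        rcases hxy with ⟨rfl, rfl⟩ | ⟨rfl, rfl⟩ <;> tauto
      rcases hwr with rfl | rfl
      · have h1 := hl.extend (y := w) (by simp [hxr, hrC]) hw
        have h2 := h1.extend (y := y) (by simp [hyr2.symm, hxyne.symm, hyC]) hyr.symm
        have h3 := h2.extend (y := r') (by simp [hyr2', hr', hxr', hm'.2.2]) hyr'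
        have hsub : C ⊆ insert r' (insert y (insert w (insert x C))) := fun v hv => by simp [hv]
        rcases hxy with ⟨rfl, rfl⟩ | ⟨rfl, rfl⟩ <;> exact huniv h3 (by simp) (by simp) hsub (by simp) (by simp)
      · have h1 := hl.extend (y := w) (by simp [hxr', hm'.2.2]) hw
        have h2 := h1.extend (y := y) (by simp [hyr2'.symm, hxyne.symm, hyC]) hyr'.symm
        have h3 := h2.extend (y := r) (by simp [hyr2, hr'.symm, hxr, hrC]) hyr
        have hsub : C ⊆ insert r (insert y (insert w (insert x C))) := fun v hv => by simp [hv]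
        rcases hxy with ⟨rfl, rfl⟩ | ⟨rfl, rfl⟩ <;> exact huniv h3 (by simp) (by simp) hsub (by simp) (by simp)
    by_cases haz : ∃ z ∈ C, G.Adj a z
    · obtain ⟨z, hz, haz⟩ := haz
      have hbz : ∀ w ∈ C, ¬ G.Adj b w := fun w hw hbw =>
        hab (hone z hz a haC w hw b hbC haz hbw (Ne.symm hra) (Ne.symm hrb)).2
      obtain ⟨h1, h2⟩ := hnbr (.inr ⟨rfl, rfl⟩) hbz b₁ b₂ hb12 hnb
      exact side (.inl ⟨rfl, rfl⟩) z hz haz a₁ a₂ ha12 hna h1 h2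
    push Not at haz
    obtain ⟨h1, h2⟩ := hnbr (.inl ⟨rfl, rfl⟩) haz a₁ a₂ ha12 hna
    by_cases hbz : ∃ z ∈ C, G.Adj b z
    · obtain ⟨z, hz, hbz⟩ := hbz
      exact side (.inr ⟨rfl, rfl⟩) z hz hbz b₁ b₂ hb12 hnb h1 h2
    push Not at hbz
    obtain ⟨h3, h4⟩ := hnbr (.inr ⟨rfl, rfl⟩) hbz b₁ b₂ hb12 hnb
    -- Neither `a` nor `b` has a neighbour in `C`, so together with `r` and `r'` they form a
    -- 4-cycle, attached to `C` by `c r`.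
    have hblock := block_of_common_neighbors (G := G) (p := r) (q := r') (Y := {a, b}) hr'.symm
      (by rw [card_pair hab]) (by simp [h1.symm, h3.symm]) (by simp [h2.symm, h4.symm])
    have hl := (hC.block.linked hc hc).glue (hblock.linked (mem_insert_self r _)
      (mem_insert_self r _)) (by simp [hrC, hm'.2.2, haC, hbC]) hcr.1
    exact huniv hl (by simp) (by simp) subset_union_left (by simp) (by simp)
  -- If `r` is the only vertex outside the ends, both `a` and `b` send an edge to `C`. With `c r`,
  -- three edges would leave `C`.
  · have aux : ∀ {x : V}, (x = a ∨ x = b) → ∀ x₁ x₂, x₁ ≠ x₂ →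
        (∀ w, G.Adj x w ↔ w = x₁ ∨ w = x₂) → ∃ z ∈ C, G.Adj x z := by
      intro x hxab x₁ x₂ h12 hx
      obtain ⟨w, hw, hwr⟩ : ∃ w, G.Adj x w ∧ w ≠ r := by
        by_cases h : x₁ = r
        · exact ⟨x₂, (hx x₂).2 (.inr rfl), fun h' => h12 (h.trans h'.symm)⟩
        · exact ⟨x₁, (hx x₁).2 (.inl rfl), h⟩
      refine ⟨w, ?_, hw⟩
      by_contra hwC
      have hwR : w ∉ R := fun h => hwr (hR1 w h)
      rw [memR] at hwR
      have : w = a ∨ w = b := by tauto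
      rcases hxab with rfl | rfl <;> rcases this with rfl | rfl
      · exact hw.ne rfl
      · exact hnadj hw
      · exact hnadj hw.symm
      · exact hw.ne rfl
    obtain ⟨z, hz, haz⟩ := aux (.inl rfl) a₁ a₂ ha12 hna
    obtain ⟨w, hw, hbw⟩ := aux (.inr rfl) b₁ b₂ hb12 hnb
    exact absurd (hone z hz a haC w hw b hbC haz hbw (Ne.symm hra) (Ne.symm hrb)).2 hab

end LargeEnds

end ProperConnection

namespace ProperConnection

open Finset

variable {V : Type*} [DecidableEq V] {G : SimpleGraph V}

/-! ### Blocks with tails and Hamiltonian paths -/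

section Tails

lemma Linked.extend_chain {l : List V} {U : Finset V} {s p : V} (h : Linked G U s p)
    (hc : (p :: l).IsChain G.Adj) (hn : l.Nodup) (hd : ∀ x ∈ l, x ∉ U) :
    ∃ t, Linked G (U ∪ l.toFinset) s t := by
  induction l generalizing U p with
  | nil => exact ⟨p, by simpa using h⟩
  | cons y l ih =>
    rw [List.isChain_cons_cons] at hc
    rw [List.nodup_cons] at hn
    obtain ⟨t, ht⟩ := ih (h.extend (hd y (by simp)) hc.1) hc.2 hn.2 (fun x hx => by
      rw [mem_insert, not_or]
      exact ⟨fun h => hn.1 (h ▸ hx), hd x (by simp [hx])⟩)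
    refine ⟨t, ?_⟩
    convert ht using 1
    ext v
    simp

variable [Fintype V]

/-- A block with two disjoint tails that cover the remaining vertices. -/
lemma exists_linked_of_tails {U : Finset V} (hU : Block G U) (p q : V) (l₁ l₂ : List V)
    (hp : p ∈ U) (hq : q ∈ U) (h₁ : (p :: l₁).IsChain G.Adj) (h₂ : (q :: l₂).IsChain G.Adj)
    (hn : (l₁ ++ l₂).Nodup) (hd : ∀ x ∈ l₁ ++ l₂, x ∉ U) (hcov : ∀ v, v ∈ U ∨ v ∈ l₁ ++ l₂) :
    ∃ s t, Linked G univ s t := by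
  rw [List.nodup_append'] at hn
  obtain ⟨t, ht⟩ := (hU.linked hq hp).extend_chain h₁ hn.1 (fun x hx => hd x (by simp [hx]))
  obtain ⟨t', ht'⟩ := ht.symm.extend_chain h₂ hn.2.1 (fun x hx => by
    simp only [mem_union, List.mem_toFinset, not_or]
    exact ⟨hd x (by simp [hx]), fun h => hn.2.2 h hx⟩)
  refine ht'.exists_linked_univ fun v => ?_
  have := hcov v
  simp only [mem_union, List.mem_toFinset, List.mem_append] at this ⊢
  tauto

/-- A Hamiltonian path. -/
lemma exists_linked_of_path (p : V) (l : List V) (hc : (p :: l).IsChain G.Adj)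
    (hn : (p :: l).Nodup) (hcov : ∀ v, v ∈ p :: l) : ∃ s t, Linked G univ s t := by
  rw [List.nodup_cons] at hn
  obtain ⟨t, ht⟩ := (linked_singleton G p).extend_chain hc hn.2 (fun x hx => by
    rw [mem_singleton]; exact fun h => hn.1 (h ▸ hx))
  refine ht.exists_linked_univ fun v => ?_
  have := hcov v
  simpa using this

/-- A block with at most two further vertices, both attached to it. -/
lemma exists_linked_of_attached {U : Finset V} (hU : Block G U) (hne : U.Nonempty)
    (hcard : Fintype.card V ≤ #U + 2) (hatt : ∀ x ∉ U, ∃ u ∈ U, G.Adj u x) :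
    ∃ s t, Linked G univ s t := by
  have h1 := card_add_card_compl U
  by_cases hx : ∃ x, x ∉ U
  · obtain ⟨x, hx⟩ := hx
    obtain ⟨u, hu, hux⟩ := hatt x hx
    by_cases hy : ∃ y, y ∉ U ∧ y ≠ x
    · obtain ⟨y, hy, hyx⟩ := hy
      obtain ⟨w, hw, hwy⟩ := hatt y hy
      have hxy : Uᶜ = {x, y} := by
        refine (Finset.eq_of_subset_of_card_le ?_ ?_).symm
        · intro v hv
          simp only [mem_insert, mem_singleton] at hv
          rcases hv with rfl | rfl <;> simpa
        · rw [card_pair hyx.symm]; omega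
      refine exists_linked_of_tails hU u w [x] [y] hu hw (by simpa) (by simpa)
        (by simpa using hyx.symm) (by simp [hx, hy]) fun v => ?_
      by_cases hv : v ∈ U
      · exact .inl hv
      · rw [← mem_compl, hxy] at hv
        exact .inr (by simpa using hv)
    · push Not at hy
      refine exists_linked_of_tails hU u u [x] [] hu hu (by simpa) (by simp) (by simp)
        (by simp [hx]) fun v => ?_
      by_cases hv : v ∈ U
      · exact .inl hv
      · exact .inr (by simpa using hy v hv)
  · push Not at hx
    obtain ⟨u, hu⟩ := hne
    exact exists_linked_of_tails hU u u [] [] hu hu (by simp) (by simp) (by simp) (by simp)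
      fun v => .inl (hx v)

end Tails

/-! ### Three vertices with the same neighbourhood -/

section Quadrilateral

lemma block_square {p q a b : V} (hpq : p ≠ q) (hab : a ≠ b) (h1 : G.Adj p a) (h2 : G.Adj p b)
    (h3 : G.Adj q a) (h4 : G.Adj q b) : Block G {p, q, a, b} :=
  block_of_common_neighbors hpq (by rw [card_pair hab]) (by simp [h1, h2]) (by simp [h3, h4])

variable [Fintype V]

lemma exists_adj_ne [DecidableRel G.Adj] {x : V} (h : 2 ≤ G.degree x) (y : V) :
    ∃ w, G.Adj x w ∧ w ≠ y := by
  rw [← G.card_neighborFinset_eq_degree] at h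
  obtain ⟨p, hp, q, hq, hpq⟩ := Finset.one_lt_card.1 h
  rw [SimpleGraph.mem_neighborFinset] at hp hq
  by_cases h : p = y
  · exact ⟨q, hq, fun h' => hpq (h.trans h'.symm)⟩
  · exact ⟨p, hp, h⟩

lemma exists_adj_of_connected (hG : G.Connected) {S : Finset V} {x y : V} (hx : x ∈ S)
    (hy : y ∉ S) : ∃ p ∈ S, ∃ q ∉ S, G.Adj p q := by
  have := one_le_cnt_of_connected hG ⟨x, hx⟩ (fun h => hy (h ▸ mem_univ y))
  simpa using cnt_pos_iff.1 this

/-- Three vertices with the same two neighbours. -/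
lemma exists_linked_of_triple [DecidableRel G.Adj] (hG : G.Connected) (h8 : Fintype.card V ≤ 8)
    {u v a b c : V} (hn : [u, v, a, b, c].Nodup)
    (ha : ∀ w, G.Adj a w ↔ w = u ∨ w = v) (hb : ∀ w, G.Adj b w ↔ w = u ∨ w = v)
    (hc : ∀ w, G.Adj c w ↔ w = u ∨ w = v)
    (hδ : Fintype.card V ≤ 6 ∨ ∀ x, 2 ≤ G.degree x) : ∃ s t, Linked G univ s t := by
  simp only [List.nodup_cons, List.mem_cons, List.not_mem_nil, not_or, or_false, not_false_eq_true,
    List.nodup_nil, and_true] at hn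
  obtain ⟨⟨huv, hua, hub, huc⟩, ⟨hva, hvb, hvc⟩, ⟨hab, hac⟩, hbc⟩ := hn
  set U : Finset V := {u, v, a, b, c} with hU
  have hblock : Block G U := block_of_common_neighbors huv
    (by rw [card_eq_three.2 ⟨a, b, c, hab, hac, hbc, rfl⟩]; omega)
    (by simp [G.adj_comm u, ha, hb, hc]) (by simp [G.adj_comm v, ha, hb, hc])
  have hU5 : #U = 5 := by simp [*]
  have hout : ∀ x ∉ U, ∀ y, G.Adj x y → y ∈ U → y = u ∨ y = v := by
    intro x hx y hxy hy
    simp only [hU, mem_insert, mem_singleton, not_or] at hx hy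
    rcases hy with rfl | rfl | rfl | rfl | rfl
    · exact .inl rfl
    · exact .inr rfl
    · exact absurd ((ha x).1 hxy.symm) (by tauto)
    · exact absurd ((hb x).1 hxy.symm) (by tauto)
    · exact absurd ((hc x).1 hxy.symm) (by tauto)
  have hcompl := card_add_card_compl U
  have hcompl3 : #Uᶜ ≤ 3 := by omega
  have huU : u ∈ U := by simp [hU]
  have hvU : v ∈ U := by simp [hU]
  by_cases hatt : ∀ x ∉ U, ∃ w ∈ U, G.Adj w x
  · by_cases h7 : Fintype.card V ≤ 7
    · exact exists_linked_of_attached hblock ⟨u, huU⟩ (by omega) hatt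
    have hδ' := hδ.resolve_left (by omega)
    -- Three vertices lie outside the block. An edge among them turns two of them into one tail.
    -- Without such an edge they are all adjacent to both `u` and `v` and join the complete
    -- bipartite block.
    by_cases hedge : ∃ x ∉ U, ∃ y ∉ U, G.Adj x y
    · obtain ⟨x, hx, y, hy, hxy⟩ := hedge
      obtain ⟨z, hz⟩ : ∃ z, z ∈ (Uᶜ.erase x).erase y := by
        refine card_pos.1 ?_
        rw [card_erase_of_mem (by simp [hy, hxy.ne']), card_erase_of_mem (by simpa using hx)]
        omega
      simp only [mem_erase, mem_compl] at hz
      have hall : ∀ w ∉ U, w = x ∨ w = y ∨ w = z := by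
        intro w hw
        by_contra! hcon
        have : ({w, x, y, z} : Finset V) ⊆ Uᶜ := by
          intro t ht
          simp only [mem_insert, mem_singleton] at ht
          rcases ht with rfl | rfl | rfl | rfl <;> simp_all
        have := card_le_card this
        have h4 : #({w, x, y, z} : Finset V) = 4 := by
          simp [hcon, hxy.ne, Ne.symm hz.1, Ne.symm hz.2.1]
        omega
      obtain ⟨p, hp, hpx⟩ := hatt x hx
      obtain ⟨q, hq, hqz⟩ := hatt z hz.2.2
      refine exists_linked_of_tails hblock p q [x, y] [z] hp hq (by simp [hpx, hxy]) (by simpa)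
        (by simp [hxy.ne, Ne.symm hz.1, Ne.symm hz.2.1]) (by simp [hx, hy, hz.2.2]) fun w => ?_
      by_cases hw : w ∈ U
      · exact .inl hw
      · exact .inr (by simpa using hall w hw)
    · push Not at hedge
      have hboth : ∀ x ∉ U, G.Adj u x ∧ G.Adj v x := by
        intro x hx
        have hxn : ∀ y, G.Adj x y → y = u ∨ y = v := fun y hxy =>
          hout x hx y hxy (by by_contra hy; exact hedge x hx y hy hxy)
        obtain ⟨y, hxy, hyu⟩ := exists_adj_ne (hδ' x) u
        obtain ⟨z, hxz, hzv⟩ := exists_adj_ne (hδ' x) v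
        have e1 := (hxn y hxy).resolve_left hyu
        have e2 := (hxn z hxz).resolve_right hzv
        exact ⟨e2 ▸ hxz.symm, e1 ▸ hxy.symm⟩
      have hbig : Block G (insert u (insert v ((univ.erase u).erase v))) := by
        refine block_of_common_neighbors huv ?_ ?_ ?_
        · rw [card_erase_of_mem (by simp [Ne.symm huv]), card_erase_of_mem (mem_univ u), card_univ]
          omega
        · intro y hy
          simp only [mem_erase, mem_univ, and_true] at hy
          by_cases hyU : y ∈ U
          · simp only [hU, mem_insert, mem_singleton] at hyU
            rw [G.adj_comm]
            rcases hyU with h | h | h | h | h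
            exacts [absurd h hy.2, absurd h hy.1, h ▸ (ha u).2 (.inl rfl), h ▸ (hb u).2 (.inl rfl),
              h ▸ (hc u).2 (.inl rfl)]
          · exact (hboth y hyU).1
        · intro y hy
          simp only [mem_erase, mem_univ, and_true] at hy
          by_cases hyU : y ∈ U
          · simp only [hU, mem_insert, mem_singleton] at hyU
            rw [G.adj_comm]
            rcases hyU with h | h | h | h | h
            exacts [absurd h hy.2, absurd h hy.1, h ▸ (ha v).2 (.inr rfl), h ▸ (hb v).2 (.inr rfl),
              h ▸ (hc v).2 (.inr rfl)]
          · exact (hboth y hyU).2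
      refine (hbig.linked (mem_insert_self _ _) (mem_insert_self _ _)).exists_linked_univ ?_
      intro x
      by_cases h1 : x = u <;> by_cases h2 : x = v <;> simp [h1, h2]
  · push Not at hatt
    obtain ⟨x, hx, hxU⟩ := hatt
    obtain ⟨p, hp, q, hq, hpq⟩ := exists_adj_of_connected hG huU hx
    have hqx : q ≠ x := fun h => hxU p hp (h ▸ hpq)
    rcases hδ with h6 | hδ
    · have h2 : ({x, q} : Finset V) ⊆ Uᶜ := by
        intro t ht
        simp only [mem_insert, mem_singleton] at ht
        rcases ht with rfl | rfl <;> simpa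
      have := card_le_card h2
      rw [card_pair hqx.symm] at this
      omega
    -- The unattached vertex `x` and its two neighbours are everything outside the block. By
    -- connectivity one of the neighbours is attached, and a single tail passes through `x` to the
    -- other one.
    · obtain ⟨y, hxy, -⟩ := exists_adj_ne (hδ x) x
      obtain ⟨z, hxz, hzy⟩ := exists_adj_ne (hδ x) y
      have hyU : y ∉ U := fun h => hxU y h hxy.symm
      have hzU : z ∉ U := fun h => hxU z h hxz.symm
      have hset : Uᶜ = {x, y, z} := by
        refine (Finset.eq_of_subset_of_card_le ?_ ?_).symm
        · intro v hv
          simp only [mem_insert, mem_singleton] at hv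
          rcases hv with rfl | rfl | rfl <;> simpa
        · rw [card_eq_three.2 ⟨x, y, z, hxy.ne, hxz.ne, hzy.symm, rfl⟩]; omega
      have hq' : q = y ∨ q = z := by
        have : q ∈ Uᶜ := by simpa using hq
        rw [hset] at this
        simpa [hqx] using this
      have fin : ∀ {y z}, G.Adj x y → G.Adj x z → z ≠ y → y ∉ U → z ∉ U → Uᶜ = {x, y, z} →
          G.Adj p y → ∃ s t, Linked G univ s t := by
        intro y z hxy hxz hzy hyU hzU hset hpy
        refine exists_linked_of_tails hblock p p [y, x, z] [] hp hp
          (by simp [hpy, hxy.symm, hxz]) (by simp) (by simp [hxy.ne', hzy.symm, hxz.ne])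
          (by simp [hyU, hx, hzU]) fun w => ?_
        by_cases hw : w ∈ U
        · exact .inl hw
        · rw [← mem_compl, hset] at hw
          exact .inr (by simpa [or_left_comm] using hw)
      rcases hq' with rfl | rfl
      · exact fin hxy hxz hzy hyU hzU hset hpq
      · exact fin hxz hxy hzy.symm hzU hyU (by rw [hset, pair_comm]) hpq

end Quadrilateral

end ProperConnection

namespace ProperConnection

open Finset

variable {V : Type*} [DecidableEq V] [Fintype V] {G : SimpleGraph V}

/-! ### Naming the last one or two vertices -/

section Remaining

lemma forall_mem_or_of_card_le_one {K : List V} (hK : K.Nodup)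
    (h : Fintype.card V ≤ K.length + 1) :
    (∀ z, z ∈ K) ∨ ∃ x, x ∉ K ∧ ∀ z, z ∈ K ∨ z = x := by
  by_cases hx : ∃ x, x ∉ K
  · obtain ⟨x, hx⟩ := hx
    refine .inr ⟨x, hx, fun z => ?_⟩
    by_contra! hz
    have h1 : (z :: x :: K).Nodup := by simp [hK, hx, hz]
    have := h1.length_le_card
    simp only [List.length_cons] at this
    omega
  · push Not at hx
    exact .inl hx

lemma forall_mem_or_of_card_le_two {K : List V} (hK : K.Nodup)
    (h : Fintype.card V ≤ K.length + 2) :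
    (∀ z, z ∈ K) ∨ (∃ x, x ∉ K ∧ ∀ z, z ∈ K ∨ z = x) ∨
      ∃ x y, x ∉ K ∧ y ∉ K ∧ x ≠ y ∧ ∀ z, z ∈ K ∨ z = x ∨ z = y := by
  by_cases hx : ∃ x, x ∉ K
  · obtain ⟨x, hx⟩ := hx
    rcases forall_mem_or_of_card_le_one (K := x :: K) (by simp [hK, hx])
      (by simp only [List.length_cons]; omega) with h1 | ⟨y, hy, h1⟩
    · exact .inr (.inl ⟨x, hx, fun z => by simpa [or_comm] using h1 z⟩)
    · simp only [List.mem_cons, not_or] at hy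
      exact .inr (.inr ⟨x, y, hx, hy.2, Ne.symm hy.1, fun z => by
        have := h1 z
        simp only [List.mem_cons] at this
        tauto⟩)
  · push Not at hx
    exact .inl hx

end Remaining

/-! ### Two of the three vertices share their neighbourhood -/

section Double

/-- Two vertices with neighbours `u, v` and one with neighbours `v, w`. -/
lemma exists_linked_of_double_adjacent [DecidableRel G.Adj] (h8 : Fintype.card V ≤ 8)
    {u v w a b c : V} (hn : [u, v, w, a, b, c].Nodup)
    (ha : ∀ z, G.Adj a z ↔ z = u ∨ z = v) (hb : ∀ z, G.Adj b z ↔ z = u ∨ z = v)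
    (hc : ∀ z, G.Adj c z ↔ z = v ∨ z = w)
    (hδ : ∀ x ∉ [u, v, w, a, b, c], 2 ≤ G.degree x) : ∃ s t, Linked G univ s t := by
  have hrest := forall_mem_or_of_card_le_two hn (by simpa using h8)
  have hau := (ha u).2 (.inl rfl)
  have hav := (ha v).2 (.inr rfl)
  have hbu := (hb u).2 (.inl rfl)
  have hbv := (hb v).2 (.inr rfl)
  have hcv := (hc v).2 (.inl rfl)
  have hcw := (hc w).2 (.inr rfl)
  have hout : ∀ x ∉ [u, v, w, a, b, c], ∀ z, G.Adj x z → z ≠ a ∧ z ≠ b ∧ z ≠ c := by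
    intro x hx z hxz
    simp only [List.mem_cons, not_or] at hx
    refine ⟨?_, ?_, ?_⟩ <;> rintro rfl
    · have := (ha x).1 hxz.symm; tauto
    · have := (hb x).1 hxz.symm; tauto
    · have := (hc x).1 hxz.symm; tauto
  simp only [List.nodup_cons, List.mem_cons, List.not_mem_nil, not_or, or_false, not_false_eq_true,
    List.nodup_nil, and_true] at hn hrest hδ hout
  have hblock : Block G {u, v, a, b} := block_square hn.1.1 (by grind) hau.symm hbu.symm hav.symm
    hbv.symm
  rcases hrest with hcov | ⟨x, hx, hcov⟩ | ⟨x, y, hx, hy, hxy, hcov⟩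
  · exact exists_linked_of_tails hblock v v [c, w] [] (by simp) (by simp) (by simp [hcv.symm, hcw])
      (by simp) (by simp; grind) (by simp; grind) (fun z => by have := hcov z; simp; grind)
  · obtain ⟨z, hxz, -⟩ := exists_adj_ne (hδ x hx) x
    have h1 := hout x hx z hxz
    have h2 : z ≠ x := hxz.ne'
    have h3 : z = u ∨ z = v ∨ z = w := by have := hcov z; tauto
    by_cases h4 : z = w
    · subst h4
      exact exists_linked_of_tails hblock v v [c, z, x] [] (by simp) (by simp)
        (by simp [hcv.symm, hcw, hxz.symm])
        (by simp) (by simp; grind) (by simp; grind) (fun z => by have := hcov z; simp; grind)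
    · exact exists_linked_of_tails hblock v z [c, w] [x] (by simp) (by simp; tauto)
        (by simp [hcv.symm, hcw])
        (by simp [hxz.symm]) (by simp; grind) (by simp; grind) (fun z => by have := hcov z; simp; grind)
  · have hnb : ∀ {x y}, ¬(x = u ∨ x = v ∨ x = w ∨ x = a ∨ x = b ∨ x = c) →
        (∀ z, (z = u ∨ z = v ∨ z = w ∨ z = a ∨ z = b ∨ z = c) ∨ z = x ∨ z = y) →
        ∀ z, G.Adj x z → z = u ∨ z = v ∨ z = w ∨ z = y := by
      intro x y hx hcov z hxz
      have h1 := hout x (by simpa using hx) z hxz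
      have h2 := hxz.ne'
      have h3 := hcov z
      grind
    -- If `x` sees `w`, it lengthens the tail `c, w`. The remaining vertex either continues that
    -- tail or is attached to the square as a tail of its own.
    have htail : ∀ {x y}, x ≠ y → ¬(x = u ∨ x = v ∨ x = w ∨ x = a ∨ x = b ∨ x = c) →
        ¬(y = u ∨ y = v ∨ y = w ∨ y = a ∨ y = b ∨ y = c) →
        (∀ z, (z = u ∨ z = v ∨ z = w ∨ z = a ∨ z = b ∨ z = c) ∨ z = x ∨ z = y) →
        G.Adj x w → ∃ s t, Linked G univ s t := by
      intro x y hxy hx hy hcov hxw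
      obtain ⟨z, hyz, hzw⟩ := exists_adj_ne (hδ y (by simpa using hy)) w
      have h1 := hnb hy (y := x) (fun z => by rw [or_comm (a := z = y)]; exact hcov z) z hyz
      by_cases h2 : z = x
      · subst h2
        exact exists_linked_of_tails hblock v v [c, w, z, y] [] (by simp) (by simp)
          (by simp [hcv.symm, hcw, hxw.symm, hyz.symm])
          (by simp) (by simp; grind) (by simp; grind) (fun z => by have := hcov z; simp; grind)
      · exact exists_linked_of_tails hblock v z [c, w, x] [y] (by simp) (by simp; tauto)
          (by simp [hcv.symm, hcw, hxw.symm])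
          (by simp [hyz.symm]) (by simp; grind) (by simp; grind)
          (fun z => by have := hcov z; simp; grind)
    have hx' : ¬(x = u ∨ x = v ∨ x = w ∨ x = a ∨ x = b ∨ x = c) := by simpa using hx
    have hy' : ¬(y = u ∨ y = v ∨ y = w ∨ y = a ∨ y = b ∨ y = c) := by simpa using hy
    have hcov' : ∀ z, (z = u ∨ z = v ∨ z = w ∨ z = a ∨ z = b ∨ z = c) ∨ z = y ∨ z = x := by
      intro z; rw [or_comm (a := z = y)]; exact hcov z
    by_cases hxw : G.Adj x w
    · exact htail hxy hx' hy' hcov hxw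
    by_cases hyw : G.Adj y w
    · exact htail (Ne.symm hxy) hy' hx' hcov' hyw
    by_cases hadj : G.Adj x y
    · obtain ⟨z, hxz, hzy⟩ := exists_adj_ne (hδ x hx) y
      have h1 := hnb hx' hcov z hxz
      have h2 : z ≠ w := fun h => hxw (h ▸ hxz)
      exact exists_linked_of_tails hblock v z [c, w] [x, y] (by simp) (by simp; tauto)
        (by simp [hcv.symm, hcw])
        (by simp [hxz.symm, hadj]) (by simp; grind) (by simp; grind)
        (fun z => by have := hcov z; simp; grind)
    · have hboth : ∀ {x y}, ¬(x = u ∨ x = v ∨ x = w ∨ x = a ∨ x = b ∨ x = c) →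
          (∀ z, (z = u ∨ z = v ∨ z = w ∨ z = a ∨ z = b ∨ z = c) ∨ z = x ∨ z = y) →
          ¬ G.Adj x w → ¬ G.Adj x y → G.Adj u x ∧ G.Adj v x := by
        intro x y hx hcov hxw hxy
        have hxn : ∀ z, G.Adj x z → z = u ∨ z = v := by
          intro z hxz
          have h1 := hnb hx hcov z hxz
          have h2 : z ≠ w := fun h => hxw (h ▸ hxz)
          have h3 : z ≠ y := fun h => hxy (h ▸ hxz)
          tauto
        obtain ⟨p, hxp, hpu⟩ := exists_adj_ne (hδ x (by simpa using hx)) u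
        obtain ⟨q, hxq, hqv⟩ := exists_adj_ne (hδ x (by simpa using hx)) v
        have e1 := (hxn p hxp).resolve_left hpu
        have e2 := (hxn q hxq).resolve_right hqv
        exact ⟨e2 ▸ hxq.symm, e1 ▸ hxp.symm⟩
      have h1 := hboth hx' hcov hxw hadj
      have h2 := hboth hy' hcov' hyw (fun h => hadj h.symm)
      -- Both extra vertices see exactly `u` and `v`, so they enlarge the square to a complete
      -- bipartite block.
      have hbig : Block G (insert u (insert v {a, b, x, y})) := by
        refine block_of_common_neighbors hn.1.1 ?_ ?_ ?_
        · rw [← card_pair hxy]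
          exact card_le_card (by intro z; simp; tauto)
        · simp [hau.symm, hbu.symm, h1, h2]
        · simp [hav.symm, hbv.symm, h1, h2]
      exact exists_linked_of_tails hbig v v [c, w] [] (by simp) (by simp)
        (by simp [hcv.symm, hcw])
        (by simp) (by simp; grind) (by simp; grind) (fun z => by have := hcov z; simp; grind)

end Double
end ProperConnection

namespace ProperConnection

open Finset

variable {V : Type*} [DecidableEq V] [Fintype V] {G : SimpleGraph V}

section Double

/-- The square on `u, v, a, b` carries the tail `w, c, x`. An eighth vertex has a neighbour other
than `w`, so it prolongs the tail at `x` or hangs on the square. -/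
lemma exists_linked_of_double_of_adj [DecidableRel G.Adj] (h8 : Fintype.card V ≤ 8)
    {u v w x a b c : V} (hn : [u, v, w, x, a, b, c].Nodup)
    (ha : ∀ z, G.Adj a z ↔ z = u ∨ z = v) (hb : ∀ z, G.Adj b z ↔ z = u ∨ z = v)
    (hc : ∀ z, G.Adj c z ↔ z = w ∨ z = x) (hδ : ∀ z, 2 ≤ G.degree z) (hvw : G.Adj v w) :
    ∃ s t, Linked G univ s t := by
  have hrest := forall_mem_or_of_card_le_one hn (by simpa using h8)
  have hau := (ha u).2 (.inl rfl)
  have hav := (ha v).2 (.inr rfl)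
  have hbu := (hb u).2 (.inl rfl)
  have hbv := (hb v).2 (.inr rfl)
  have hcw := (hc w).2 (.inl rfl)
  have hcx := (hc x).2 (.inr rfl)
  simp only [List.nodup_cons, List.mem_cons, List.not_mem_nil, not_or, or_false, not_false_eq_true,
    List.nodup_nil, and_true] at hn hrest
  have hblock : Block G {u, v, a, b} := block_square hn.1.1 (by grind) hau.symm hbu.symm hav.symm
    hbv.symm
  rcases hrest with hcov | ⟨y, hy, hcov⟩
  · exact exists_linked_of_tails hblock v v [w, c, x] [] (by simp) (by simp)
      (by simp [hvw, hcw.symm, hcx])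
      (by simp) (by simp; grind) (by simp; grind) (fun z => by have := hcov z; simp; grind)
  · obtain ⟨z, hyz, hzw⟩ := exists_adj_ne (hδ y) w
    have h1 : z = u ∨ z = v ∨ z = x := by
      have := ha y; have := hb y; have := hc y; have := hcov z
      have := hyz.ne'; have := hyz.symm
      grind
    by_cases h2 : z = x
    · subst h2
      exact exists_linked_of_tails hblock v v [w, c, z, y] [] (by simp) (by simp)
        (by simp [hvw, hcw.symm, hcx, hyz.symm])
        (by simp) (by simp; grind) (by simp; grind) (fun z => by have := hcov z; simp; grind)
    · exact exists_linked_of_tails hblock v z [w, c, x] [y] (by simp) (by simp; tauto)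
        (by simp [hvw, hcw.symm, hcx])
        (by simp [hyz.symm]) (by simp; grind) (by simp; grind)
        (fun z => by have := hcov z; simp; grind)

lemma exists_linked_of_double_of_path (hn8 : Fintype.card V ≤ 8)
    {u v w x y a b c : V} (hn : [u, v, w, x, y, a, b, c].Nodup)
    (ha : ∀ z, G.Adj a z ↔ z = u ∨ z = v) (hb : ∀ z, G.Adj b z ↔ z = u ∨ z = v)
    (hc : ∀ z, G.Adj c z ↔ z = w ∨ z = x) (hvy : G.Adj v y) (hyw : G.Adj y w) :
    ∃ s t, Linked G univ s t := by
  have hcov : ∀ z, z ∈ [u, v, w, x, y, a, b, c] := by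
    intro z
    by_contra hz
    have := (List.nodup_cons.2 ⟨hz, hn⟩).length_le_card
    simp at this
    omega
  simp only [List.nodup_cons, List.mem_cons, List.not_mem_nil, not_or, or_false, not_false_eq_true,
    List.nodup_nil, and_true] at hn hcov
  have hblock : Block G {u, v, a, b} := block_square hn.1.1 (by grind)
    ((ha u).2 (.inl rfl)).symm ((hb u).2 (.inl rfl)).symm ((ha v).2 (.inr rfl)).symm
    ((hb v).2 (.inr rfl)).symm
  exact exists_linked_of_tails hblock v v [y, w, c, x] [] (by simp) (by simp)
      (by simp [hvy, hyw, ((hc w).2 (.inl rfl)).symm, hc])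
      (by simp) (by simp; grind) (by simp; grind) (fun z => by have := hcov z; simp; grind)

/-- Two vertices with neighbours `u, v` and one with neighbours `w, x`. -/
lemma exists_linked_of_double_disjoint [DecidableRel G.Adj] (hG : G.Connected)
    (h8 : Fintype.card V ≤ 8)
    {u v w x a b c : V} (hn : [u, v, w, x, a, b, c].Nodup)
    (ha : ∀ z, G.Adj a z ↔ z = u ∨ z = v) (hb : ∀ z, G.Adj b z ↔ z = u ∨ z = v)
    (hc : ∀ z, G.Adj c z ↔ z = w ∨ z = x) (hδ : ∀ z, 2 ≤ G.degree z) :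
    ∃ s t, Linked G univ s t := by
  have ha' : ∀ z, G.Adj a z ↔ z = v ∨ z = u := fun z => (ha z).trans or_comm
  have hb' : ∀ z, G.Adj b z ↔ z = v ∨ z = u := fun z => (hb z).trans or_comm
  have hc' : ∀ z, G.Adj c z ↔ z = x ∨ z = w := fun z => (hc z).trans or_comm
  have hrest := forall_mem_or_of_card_le_one hn (by simpa using h8)
  have hn0 := hn
  simp only [List.nodup_cons, List.mem_cons, List.not_mem_nil, not_or, or_false, not_false_eq_true,
    List.nodup_nil, and_true] at hn hrest
  by_cases hvw : G.Adj v w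
  · exact exists_linked_of_double_of_adj h8 hn0 ha hb hc hδ hvw
  by_cases hvx : G.Adj v x
  · exact exists_linked_of_double_of_adj h8 (by simp; grind) ha hb hc' hδ hvx
  by_cases huw : G.Adj u w
  · exact exists_linked_of_double_of_adj h8 (by simp; grind) ha' hb' hc hδ huw
  by_cases hux : G.Adj u x
  · exact exists_linked_of_double_of_adj h8 (by simp; grind) ha' hb' hc' hδ hux
  -- With no edge between `{u, v}` and `{w, x}`, connectivity can only be provided by an eighth
  -- vertex adjacent to both sides.
  obtain ⟨p, hp, q, hq, hpq⟩ := exists_adj_of_connected hG (S := {u, v, a, b}) (x := u) (y := c)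
    (by simp) (by simp; grind)
  obtain ⟨p', hp', q', hq', hpq'⟩ := exists_adj_of_connected hG (S := {w, x, c}) (x := c) (y := u)
    (by simp) (by simp; grind)
  simp only [mem_insert, mem_singleton, not_or] at hp hq hp' hq'
  have e1 : p = u ∨ p = v := by have := ha q; have := hb q; grind
  have e2 : p' = w ∨ p' = x := by have := hc q'; grind
  have e3 : q ≠ c := by rintro rfl; have := hc p; have := hpq.symm; grind
  have e4 : q' ≠ a ∧ q' ≠ b := by
    have := ha p'; have := hb p'; have := hpq'.symm
    constructor <;> rintro rfl <;> grind
  have e5 : q ≠ w ∧ q ≠ x := by constructor <;> rintro rfl <;> grind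
  have e6 : q' ≠ u ∧ q' ≠ v := by
    have := hpq'.symm
    constructor <;> rintro rfl <;> grind
  rcases hrest with hcov | ⟨y, hy, hcov⟩
  · have := hcov q
    grind
  · have e7 : q = y := by have := hcov q; grind
    have e8 : q' = y := by have := hcov q'; grind
    subst e7
    subst e8
    have h := hpq'.symm
    rcases e1 with rfl | rfl <;> rcases e2 with rfl | rfl
    · exact exists_linked_of_double_of_path h8 (by simp; grind) ha' hb' hc hpq h
    · exact exists_linked_of_double_of_path h8 (by simp; grind) ha' hb' hc' hpq h
    · exact exists_linked_of_double_of_path h8 (by simp; grind) ha hb hc hpq h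
    · exact exists_linked_of_double_of_path h8 (by simp; grind) ha hb hc' hpq h

end Double

/-! ### Neighbourhoods forming a triangle or a path -/

section Distinct

omit [Fintype V] in
lemma block_of_cycle {a b c d e f : V} (hn : [a, b, c, d, e, f].Nodup) (hab : G.Adj a b)
    (hbc : G.Adj b c) (hcd : G.Adj c d) (hde : G.Adj d e) (hef : G.Adj e f) (hfa : G.Adj f a) :
    Block G {a, b, c, d, e, f} := by
  have hblock : Block G (univ.image ![a, b, c, d, e, f]) := by
    refine block_hexagon ?_ ?_
    · rw [← List.nodup_ofFn]
      simpa [List.ofFn_succ] using hn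
    · intro i
      fin_cases i
      exacts [hab, hbc, hcd, hde, hef, hfa]
  convert hblock using 1
  ext z
  simp [Fin.exists_fin_succ, eq_comm]

/-- Three vertices whose neighbourhoods are the sides of a triangle. -/
lemma exists_linked_of_cyclic [DecidableRel G.Adj] (h8 : Fintype.card V ≤ 8)
    {u v w a b c : V} (hn : [u, v, w, a, b, c].Nodup)
    (ha : ∀ z, G.Adj a z ↔ z = u ∨ z = v) (hb : ∀ z, G.Adj b z ↔ z = v ∨ z = w)
    (hc : ∀ z, G.Adj c z ↔ z = w ∨ z = u)
    (hδ : ∀ x ∉ [u, v, w, a, b, c], 2 ≤ G.degree x) : ∃ s t, Linked G univ s t := by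
  have hrest := forall_mem_or_of_card_le_two hn (by simpa using h8)
  have hn0 := hn
  simp only [List.nodup_cons, List.mem_cons, List.not_mem_nil, not_or, or_false, not_false_eq_true,
    List.nodup_nil, and_true] at hn hrest hδ
  -- The three neighbourhoods close up to a 6-cycle. A vertex outside it has two neighbours, at most
  -- one of which is also outside.
  have hblock : Block G {u, a, v, b, w, c} := block_of_cycle (by simp; grind)
    ((ha u).2 (.inl rfl)).symm ((ha v).2 (.inr rfl)) ((hb v).2 (.inl rfl)).symm
    ((hb w).2 (.inr rfl)) ((hc w).2 (.inl rfl)).symm ((hc u).2 (.inr rfl))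
  have h6 : #({u, a, v, b, w, c} : Finset V) = 6 := by
    have := List.toFinset_card_of_nodup (l := [u, a, v, b, w, c]) (by simp; grind)
    simpa using this
  refine exists_linked_of_attached hblock ⟨u, by simp⟩ (by omega) fun x hx => ?_
  simp only [mem_insert, mem_singleton, not_or] at hx
  by_contra! hcon
  have hx' := hδ x (by tauto)
  obtain ⟨p, hxp, -⟩ := exists_adj_ne hx' x
  obtain ⟨q, hxq, hqp⟩ := exists_adj_ne hx' p
  have h1 := hcon p
  have h2 := hcon q
  simp only [mem_insert, mem_singleton, G.adj_comm _ x] at h1 h2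
  have h3 := hxp.ne
  have h4 := hxq.ne
  rcases hrest with hcov | ⟨y, hy, hcov⟩ | ⟨y, y', hy, hy', hyy', hcov⟩
  all_goals
    have := hcov x; have := hcov p; have := hcov q
    grind

/-- Three vertices whose neighbourhoods are the edges of a path. -/
lemma exists_linked_of_consecutive [DecidableRel G.Adj] (h8 : Fintype.card V ≤ 8)
    {u v w x a b c : V} (hn : [u, v, w, x, a, b, c].Nodup)
    (ha : ∀ z, G.Adj a z ↔ z = u ∨ z = v) (hb : ∀ z, G.Adj b z ↔ z = v ∨ z = w)
    (hc : ∀ z, G.Adj c z ↔ z = w ∨ z = x) (hδ : ∀ z, 2 ≤ G.degree z) :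
    ∃ s t, Linked G univ s t := by
  have hrest := forall_mem_or_of_card_le_one hn (by simpa using h8)
  have hau := (ha u).2 (.inl rfl)
  have hav := (ha v).2 (.inr rfl)
  have hbv := (hb v).2 (.inl rfl)
  have hbw := (hb w).2 (.inr rfl)
  have hcw := (hc w).2 (.inl rfl)
  have hcx := (hc x).2 (.inr rfl)
  simp only [List.nodup_cons, List.mem_cons, List.not_mem_nil, not_or, or_false, not_false_eq_true,
    List.nodup_nil, and_true] at hn hrest
  rcases hrest with hcov | ⟨y, hy, hcov⟩
  · exact exists_linked_of_path u [a, v, b, w, c, x] (by simp [hau.symm, hav, hbv.symm, hbw,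
      hcw.symm, hcx]) (by simp; grind) (fun z => by have := hcov z; simp; grind)
  by_cases hyu : G.Adj y u
  · exact exists_linked_of_path y [u, a, v, b, w, c, x] (by simp [hyu, hau.symm, hav, hbv.symm, hbw,
      hcw.symm, hcx]) (by simp; grind) (fun z => by have := hcov z; simp; grind)
  by_cases hyx : G.Adj y x
  · exact exists_linked_of_path u [a, v, b, w, c, x, y] (by simp [hau.symm, hav, hbv.symm, hbw,
      hcw.symm, hcx, hyx.symm]) (by simp; grind) (fun z => by have := hcov z; simp; grind)
  -- If `y` does not prolong the path `u, a, v, b, w, c, x` at either end, its only neighbours are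
  -- `v` and `w`. Then `v, b, w, y` is a 4-cycle from which both halves of the path hang as tails.
  have hnb : ∀ z, G.Adj y z → z = v ∨ z = w := by
    intro z hyz
    have := ha y; have := hb y; have := hc y; have := hcov z
    have := hyz.ne'; have := hyz.symm
    grind
  obtain ⟨p, hyp, hp⟩ := exists_adj_ne (hδ y) w
  obtain ⟨q, hyq, hq⟩ := exists_adj_ne (hδ y) v
  obtain rfl := (hnb p hyp).resolve_right hp
  obtain rfl := (hnb q hyq).resolve_left hq
  have hblock : Block G {p, q, b, y} := block_square (by grind) (by grind) hbv.symm hyp.symm hbw.symm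
    hyq.symm
  exact exists_linked_of_tails hblock p q [a, u] [c, x] (by simp) (by simp)
    (by simp [hau, hav.symm]) (by simp [hcw.symm, hcx]) (by simp; grind) (by simp; grind)
    (fun z => by have := hcov z; simp; grind)

end Distinct
end ProperConnection

namespace ProperConnection

open Finset

variable {V : Type*} [DecidableEq V] [Fintype V] {G : SimpleGraph V}

/-! ### Recognising an exceptional graph from a list of its vertices -/

section Isomorphism

omit [DecidableEq V] [Fintype V] in
lemma nonempty_iso_of_list {k : ℕ} {H : SimpleGraph (Fin k)} (f : Fin k → V)
    (hn : (List.ofFn f).Nodup) (hcov : ∀ v, v ∈ List.ofFn f)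
    (hadj : ∀ i j, i < j → (G.Adj (f i) (f j) ↔ H.Adj i j)) : Nonempty (G ≃g H) := by
  have hf : Function.Bijective f :=
    ⟨List.nodup_ofFn.1 hn, fun v => by simpa [List.mem_ofFn] using hcov v⟩
  refine ⟨(⟨Equiv.ofBijective f hf, fun {i j} => ?_⟩ : H ≃g G).symm⟩
  simp only [Equiv.ofBijective_apply]
  rcases lt_trichotomy i j with h | rfl | h
  · exact hadj i j h
  · simp
  · rw [G.adj_comm, H.adj_comm]
    exact hadj j i h

end Isomorphism

/-! ### Neighbourhoods forming a star -/

section Star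

/-- The edge `p q` gives the Hamiltonian path `r, c, v, a, p, q, b` on seven vertices. An eighth
vertex is put at the end next to `r`, between `p` and `q`, or on a 4-cycle with `v` and one of `p`,
`q`. -/
lemma exists_linked_of_star_of_adj [DecidableRel G.Adj] (h8 : Fintype.card V ≤ 8)
    {v p q r a b c : V} (hn : [v, p, q, r, a, b, c].Nodup)
    (ha : ∀ z, G.Adj a z ↔ z = v ∨ z = p) (hb : ∀ z, G.Adj b z ↔ z = v ∨ z = q)
    (hc : ∀ z, G.Adj c z ↔ z = v ∨ z = r) (hδ : ∀ z, 2 ≤ G.degree z) (hpq : G.Adj p q) :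
    ∃ s t, Linked G univ s t := by
  have hrest := forall_mem_or_of_card_le_one hn (by simpa using h8)
  have hav := (ha v).2 (.inl rfl)
  have hap := (ha p).2 (.inr rfl)
  have hbv := (hb v).2 (.inl rfl)
  have hbq := (hb q).2 (.inr rfl)
  have hcv := (hc v).2 (.inl rfl)
  have hcr := (hc r).2 (.inr rfl)
  simp only [List.nodup_cons, List.mem_cons, List.not_mem_nil, not_or, or_false, not_false_eq_true,
    List.nodup_nil, and_true] at hn hrest
  rcases hrest with hcov | ⟨y, hy, hcov⟩
  · exact exists_linked_of_path r [c, v, a, p, q, b] (by simp [hcr.symm, hcv, hav.symm, hap, hpq,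
      hbq.symm]) (by simp; grind) (fun z => by have := hcov z; simp; grind)
  by_cases hyr : G.Adj y r
  · exact exists_linked_of_path y [r, c, v, a, p, q, b] (by simp [hyr, hcr.symm, hcv, hav.symm,
      hap, hpq, hbq.symm]) (by simp; grind) (fun z => by have := hcov z; simp; grind)
  have hnb : ∀ z, G.Adj y z → z = v ∨ z = p ∨ z = q := by
    intro z hyz
    have := ha y; have := hb y; have := hc y; have := hcov z
    have := hyz.ne'; have := hyz.symm
    grind
  by_cases hyv : G.Adj y v
  · obtain ⟨z, hyz, hz⟩ := exists_adj_ne (hδ y) v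
    rcases (hnb z hyz).resolve_left hz with rfl | rfl
    · have hblock : Block G {v, z, a, y} := block_square (by grind) (by grind) hav.symm hyv.symm
        hap.symm hyz.symm
      exact exists_linked_of_tails hblock v z [c, r] [q, b] (by simp) (by simp)
        (by simp [hcv.symm, hcr]) (by simp [hpq, hbq.symm]) (by simp; grind) (by simp; grind)
        (fun z => by have := hcov z; simp; grind)
    · have hblock : Block G {v, z, b, y} := block_square (by grind) (by grind) hbv.symm hyv.symm
        hbq.symm hyz.symm
      exact exists_linked_of_tails hblock v z [c, r] [p, a] (by simp) (by simp)
        (by simp [hcv.symm, hcr]) (by simp [hpq.symm, hap.symm]) (by simp; grind) (by simp; grind)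
        (fun z => by have := hcov z; simp; grind)
  · obtain ⟨z, hyz, hz⟩ := exists_adj_ne (hδ y) q
    obtain ⟨z', hyz', hz'⟩ := exists_adj_ne (hδ y) p
    obtain rfl : z = p := by have := hnb z hyz; grind
    obtain rfl : z' = q := by have := hnb z' hyz'; grind
    exact exists_linked_of_path r [c, v, a, z, y, z', b] (by simp [hcr.symm, hcv, hav.symm,
      hap, hyz.symm, hyz', hbq.symm]) (by simp; grind) (fun z => by have := hcov z; simp; grind)

/-- The eighth vertex closes a 4-cycle with `v, a, p` or a 6-cycle with `q, b, v, a, p`. The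
remaining vertices are tails at `v`. -/
lemma exists_linked_of_star_of_common (h8 : Fintype.card V ≤ 8)
    {v p q r y a b c : V} (hn : [y, v, p, q, r, a, b, c].Nodup)
    (ha : ∀ z, G.Adj a z ↔ z = v ∨ z = p) (hb : ∀ z, G.Adj b z ↔ z = v ∨ z = q)
    (hc : ∀ z, G.Adj c z ↔ z = v ∨ z = r) (hyp : G.Adj y p) (hy : G.Adj y v ∨ G.Adj y q) :
    ∃ s t, Linked G univ s t := by
  have hcov : ∀ z, z ∈ [y, v, p, q, r, a, b, c] := by
    intro z
    by_contra hz
    have := (List.nodup_cons.2 ⟨hz, hn⟩).length_le_card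
    simp at this
    omega
  have hav := (ha v).2 (.inl rfl)
  have hap := (ha p).2 (.inr rfl)
  have hbv := (hb v).2 (.inl rfl)
  have hbq := (hb q).2 (.inr rfl)
  have hcv := (hc v).2 (.inl rfl)
  have hcr := (hc r).2 (.inr rfl)
  simp only [List.nodup_cons, List.mem_cons, List.not_mem_nil, not_or, or_false, not_false_eq_true,
    List.nodup_nil, and_true] at hn hcov
  rcases hy with hyv | hyq
  · have hblock : Block G {v, p, a, y} := block_square (by grind) (by grind) hav.symm hyv.symm
      hap.symm hyp.symm
    exact exists_linked_of_tails hblock v v [c, r] [b, q] (by simp) (by simp)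
      (by simp [hcv.symm, hcr]) (by simp [hbv.symm, hbq]) (by simp; grind) (by simp; grind)
      (fun z => by have := hcov z; simp; grind)
  · have hblock : Block G {v, a, p, y, q, b} := block_of_cycle (by simp; grind) hav.symm hap
      hyp.symm hyq hbq.symm hbv
    exact exists_linked_of_tails hblock v v [c, r] [] (by simp) (by simp)
      (by simp [hcv.symm, hcr]) (by simp) (by simp; grind) (by simp; grind)
      (fun z => by have := hcov z; simp; grind)

/-- Three vertices whose neighbourhoods are the edges of a star. -/
lemma exists_linked_or_iso_of_star [DecidableRel G.Adj] (h8 : Fintype.card V ≤ 8)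
    {v p q r a b c : V} (hn : [v, p, q, r, a, b, c].Nodup)
    (ha : ∀ z, G.Adj a z ↔ z = v ∨ z = p) (hb : ∀ z, G.Adj b z ↔ z = v ∨ z = q)
    (hc : ∀ z, G.Adj c z ↔ z = v ∨ z = r) (hδ : ∀ z, 2 ≤ G.degree z) :
    (∃ s t, Linked G univ s t) ∨ Nonempty (G ≃g exceptional₂) := by
  have hrest := forall_mem_or_of_card_le_one hn (by simpa using h8)
  have hn0 := hn
  simp only [List.nodup_cons, List.mem_cons, List.not_mem_nil, not_or, or_false, not_false_eq_true,
    List.nodup_nil, and_true] at hn hrest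
  by_cases hpq : G.Adj p q
  · exact .inl (exists_linked_of_star_of_adj h8 hn0 ha hb hc hδ hpq)
  by_cases hpr : G.Adj p r
  · exact .inl (exists_linked_of_star_of_adj h8 (by simp; grind) ha hc hb hδ hpr)
  by_cases hqr : G.Adj q r
  · exact .inl (exists_linked_of_star_of_adj h8 (by simp; grind) hb hc ha hδ hqr)
  rcases hrest with hcov | ⟨y, hy, hcov⟩
  · right
    -- With `p, q, r` pairwise nonadjacent and no eighth vertex, degree two at `p` leaves only `v`
    -- as a second neighbour. The same holds at `q` and `r`, which yields three triangles.
    have hpv : G.Adj v p := by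
      obtain ⟨z, hz, hza⟩ := exists_adj_ne (hδ p) a
      have := hcov z; have := hz.ne'; have := hb p; have := hc p; have := hz.symm
      grind
    have hqv : G.Adj v q := by
      obtain ⟨z, hz, hza⟩ := exists_adj_ne (hδ q) b
      have := hcov z; have := hz.ne'; have := ha q; have := hc q; have := hz.symm
      have := G.adj_comm p q
      grind
    have hrv : G.Adj v r := by
      obtain ⟨z, hz, hza⟩ := exists_adj_ne (hδ r) c
      have := hcov z; have := hz.ne'; have := ha r; have := hb r; have := hz.symm
      have := G.adj_comm p r; have := G.adj_comm q r
      grind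
    refine nonempty_iso_of_list ![v, p, a, q, b, r, c] (by simp [List.ofFn_succ]; grind)
      (fun z => by have := hcov z; simp [List.ofFn_succ]; grind) ?_
    have ha' : ∀ z, G.Adj z a ↔ z = v ∨ z = p := fun z => by rw [G.adj_comm, ha]
    have hb' : ∀ z, G.Adj z b ↔ z = v ∨ z = q := fun z => by rw [G.adj_comm, hb]
    have hc' : ∀ z, G.Adj z c ↔ z = v ∨ z = r := fun z => by rw [G.adj_comm, hc]
    intro i j hij
    fin_cases i <;> fin_cases j <;> simp at hij <;>
      simp [exceptional₂, ha, hb, ha', hb', hc', hpv, hqv, hrv, hpq, hpr, hqr] <;> grind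
  · left
    have hnb : ∀ z, G.Adj y z → z = v ∨ z = p ∨ z = q ∨ z = r := by
      intro z hyz
      have := ha y; have := hb y; have := hc y; have := hcov z
      have := hyz.ne'; have := hyz.symm
      grind
    obtain ⟨z, hyz, hz⟩ := exists_adj_ne (hδ y) v
    obtain ⟨z', hyz', hz'⟩ := exists_adj_ne (hδ y) z
    have h1 := hnb z' hyz'
    rcases (hnb z hyz).resolve_left hz with rfl | rfl | rfl
    · rcases h1 with rfl | rfl | rfl | rfl
      · exact exists_linked_of_star_of_common h8 (by simp; grind) ha hb hc hyz (.inl hyz')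
      · exact absurd rfl hz'
      · exact exists_linked_of_star_of_common h8 (by simp; grind) ha hb hc hyz (.inr hyz')
      · exact exists_linked_of_star_of_common h8 (by simp; grind) ha hc hb hyz (.inr hyz')
    · rcases h1 with rfl | rfl | rfl | rfl
      · exact exists_linked_of_star_of_common h8 (by simp; grind) hb ha hc hyz (.inl hyz')
      · exact exists_linked_of_star_of_common h8 (by simp; grind) hb ha hc hyz (.inr hyz')
      · exact absurd rfl hz'
      · exact exists_linked_of_star_of_common h8 (by simp; grind) hb hc ha hyz (.inr hyz')
    · rcases h1 with rfl | rfl | rfl | rfl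
      · exact exists_linked_of_star_of_common h8 (by simp; grind) hc ha hb hyz (.inl hyz')
      · exact exists_linked_of_star_of_common h8 (by simp; grind) hc ha hb hyz (.inr hyz')
      · exact exists_linked_of_star_of_common h8 (by simp; grind) hc hb ha hyz (.inr hyz')
      · exact absurd rfl hz'

end Star

/-! ### Neighbourhoods forming two incident edges and a disjoint one -/

section Broken

/-- An edge `u w` gives a Hamiltonian path, and an edge `v y` gives a 4-cycle with two tails at `v`.
Without both, minimum degree two forces the three triangles of the third exception. -/
lemma exists_linked_or_iso_of_broken_of_adj [DecidableRel G.Adj]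
    {u v w x y a b c : V} (hn : [u, v, w, x, y, a, b, c].Nodup)
    (hcov : ∀ z, z ∈ [u, v, w, x, y, a, b, c])
    (ha : ∀ z, G.Adj a z ↔ z = u ∨ z = v) (hb : ∀ z, G.Adj b z ↔ z = v ∨ z = w)
    (hc : ∀ z, G.Adj c z ↔ z = x ∨ z = y) (hδ : ∀ z, 2 ≤ G.degree z)
    (hux : ¬ G.Adj u x) (huy : ¬ G.Adj u y) (hwx : ¬ G.Adj w x) (hwy : ¬ G.Adj w y)
    (hvx : G.Adj v x) :
    (∃ s t, Linked G univ s t) ∨ Nonempty (G ≃g exceptional₃) := by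
  have hau := (ha u).2 (.inl rfl)
  have hav := (ha v).2 (.inr rfl)
  have hbv := (hb v).2 (.inl rfl)
  have hbw := (hb w).2 (.inr rfl)
  have hcx := (hc x).2 (.inl rfl)
  have hcy := (hc y).2 (.inr rfl)
  simp only [List.nodup_cons, List.mem_cons, List.not_mem_nil, not_or, or_false, not_false_eq_true,
    List.nodup_nil, and_true] at hn hcov
  by_cases huw : G.Adj u w
  · exact .inl (exists_linked_of_path y [c, x, v, a, u, w, b] (by simp [hcy.symm, hcx, hvx.symm,
      hav.symm, hau, huw, hbw.symm]) (by simp; grind) (fun z => by have := hcov z; simp; grind))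
  by_cases hvy : G.Adj v y
  · have hblock : Block G {v, c, x, y} := block_square (by grind) (by grind) hvx hvy hcx hcy
    exact .inl (exists_linked_of_tails hblock v v [a, u] [b, w] (by simp) (by simp)
      (by simp [hav.symm, hau]) (by simp [hbv.symm, hbw]) (by simp; grind) (by simp; grind)
      (fun z => by have := hcov z; simp; grind))
  right
  have huv : G.Adj v u := by
    obtain ⟨z, hz, hza⟩ := exists_adj_ne (hδ u) a
    have := hcov z; have := hz.ne'; have := hb u; have := hc u; have := hz.symm
    grind
  have hwv : G.Adj v w := by
    obtain ⟨z, hz, hza⟩ := exists_adj_ne (hδ w) b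
    have := hcov z; have := hz.ne'; have := ha w; have := hc w; have := hz.symm
    have := G.adj_comm u w
    grind
  have hxy : G.Adj x y := by
    obtain ⟨z, hz, hza⟩ := exists_adj_ne (hδ y) c
    have := hcov z; have := hz.ne'; have := ha y; have := hb y; have := hz.symm
    grind
  refine nonempty_iso_of_list ![v, u, a, w, b, x, y, c] (by simp [List.ofFn_succ]; grind)
    (fun z => by have := hcov z; simp [List.ofFn_succ]; grind) ?_
  have ha' : ∀ z, G.Adj z a ↔ z = u ∨ z = v := fun z => by rw [G.adj_comm, ha]
  have hb' : ∀ z, G.Adj z b ↔ z = v ∨ z = w := fun z => by rw [G.adj_comm, hb]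
  have hc' : ∀ z, G.Adj z c ↔ z = x ∨ z = y := fun z => by rw [G.adj_comm, hc]
  intro i j hij
  fin_cases i <;> fin_cases j <;> simp at hij <;>
    simp [exceptional₃, ha, hb, ha', hb', hc', huv, hwv, hvx, hxy, huw, hux, huy, hwx, hwy,
      hvy] <;> grind

/-- Three vertices whose neighbourhoods are two incident edges and an edge disjoint from both. -/
lemma exists_linked_or_iso_of_broken [DecidableRel G.Adj] (hG : G.Connected)
    (h8 : Fintype.card V ≤ 8)
    {u v w x y a b c : V} (hn : [u, v, w, x, y, a, b, c].Nodup)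
    (ha : ∀ z, G.Adj a z ↔ z = u ∨ z = v) (hb : ∀ z, G.Adj b z ↔ z = v ∨ z = w)
    (hc : ∀ z, G.Adj c z ↔ z = x ∨ z = y) (hδ : ∀ z, 2 ≤ G.degree z) :
    (∃ s t, Linked G univ s t) ∨ Nonempty (G ≃g exceptional₃) := by
  have hcov : ∀ z, z ∈ [u, v, w, x, y, a, b, c] := by
    intro z
    by_contra hz
    have := (List.nodup_cons.2 ⟨hz, hn⟩).length_le_card
    simp at this
    omega
  have hpath : ∀ {u v w x y a b c : V}, [u, v, w, x, y, a, b, c].Nodup →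
      (∀ z, z ∈ [u, v, w, x, y, a, b, c]) → (∀ z, G.Adj a z ↔ z = u ∨ z = v) →
      (∀ z, G.Adj b z ↔ z = v ∨ z = w) → (∀ z, G.Adj c z ↔ z = x ∨ z = y) → G.Adj u x →
      ∃ s t, Linked G univ s t := by
    intro u v w x y a b c hn hcov ha hb hc hux
    simp only [List.nodup_cons, List.mem_cons, List.not_mem_nil, not_or, or_false,
      not_false_eq_true, List.nodup_nil, and_true] at hn hcov
    exact exists_linked_of_path y [c, x, u, a, v, b, w] (by simp [G.adj_comm y, G.adj_comm v b,
      G.adj_comm x u, G.adj_comm u a, ha, hb, hc, hux]) (by simp; grind)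
      (fun z => by have := hcov z; simp; grind)
  have ha' : ∀ z, G.Adj a z ↔ z = v ∨ z = u := fun z => (ha z).trans or_comm
  have hb' : ∀ z, G.Adj b z ↔ z = w ∨ z = v := fun z => (hb z).trans or_comm
  have hc' : ∀ z, G.Adj c z ↔ z = y ∨ z = x := fun z => (hc z).trans or_comm
  have hn0 := hn
  have hcov0 := hcov
  simp only [List.nodup_cons, List.mem_cons, List.not_mem_nil, not_or, or_false, not_false_eq_true,
    List.nodup_nil, and_true] at hn hcov
  by_cases hux : G.Adj u x
  · exact .inl (hpath hn0 hcov0 ha hb hc hux)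
  by_cases huy : G.Adj u y
  · exact .inl (hpath (by simp; grind) (fun z => by have := hcov z; simp; grind) ha hb hc' huy)
  by_cases hwx : G.Adj w x
  · exact .inl (hpath (by simp; grind) (fun z => by have := hcov z; simp; grind) hb' ha' hc hwx)
  by_cases hwy : G.Adj w y
  · exact .inl (hpath (by simp; grind) (fun z => by have := hcov z; simp; grind) hb' ha' hc' hwy)
  obtain ⟨p, hp, q, hq, hpq⟩ := exists_adj_of_connected hG (S := {x, y, c}) (x := x) (y := u)
    (by simp) (by simp; grind)
  simp only [mem_insert, mem_singleton, not_or] at hp hq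
  -- With no edge from `u` or `w` to `x` or `y`, the part `{x, y, c}` can be joined to the rest only
  -- at `v`.
  have e1 : q = v := by
    have := hcov q; have := ha p; have := hb p; have := hc q; have := hpq.symm
    grind
  subst e1
  have e2 : p = x ∨ p = y := by
    have := hc q
    grind
  rcases e2 with rfl | rfl
  · exact exists_linked_or_iso_of_broken_of_adj hn0 hcov0 ha hb hc hδ hux huy hwx hwy hpq.symm
  · exact exists_linked_or_iso_of_broken_of_adj (by simp; grind)
      (fun z => by have := hcov z; simp; grind) ha hb hc' hδ huy hux hwy hwx hpq.symm

end Broken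
end ProperConnection

namespace ProperConnection

open Finset

variable {V : Type*} [DecidableEq V] {G : SimpleGraph V}

/-! ### Two neighbourhoods of size two -/

section Pairs

/-- Two pairs are equal, share one element, or are disjoint. -/
lemma pair_cases {P Q : V → Prop} (hP : ∃ u v, u ≠ v ∧ ∀ z, P z ↔ z = u ∨ z = v)
    (hQ : ∃ u v, u ≠ v ∧ ∀ z, Q z ↔ z = u ∨ z = v) :
    (∃ u v, u ≠ v ∧ (∀ z, P z ↔ z = u ∨ z = v) ∧ ∀ z, Q z ↔ z = u ∨ z = v) ∨
    (∃ u v w, [u, v, w].Nodup ∧ (∀ z, P z ↔ z = u ∨ z = v) ∧ ∀ z, Q z ↔ z = v ∨ z = w) ∨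
    ∃ u v w x, [u, v, w, x].Nodup ∧ (∀ z, P z ↔ z = u ∨ z = v) ∧ ∀ z, Q z ↔ z = w ∨ z = x := by
  obtain ⟨u, v, huv, hP⟩ := hP
  obtain ⟨w, x, hwx, hQ⟩ := hQ
  have hP' : ∀ z, P z ↔ z = v ∨ z = u := fun z => (hP z).trans or_comm
  have hQ' : ∀ z, Q z ↔ z = x ∨ z = w := fun z => (hQ z).trans or_comm
  by_cases h1 : w = u
  · subst h1
    by_cases h2 : x = v
    · subst h2; exact .inl ⟨w, x, hwx, hP, hQ⟩
    · exact .inr (.inl ⟨v, w, x, by simp; grind, hP', hQ⟩)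
  by_cases h2 : w = v
  · subst h2
    by_cases h3 : x = u
    · subst h3; exact .inl ⟨x, w, huv, hP, hQ'⟩
    · exact .inr (.inl ⟨u, w, x, by simp; grind, hP, hQ⟩)
  by_cases h3 : x = u
  · subst h3; exact .inr (.inl ⟨v, x, w, by simp; grind, hP', hQ'⟩)
  by_cases h4 : x = v
  · subst h4; exact .inr (.inl ⟨u, x, w, by simp; grind, hP, hQ'⟩)
  exact .inr (.inr ⟨u, v, w, x, by simp; grind, hP, hQ⟩)

variable [Fintype V] [DecidableRel G.Adj]

omit [DecidableEq V] in
lemma exists_pair_of_degree_eq_two {a : V} (h : G.degree a = 2) :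
    ∃ u v, u ≠ v ∧ ∀ z, G.Adj a z ↔ z = u ∨ z = v := by
  classical
  rw [← G.card_neighborFinset_eq_degree, card_eq_two] at h
  obtain ⟨u, v, huv, h⟩ := h
  refine ⟨u, v, huv, fun z => ?_⟩
  rw [← G.mem_neighborFinset, h]
  simp

omit [DecidableEq V] in
lemma exists_of_degree_eq_one {a : V} (h : G.degree a = 1) : ∃ u, ∀ z, G.Adj a z ↔ z = u := by
  rw [← G.card_neighborFinset_eq_degree, card_eq_one] at h
  obtain ⟨u, h⟩ := h
  refine ⟨u, fun z => ?_⟩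
  rw [← G.mem_neighborFinset, h]
  simp

end Pairs

/-! ### Three independent vertices of degree two -/

section Small

variable [Fintype V] [DecidableRel G.Adj]

/-- Three independent vertices of degree two. -/
lemma exists_linked_or_iso_of_degree_two (hG : G.Connected) (h8 : Fintype.card V ≤ 8) {a b c : V}
    (hab : a ≠ b) (hac : a ≠ c) (hbc : b ≠ c) (hab' : ¬ G.Adj a b) (hac' : ¬ G.Adj a c)
    (hbc' : ¬ G.Adj b c) (ha : G.degree a = 2) (hb : G.degree b = 2) (hc : G.degree c = 2)
    (hδ : Fintype.card V ≤ 6 ∨ ∀ x, 2 ≤ G.degree x) :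
    (∃ s t, Linked G univ s t) ∨ Nonempty (G ≃g exceptional₂) ∨ Nonempty (G ≃g exceptional₃) := by
  -- The patterns that need minimum degree two everywhere involve at least seven vertices, which
  -- rules out the first alternative of `hδ`.
  have hδ' : ∀ {l : List V}, l.Nodup → 7 ≤ l.length → ∀ x, 2 ≤ G.degree x := by
    intro l hl h7
    have := hl.length_le_card
    exact hδ.resolve_left (by omega)
  have hδ6 : ∀ {l : List V}, l.Nodup → 6 ≤ l.length → ∀ x ∉ l, 2 ≤ G.degree x := by
    intro l hl h7 x hx
    exact hδ' (List.nodup_cons.2 ⟨hx, hl⟩) (by simpa using h7) x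
  -- The neighbourhoods of `a`, `b`, `c` are regarded as three edges on the other vertices, and the
  -- cases are the possible shapes. Here two of the edges coincide.
  have key : ∀ {a b c : V}, a ≠ b → a ≠ c → b ≠ c → ¬ G.Adj a b → ¬ G.Adj a c → ¬ G.Adj b c →
      ∀ {u v s t}, u ≠ v → s ≠ t → (∀ z, G.Adj a z ↔ z = u ∨ z = v) →
      (∀ z, G.Adj b z ↔ z = u ∨ z = v) → (∀ z, G.Adj c z ↔ z = s ∨ z = t) →
      ∃ s t, Linked G univ s t := by
    intro a b c hab hac hbc hab' hac' hbc' u v s t huv hst ha hb hc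
    have hba' := mt SimpleGraph.Adj.symm hab'
    have hca' := mt SimpleGraph.Adj.symm hac'
    have hcb' := mt SimpleGraph.Adj.symm hbc'
    have ea := G.irrefl (v := a)
    have eb := G.irrefl (v := b)
    have ec := G.irrefl (v := c)
    rw [ha] at hab' hac' ea
    rw [hb] at hbc' hba' eb
    rw [hc] at hca' hcb' ec
    have ha' : ∀ z, G.Adj a z ↔ z = v ∨ z = u := fun z => (ha z).trans or_comm
    have hb' : ∀ z, G.Adj b z ↔ z = v ∨ z = u := fun z => (hb z).trans or_comm
    have hc' : ∀ z, G.Adj c z ↔ z = t ∨ z = s := fun z => (hc z).trans or_comm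
    have hadj : ∀ {u v t : V}, [u, v, t, a, b, c].Nodup → (∀ z, G.Adj a z ↔ z = u ∨ z = v) →
      (∀ z, G.Adj b z ↔ z = u ∨ z = v) → (∀ z, G.Adj c z ↔ z = v ∨ z = t) →
      ∃ s t, Linked G univ s t := fun hn ha hb hc =>
        exists_linked_of_double_adjacent h8 hn ha hb hc (hδ6 hn (by simp))
    by_cases h1 : s = u
    · subst h1
      by_cases h2 : t = v
      · subst h2; exact exists_linked_of_triple hG h8 (by simp; grind) ha hb hc hδ
      · exact hadj (by simp; grind) ha' hb' hc
    by_cases h2 : s = v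
    · subst h2
      by_cases h3 : t = u
      · subst h3; exact exists_linked_of_triple hG h8 (by simp; grind) ha hb hc' hδ
      · exact hadj (by simp; grind) ha hb hc
    by_cases h3 : t = u
    · subst h3; exact hadj (by simp; grind) ha' hb' hc'
    by_cases h4 : t = v
    · subst h4; exact hadj (by simp; grind) ha hb hc'
    have hn : [u, v, s, t, a, b, c].Nodup := by simp; grind
    exact exists_linked_of_double_disjoint hG h8 hn ha hb hc (hδ' hn (by simp))
  obtain ⟨s, t, hst, hc⟩ := exists_pair_of_degree_eq_two hc
  have hba' := mt SimpleGraph.Adj.symm hab'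
  have hca' := mt SimpleGraph.Adj.symm hac'
  have hcb' := mt SimpleGraph.Adj.symm hbc'
  have hc' : ∀ z, G.Adj c z ↔ z = t ∨ z = s := fun z => (hc z).trans or_comm
  have hab'' := hab'
  have hac'' := hac'
  have hbc'' := hbc'
  have ea := G.irrefl (v := a)
  have eb := G.irrefl (v := b)
  have ec := G.irrefl (v := c)
  rcases pair_cases (exists_pair_of_degree_eq_two ha) (exists_pair_of_degree_eq_two hb) with
    ⟨u, v, huv, ha, hb⟩ | ⟨u, v, w, hn, ha, hb⟩ | ⟨u, v, w, x, hn, ha, hb⟩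
  · exact .inl (key hab hac hbc hab' hac' hbc' huv hst ha hb hc)
  · simp only [List.nodup_cons, List.mem_cons, List.not_mem_nil, not_or, or_false,
      not_false_eq_true, List.nodup_nil, and_true] at hn
    have ha' : ∀ z, G.Adj a z ↔ z = v ∨ z = u := fun z => (ha z).trans or_comm
    have hb' : ∀ z, G.Adj b z ↔ z = w ∨ z = v := fun z => (hb z).trans or_comm
    rw [ha] at hab'' hac'' ea
    rw [hb] at hbc'' hba' eb
    have hca := hca'
    rw [hc] at hca' hcb' ec
    -- Two of the edges form the path `u, v, w`. Up to exchanging `s` and `t`, the third edge has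
    -- its end `s` on that path or is disjoint from it.
    have fin : ∀ {s t : V}, s ≠ t → (s = u ∨ s = v ∨ s = w ∨ (t ≠ u ∧ t ≠ v ∧ t ≠ w)) →
        ¬(a = s ∨ a = t) → ¬(b = s ∨ b = t) → ¬(c = s ∨ c = t) →
        (∀ z, G.Adj c z ↔ z = s ∨ z = t) →
        (∃ s t, Linked G univ s t) ∨ Nonempty (G ≃g exceptional₂) ∨
          Nonempty (G ≃g exceptional₃) := by
      intro s t hst hs hca' hcb' ec hc
      have hc' : ∀ z, G.Adj c z ↔ z = t ∨ z = s := fun z => (hc z).trans or_comm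
      by_cases h1 : s = u
      · subst h1
        left
        by_cases h2 : t = v
        · subst h2
          exact key hac hab hbc.symm hac' hab' (mt SimpleGraph.Adj.symm hbc') hst hn.2 ha hc hb
        by_cases h3 : t = w
        · subst h3
          have hn' : [s, v, t, a, b, c].Nodup := by simp; grind
          exact exists_linked_of_cyclic h8 hn' ha hb hc' (hδ6 hn' (by simp))
        have hn' : [t, s, v, w, c, a, b].Nodup := by simp; grind
        exact exists_linked_of_consecutive h8 hn' hc' ha hb (hδ' hn' (by simp))
      by_cases h2 : s = v
      · subst h2
        by_cases h3 : t = u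
        · subst h3
          exact .inl (key hac hab hbc.symm hac' hab' (mt SimpleGraph.Adj.symm hbc') (Ne.symm hst) hn.2 ha hc' hb)
        by_cases h4 : t = w
        · subst h4
          exact .inl (key hbc hab.symm hac.symm hbc' (mt SimpleGraph.Adj.symm hab') hca hst hn.1.1
            hb hc ha)
        have hn' : [s, u, w, t, a, b, c].Nodup := by simp; grind
        exact (exists_linked_or_iso_of_star h8 hn' ha' hb hc (hδ' hn' (by simp))).imp_right .inl
      by_cases h3 : s = w
      · subst h3
        left
        by_cases h4 : t = v
        · subst h4
          exact key hbc hab.symm hac.symm hbc' (mt SimpleGraph.Adj.symm hab') hca (Ne.symm hst) hn.1.1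
            hb hc' ha
        by_cases h5 : t = u
        · subst h5
          have hn' : [t, v, s, a, b, c].Nodup := by simp; grind
          exact exists_linked_of_cyclic h8 hn' ha hb hc (hδ6 hn' (by simp))
        have hn' : [u, v, s, t, a, b, c].Nodup := by simp; grind
        exact exists_linked_of_consecutive h8 hn' ha hb hc (hδ' hn' (by simp))
      have hn' : [u, v, w, s, t, a, b, c].Nodup := by simp; grind
      exact (exists_linked_or_iso_of_broken hG h8 hn' ha hb hc
        (hδ' hn' (by simp))).imp_right .inr
    by_cases hs : s = u ∨ s = v ∨ s = w ∨ (t ≠ u ∧ t ≠ v ∧ t ≠ w)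
    · exact fin hst hs hca' hcb' ec hc
    · exact fin (Ne.symm hst) (by grind) (by grind) (by grind) (by grind) hc'
  · simp only [List.nodup_cons, List.mem_cons, List.not_mem_nil, not_or, or_false,
      not_false_eq_true, List.nodup_nil, and_true] at hn
    have ha' : ∀ z, G.Adj a z ↔ z = v ∨ z = u := fun z => (ha z).trans or_comm
    have hb' : ∀ z, G.Adj b z ↔ z = x ∨ z = w := fun z => (hb z).trans or_comm
    rw [ha] at hab'' hac'' ea
    rw [hb] at hbc'' hba' eb
    have hca := hca'
    rw [hc] at hca' hcb' ec
    -- Two disjoint edges and a third that meets the first at `v`. It either reaches the second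
    -- edge, giving a path, or leaves the second edge isolated.
    have hmeet : ∀ {u v w x t a b c : V}, [u, v, w, x, a, b, c].Nodup →
        (∀ z, G.Adj a z ↔ z = u ∨ z = v) → (∀ z, G.Adj b z ↔ z = w ∨ z = x) →
        (∀ z, G.Adj c z ↔ z = v ∨ z = t) → t ∉ [u, v, a, b, c] →
        (∃ s t, Linked G univ s t) ∨ Nonempty (G ≃g exceptional₂) ∨
          Nonempty (G ≃g exceptional₃) := by
      intro u v w x t a b c hn ha hb hc ht
      have hδ'' := hδ' hn (by simp)
      have hb' : ∀ z, G.Adj b z ↔ z = x ∨ z = w := fun z => (hb z).trans or_comm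
      simp only [List.nodup_cons, List.mem_cons, List.not_mem_nil, not_or, or_false,
        not_false_eq_true, List.nodup_nil, and_true] at hn ht
      by_cases h1 : t = w
      · subst h1
        exact .inl (exists_linked_of_consecutive h8 (by simp; grind) ha hc hb hδ'')
      by_cases h2 : t = x
      · subst h2
        exact .inl (exists_linked_of_consecutive h8 (by simp; grind) ha hc hb' hδ'')
      exact (exists_linked_or_iso_of_broken hG h8 (by simp; grind) ha hc hb hδ'').imp_right .inr
    have hn' : [u, v, w, x, a, b, c].Nodup := by simp; grind
    by_cases h1 : s = u
    · subst h1
      by_cases h2 : t = v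
      · subst h2
        exact .inl (key hac hab hbc.symm hac' hab' (mt SimpleGraph.Adj.symm hbc') hst hn.2.2 ha hc hb)
      · exact hmeet (by simp; grind) ha' hb hc (by simp; grind)
    by_cases h2 : s = v
    · subst h2
      by_cases h3 : t = u
      · subst h3
        exact .inl (key hac hab hbc.symm hac' hab' (mt SimpleGraph.Adj.symm hbc') (Ne.symm hst) hn.2.2 ha hc' hb)
      · exact hmeet hn' ha hb hc (by simp; grind)
    by_cases h3 : t = u
    · subst h3
      exact hmeet (by simp; grind) ha' hb hc' (by simp; grind)
    by_cases h4 : t = v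
    · subst h4
      exact hmeet hn' ha hb hc' (by simp; grind)
    by_cases h5 : s = w
    · subst h5
      by_cases h6 : t = x
      · subst h6
        exact .inl (key hbc hab.symm hac.symm hbc' (mt SimpleGraph.Adj.symm hab') hca hst hn.1.1 hb hc ha)
      · exact hmeet (by simp; grind) hb' ha hc (by simp; grind)
    by_cases h6 : s = x
    · subst h6
      by_cases h7 : t = w
      · subst h7
        exact .inl (key hbc hab.symm hac.symm hbc' (mt SimpleGraph.Adj.symm hab') hca (Ne.symm hst) hn.1.1 hb hc'
          ha)
      · exact hmeet (by simp; grind) hb ha hc (by simp; grind)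
    by_cases h7 : t = w
    · subst h7
      exact hmeet (by simp; grind) hb' ha hc' (by simp; grind)
    by_cases h8' : t = x
    · subst h8'
      exact hmeet (by simp; grind) hb ha hc' (by simp; grind)
    -- Three disjoint neighbourhoods together with `a, b, c` would need nine vertices.
    have h9 : [s, t, u, v, w, x, a, b, c].Nodup := by simp; grind
    have := h9.length_le_card
    simp at this
    omega

end Small
end ProperConnection

namespace ProperConnection

open Finset

variable {V : Type*} [DecidableEq V] [Fintype V] {G : SimpleGraph V} [DecidableRel G.Adj]

/-! ### A pendant vertex, and the reduction for independent triples -/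

section Small

/-- An independent triple with degrees one, two, two in a graph with at most six vertices. -/
lemma exists_linked_or_iso_of_degree_one (hG : G.Connected) (h6 : Fintype.card V ≤ 6) {a b c : V}
    (hab : a ≠ b) (hac : a ≠ c) (hbc : b ≠ c) (hab' : ¬ G.Adj a b) (hac' : ¬ G.Adj a c)
    (hbc' : ¬ G.Adj b c) (ha : G.degree a = 1) (hb : G.degree b = 2) (hc : G.degree c = 2)
    (hδ : Fintype.card V = 6 → ∀ x, x ≠ a → ¬ G.Adj a x → 2 ≤ G.degree x) :
    (∃ s t, Linked G univ s t) ∨ Nonempty (G ≃g exceptional₁) := by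
  obtain ⟨p, ha⟩ := exists_of_degree_eq_one ha
  have hba' := mt SimpleGraph.Adj.symm hab'
  have hca' := mt SimpleGraph.Adj.symm hac'
  have hcb' := mt SimpleGraph.Adj.symm hbc'
  have ea := G.irrefl (v := a)
  have eb := G.irrefl (v := b)
  have ec := G.irrefl (v := c)
  have hap := (ha p).2 rfl
  rw [ha] at hab' hac' ea
  rcases pair_cases (exists_pair_of_degree_eq_two hb) (exists_pair_of_degree_eq_two hc) with
    ⟨u, v, huv, hb, hc⟩ | ⟨u, v, w, hn, hb, hc⟩ | ⟨u, v, w, x, hn, hb, hc⟩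
  · left
    rw [hb] at hbc' hba' eb
    rw [hc] at hca' hcb' ec
    have hn : [u, v, a, b, c].Nodup := by simp; grind
    have hrest := forall_mem_or_of_card_le_one hn (by simpa using h6)
    simp only [List.nodup_cons, List.mem_cons, List.not_mem_nil, not_or, or_false,
      not_false_eq_true, List.nodup_nil, and_true] at hn hrest
    have hblock : Block G {u, v, b, c} := block_square huv hbc ((hb u).2 (.inl rfl)).symm
      ((hc u).2 (.inl rfl)).symm ((hb v).2 (.inr rfl)).symm ((hc v).2 (.inr rfl)).symm
    rcases hrest with hcov | ⟨w, hw, hcov⟩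
    · exact exists_linked_of_tails hblock p p [a] [] (by have := hcov p; simp; grind)
        (by have := hcov p; simp; grind) (by simp [hap.symm]) (by simp) (by simp)
        (by simp; grind) (fun z => by have := hcov z; simp; grind)
    by_cases hpw : p = w
    · subst hpw
      obtain ⟨q, hq, r, hr, hqr⟩ := exists_adj_of_connected hG (S := {p, a}) (x := p) (y := u)
        (by simp) (by simp; grind)
      simp only [mem_insert, mem_singleton, not_or] at hq hr
      obtain rfl : q = p := by have := ha r; grind
      exact exists_linked_of_tails hblock r r [q, a] [] (by have := hcov r; simp; grind)
        (by have := hcov r; simp; grind) (by simp [hap.symm, hqr.symm]) (by simp) (by simp; grind)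
        (by simp; grind) (fun z => by have := hcov z; simp; grind)
    · obtain ⟨q, hq, r, hr, hqr⟩ := exists_adj_of_connected hG (S := {w}) (x := w) (y := u)
        (by simp) (by simp; grind)
      rw [mem_singleton] at hq hr
      subst hq
      have hra : r ≠ a := by
        rintro rfl
        exact hpw ((ha q).1 hqr.symm).symm
      exact exists_linked_of_tails hblock p r [a] [q] (by have := hcov p; simp; grind)
        (by have := hcov r; simp; grind) (by simp [hap.symm]) (by simp [hqr.symm]) (by simp; grind)
        (by simp; grind) (fun z => by have := hcov z; simp; grind)
  · have hbu := (hb u).2 (.inl rfl)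
    have hbv := (hb v).2 (.inr rfl)
    have hcv := (hc v).2 (.inl rfl)
    have hcw := (hc w).2 (.inr rfl)
    rw [hb] at hbc' hba' eb
    rw [hc] at hca' hcb' ec
    have hn' : [u, v, w, a, b, c].Nodup := by
      simp only [List.nodup_cons, List.mem_cons, List.not_mem_nil, not_or, or_false,
        not_false_eq_true, List.nodup_nil, and_true] at hn ⊢
      grind
    have hcov : ∀ z, z ∈ [u, v, w, a, b, c] := by
      intro z
      by_contra hz
      have := (List.nodup_cons.2 ⟨hz, hn'⟩).length_le_card
      simp at this
      omega
    have hcard : Fintype.card V = 6 := le_antisymm h6 (by simpa using hn'.length_le_card)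
    simp only [List.nodup_cons, List.mem_cons, List.not_mem_nil, not_or, or_false,
      not_false_eq_true, List.nodup_nil, and_true] at hn' hcov
    by_cases h1 : p = u
    · subst h1
      exact .inl (exists_linked_of_path a [p, b, v, c, w] (by simp [hap, hbu.symm, hbv, hcv.symm,
        hcw]) (by simp; grind) (fun z => by have := hcov z; simp; grind))
    by_cases h2 : p = w
    · subst h2
      exact .inl (exists_linked_of_path u [b, v, c, p, a] (by simp [hap.symm, hbu.symm, hbv,
        hcv.symm, hcw]) (by simp; grind) (fun z => by have := hcov z; simp; grind))
    -- The pendant vertex at an end of the path `u, b, v, c, w` gives a Hamiltonian path. It remains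
    -- to treat a pendant vertex at the middle.
    obtain rfl : p = v := by have := hcov p; grind
    by_cases huw : G.Adj u w
    · exact .inl (exists_linked_of_path a [p, b, u, w, c] (by simp [hap, hbu, hbv.symm, huw,
        hcw.symm]) (by simp; grind) (fun z => by have := hcov z; simp; grind))
    right
    have hup : G.Adj p u := by
      obtain ⟨z, hz, hzb⟩ := exists_adj_ne (hδ hcard u (by grind) (by rw [ha]; grind)) b
      have := hcov z; have := hz.ne'; have := ha u; have := hc u; have := hz.symm
      grind
    have hwp : G.Adj p w := by
      obtain ⟨z, hz, hzb⟩ := exists_adj_ne (hδ hcard w (by grind) (by rw [ha]; grind)) c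
      have := hcov z; have := hz.ne'; have := ha w; have := hb w; have := hz.symm
      have := G.adj_comm u w
      grind
    refine nonempty_iso_of_list ![p, a, u, b, w, c] (by simp [List.ofFn_succ]; grind)
      (fun z => by have := hcov z; simp [List.ofFn_succ]; grind) ?_
    have ha' : ∀ z, G.Adj z a ↔ z = p := fun z => by rw [G.adj_comm, ha]
    have hb' : ∀ z, G.Adj z b ↔ z = u ∨ z = p := fun z => by rw [G.adj_comm, hb]
    have hc' : ∀ z, G.Adj z c ↔ z = p ∨ z = w := fun z => by rw [G.adj_comm, hc]
    intro i j hij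
    fin_cases i <;> fin_cases j <;> simp at hij <;>
      simp [exceptional₁, ha, hb, ha', hb', hc', huw, hup, hwp] <;> grind
  · rw [hb] at hbc' hba' eb
    rw [hc] at hca' hcb' ec
    have hn' : [u, v, w, x, a, b, c].Nodup := by
      simp only [List.nodup_cons, List.mem_cons, List.not_mem_nil, not_or, or_false,
        not_false_eq_true, List.nodup_nil, and_true] at hn ⊢
      grind
    have := hn'.length_le_card
    simp at this
    omega

/-- An independent triple of vertices of degree at most two. -/
lemma exists_linked_or_iso_of_independent (hG : G.Connected) (h5 : 5 ≤ Fintype.card V)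
    (hdeg : ∀ x y, x ≠ y → ¬ G.Adj x y → Fintype.card V ≤ 2 * (G.degree x + G.degree y))
    {a b c : V} (hab : a ≠ b) (hac : a ≠ c) (hbc : b ≠ c) (hab' : ¬ G.Adj a b)
    (hac' : ¬ G.Adj a c) (hbc' : ¬ G.Adj b c) (ha : G.degree a ≤ 2) (hb : G.degree b ≤ 2)
    (hc : G.degree c ≤ 2) :
    (∃ s t, Linked G univ s t) ∨ Nonempty (G ≃g exceptional₁) ∨ Nonempty (G ≃g exceptional₂) ∨
      Nonempty (G ≃g exceptional₃) := by
  have h1 := hdeg a b hab hab'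
  have h2 := hdeg a c hac hac'
  have h3 := hdeg b c hbc hbc'
  -- With at least five vertices, two nonadjacent vertices have degree sum at least three, so at
  -- most one of `a, b, c` has degree one. If one does, there are at most six vertices.
  have hone : ∀ {a b c : V}, a ≠ b → a ≠ c → b ≠ c → ¬ G.Adj a b → ¬ G.Adj a c → ¬ G.Adj b c →
      G.degree a = 1 → G.degree b = 2 → G.degree c = 2 → (∃ s t, Linked G univ s t) ∨
        Nonempty (G ≃g exceptional₁) ∨ Nonempty (G ≃g exceptional₂) ∨
        Nonempty (G ≃g exceptional₃) := by
    intro a b c hab hac hbc hab' hac' hbc' ha hb hc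
    have h1 := hdeg a b hab hab'
    refine (exists_linked_or_iso_of_degree_one hG (by omega) hab hac hbc hab' hac' hbc' ha hb hc
      fun h6 x hx hax => ?_).imp_right .inl
    have := hdeg a x (Ne.symm hx) hax
    omega
  have hpos : ∀ x, 1 ≤ G.degree x := fun x => by
    have : Nontrivial V := ⟨a, b, hab⟩
    exact hG.preconnected.degree_pos_of_nontrivial x
  have ha0 := hpos a
  have hb0 := hpos b
  have hc0 := hpos c
  by_cases ha1 : G.degree a = 1
  · exact hone hab hac hbc hab' hac' hbc' ha1 (by omega) (by omega)
  by_cases hb1 : G.degree b = 1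
  · exact hone (Ne.symm hab) hbc hac (mt SimpleGraph.Adj.symm hab') hbc' hac' hb1 (by omega)
      (by omega)
  by_cases hc1 : G.degree c = 1
  · exact hone (Ne.symm hac) (Ne.symm hbc) hab (mt SimpleGraph.Adj.symm hac')
      (mt SimpleGraph.Adj.symm hbc') hab' hc1 (by omega) (by omega)
  refine (exists_linked_or_iso_of_degree_two hG (by omega) hab hac hbc hab' hac' hbc' (by omega)
    (by omega) (by omega) ?_).imp_right .inr
  by_cases h6 : Fintype.card V ≤ 6
  · exact .inl h6
  -- With at least seven vertices, degree sums of nonadjacent vertices are at least four. A vertex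
  -- not adjacent to `a` or not adjacent to `b` therefore has degree at least two, and a vertex
  -- adjacent to both has it anyway.
  refine .inr fun x => ?_
  by_cases hxa : x = a
  · subst hxa; omega
  by_cases hxb : x = b
  · subst hxb; omega
  by_cases hxa' : G.Adj x a
  · by_cases hxb' : G.Adj x b
    · rw [← G.card_neighborFinset_eq_degree, ← card_pair hab]
      exact card_le_card (by simp [insert_subset_iff, hxa', hxb'])
    · have := hdeg x b hxb hxb'
      omega
  · have := hdeg x a hxa hxa'
    omega

end Small

/-! ### Combining the cases -/

section Main

/-- The degree condition makes the whole graph linked, up to three exceptions. -/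
lemma exists_linked_or_iso (hG : G.Connected) (h5 : 5 ≤ Fintype.card V)
    (hdeg : ∀ x y, x ≠ y → ¬ G.Adj x y → Fintype.card V ≤ 2 * (G.degree x + G.degree y)) :
    (∃ s t, Linked G univ s t) ∨ Nonempty (G ≃g exceptional₁) ∨ Nonempty (G ≃g exceptional₂) ∨
      Nonempty (G ≃g exceptional₃) := by
  by_cases hno : ∃ s t, Linked G univ s t
  · exact .inl hno
  obtain ⟨σ, hσ⟩ := exists_isOptimalCut G
  obtain ⟨A, B, C, hA, hB, hC, hAB, hAC, hBC⟩ := exists_three_isEnd hG hσ.1 (by simpa using hno)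
  have hsmall : ∀ {a}, IsEnd (cutGraph G σ) {a} → G.degree a ≤ 2 := by
    intro a ha
    rw [degree_eq_cnt]
    exact (hσ.1.cnt_le {a}).trans (by rw [ha.cnt_eq])
  -- The case is decided by how many of the three ends are single vertices. The order of the ends
  -- does not matter.
  rcases hA.card_eq_one_or with ⟨a, rfl⟩ | hA4 <;> rcases hB.card_eq_one_or with ⟨b, rfl⟩ | hB4 <;>
    rcases hC.card_eq_one_or with ⟨c, rfl⟩ | hC4 <;>
    try simp only [disjoint_singleton_left, disjoint_singleton_right, mem_singleton] at hAB hAC hBC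
  · rw [eq_comm] at hAB hAC hBC
    exact exists_linked_or_iso_of_independent hG h5 hdeg hAB hAC hBC
      (hσ.not_adj hG hA hB hC hAB (by simpa) (by simpa))
      (hσ.not_adj hG hA hC hB hAC (by simpa) (by simpa using Ne.symm hBC))
      (hσ.not_adj hG hB hC hA hBC (by simpa using Ne.symm hAB) (by simpa using Ne.symm hAC))
      (hsmall hA) (hsmall hB) (hsmall hC)
  · exact .inl (exists_linked_of_one_block hG hσ.1 hdeg hA hB hC (Ne.symm hAB)
      (hσ.not_adj hG hA hB hC (Ne.symm hAB) hAC hBC) hAC hBC hC4)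
  · exact .inl (exists_linked_of_one_block hG hσ.1 hdeg hA hC hB (Ne.symm hAC)
      (hσ.not_adj hG hA hC hB (Ne.symm hAC) hAB hBC) hAB hBC hB4)
  · exact .inl (exists_linked_of_two_blocks hG hσ.1 hdeg hA hB hC hAB hAC hBC hB4 hC4)
  · exact .inl (exists_linked_of_one_block hG hσ.1 hdeg hB hC hA (Ne.symm hBC)
      (hσ.not_adj hG hB hC hA (Ne.symm hBC) hAB hAC) hAB hAC hA4)
  · exact .inl (exists_linked_of_two_blocks hG hσ.1 hdeg hB hA hC hAB hBC hAC hA4 hC4)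
  · exact .inl (exists_linked_of_two_blocks hG hσ.1 hdeg hC hA hB hAC hBC hAB hA4 hB4)
  · exact .inl (exists_linked_of_three_blocks hG hσ.1 hdeg hA hB hC hAB hAC hBC hA4 hB4 hC4)

end Main
end ProperConnection

namespace ProperConnection

open Finset

/-! ### The proper connection number under the degree condition -/

section Number

variable {V : Type*} {G : SimpleGraph V}

lemma IsProperPath.get_ne {K : Type*} {c : G.EdgeLabeling K} {x y z w : V} {h : G.Adj x y}
    {h' : G.Adj y z} {p : G.Walk z w} (hp : IsProperPath c (.cons h (.cons h' p))) :
    c.get x y h ≠ c.get y z h' :=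
  (List.isChain_cons_cons.1 hp.2).1

lemma IsProperPath.tail {K : Type*} {c : G.EdgeLabeling K} {x y z : V} {h : G.Adj x y}
    {p : G.Walk y z} (hp : IsProperPath c (.cons h p)) : IsProperPath c p :=
  ⟨hp.1.of_cons, List.IsChain.of_cons hp.2⟩

/-- A proper path between nonadjacent vertices begins with two edges of different colours. -/
lemma two_le_of_isProperConnected (hG : G ≠ ⊤) {k : ℕ} {c : G.EdgeLabeling (Fin k)}
    (hc : IsProperConnected c) : 2 ≤ k := by
  obtain ⟨u, v, huv, hadj⟩ : ∃ u v, u ≠ v ∧ ¬ G.Adj u v := by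
    by_contra! h
    exact hG (eq_top_iff.2 fun u v huv => h u v huv)
  obtain ⟨p, hp⟩ := hc u v huv
  match p, hp with
  | .nil, _ => exact absurd rfl huv
  | .cons h .nil, _ => exact absurd h hadj
  | .cons h (.cons h' p), hp =>
    have := hp.get_ne
    rw [Ne, Fin.ext_iff] at this
    omega

lemma pc_eq_of_forall {k : ℕ} (h : ∃ c : G.EdgeLabeling (Fin k), IsProperConnected c)
    (hmin : ∀ (j : ℕ) (c : G.EdgeLabeling (Fin j)), IsProperConnected c → k ≤ j) : pc G = k :=
  le_antisymm (Nat.sInf_le h) (le_csInf ⟨k, h⟩ fun j ⟨c, hc⟩ => hmin j c hc)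

theorem pc_eq_two [Fintype V] [DecidableRel G.Adj] (h5 : 5 ≤ Fintype.card V) (hG : G.Connected)
    (hne : G ≠ ⊤) (h₁ : IsEmpty (G ≃g exceptional₁)) (h₂ : IsEmpty (G ≃g exceptional₂))
    (h₃ : IsEmpty (G ≃g exceptional₃))
    (hdeg : ∀ x y, x ≠ y → ¬ G.Adj x y → Fintype.card V ≤ 2 * (G.degree x + G.degree y)) :
    pc G = 2 := by
  classical
  obtain ⟨s, t, h⟩ : ∃ s t, Linked G univ s t := by
    simpa [not_nonempty_iff.2 h₁, not_nonempty_iff.2 h₂, not_nonempty_iff.2 h₃] using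
      exists_linked_or_iso hG h5 hdeg
  exact pc_eq_of_forall h.exists_isProperConnected fun _ _ => two_le_of_isProperConnected hne

end Number

/-! ### Constraints on the colours around a cut vertex -/

section Lower

variable {V : Type*} {G : SimpleGraph V}

/-- Every way out of `S` passes through `r`, so a walk that avoids `r` is trapped. -/
lemma mem_of_walk {S : Set V} {r : V} (hS : ∀ a ∈ S, ∀ b, G.Adj a b → b ∈ S ∨ b = r) {a b : V}
    (p : G.Walk a b) (ha : a ∈ S) (hr : r ∉ p.support) : b ∈ S := by
  induction p with
  | nil => exact ha
  | cons h p ih =>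
    rw [SimpleGraph.Walk.support_cons, List.mem_cons, not_or] at hr
    refine ih ((hS _ ha _ h).resolve_right ?_) hr.2
    rintro rfl
    exact hr.2 p.start_mem_support

variable {K : Type*} {c : G.EdgeLabeling K} {v s t x y : V} {X Y : Set V}

/-- A proper path from the triangle vertex `s` into the set `X` enters it from `v` through `x`. -/
lemma get_ne_of_triangle (hc : IsProperConnected c) (hsv : G.Adj s v) (htv : G.Adj t v)
    (hst : G.Adj s t) (hvx : G.Adj v x) (hs : ∀ z, G.Adj s z → z = v ∨ z = t)
    (ht : ∀ z, G.Adj t z → z = v ∨ z = s) (hv : ∀ z, G.Adj v z → z = s ∨ z = t ∨ z = x ∨ z = y)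
    (hY : ∀ a ∈ Y, ∀ b, G.Adj a b → b ∈ Y ∨ b = v) (hyY : y ∈ Y) (hxY : x ∉ Y) (hxs : x ≠ s)
    (hxt : x ≠ t) :
    c.get s v hsv ≠ c.get v x hvx ∨
      c.get s t hst ≠ c.get t v htv ∧ c.get t v htv ≠ c.get v x hvx := by
  have hvx0 := hvx.ne
  -- After passing through `v`, a path cannot return to it. The triangle and the set `Y` can be left
  -- only through `v`, so the next vertex must be `x`.
  have hfirst : ∀ {z} (h : G.Adj v z) (p : G.Walk z x), v ∉ p.support → z = x := by
    intro z h p hp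
    rcases hv z h with rfl | rfl | rfl | rfl
    · have := mem_of_walk (S := {z, t}) (r := v) (by simp; grind) p (by simp) hp
      simp at this; grind
    · have := mem_of_walk (S := {s, z}) (r := v) (by simp; grind) p (by simp) hp
      simp at this; grind
    · rfl
    · exact absurd (mem_of_walk hY p hyY hp) hxY
  obtain ⟨p, hp⟩ := hc s x hxs.symm
  cases p with
  | nil => exact absurd rfl hxs
  | @cons _ z _ h p =>
    have h1 := (SimpleGraph.Walk.cons_isPath_iff ..).1 hp.1
    rcases hs z h with rfl | rfl
    · cases p with
      | nil => exact absurd rfl hvx0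
      | cons h' p =>
        obtain rfl := hfirst h' p ((SimpleGraph.Walk.cons_isPath_iff ..).1 h1.1).2
        exact .inl hp.get_ne
    · cases p with
      | nil => exact absurd rfl hxt
      | @cons _ z' _ h' p =>
        have h2 := (SimpleGraph.Walk.cons_isPath_iff ..).1 h1.1
        rcases ht z' h' with rfl | rfl
        · cases p with
          | nil => exact absurd rfl hvx0
          | cons h'' p =>
            obtain rfl := hfirst h'' p ((SimpleGraph.Walk.cons_isPath_iff ..).1 h2.1).2
            exact .inr ⟨hp.get_ne, hp.tail.get_ne⟩
        · exact absurd (by simp) h1.2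

/-- A proper path from `x` to `y` uses the edges `xv` and `vy`. -/
lemma get_ne_of_between (hc : IsProperConnected c) (hvx : G.Adj v x) (hvy : G.Adj v y)
    (hs : ∀ z, G.Adj s z → z = v ∨ z = t)
    (ht : ∀ z, G.Adj t z → z = v ∨ z = s) (hv : ∀ z, G.Adj v z → z = s ∨ z = t ∨ z = x ∨ z = y)
    (hx : ∀ z, G.Adj x z → z = v ∨ z ∈ X) (hX : ∀ a ∈ X, ∀ b, G.Adj a b → b ∈ X ∨ b = x)
    (hyX : y ∉ X) (hys : y ≠ s) (hyt : y ≠ t) (hxy : x ≠ y) :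
    c.get v x hvx ≠ c.get v y hvy := by
  have hvy0 := hvy.ne
  obtain ⟨p, hp⟩ := hc x y hxy
  cases p with
  | nil => exact absurd rfl hxy
  | @cons _ z _ h p =>
    have h1 := (SimpleGraph.Walk.cons_isPath_iff ..).1 hp.1
    rcases hx z h with rfl | hz
    · cases p with
      | nil => exact absurd rfl hvy0
      | @cons _ z' _ h' p =>
        have h2 := (SimpleGraph.Walk.cons_isPath_iff ..).1 h1.1
        have h3 : z' = y := by
          rcases hv z' h' with rfl | rfl | rfl | rfl
          · have := mem_of_walk (S := {z', t}) (r := z) (by simp; grind) p (by simp) h2.2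
            simp at this; grind
          · have := mem_of_walk (S := {s, z'}) (r := z) (by simp; grind) p (by simp) h2.2
            simp at this; grind
          · exact absurd (by simp) h1.2
          · rfl
        subst h3
        rw [c.get_comm]
        exact hp.get_ne
    · exact absurd (mem_of_walk hX p hz h1.2) hyX

end Lower
end ProperConnection

namespace ProperConnection

open Finset

/-! ### The sharpness example -/

section Sharp

open Sum

variable {m : ℕ} [NeZero m]

@[simp] lemma sharpGraph_adj_inl_inl {i j : Fin 3} :
    (sharpGraph m).Adj (inl i) (inl j) ↔ i ≠ j := by
  simp [sharpGraph, SimpleGraph.edge_adj]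

@[simp] lemma sharpGraph_adj_inl_left {i : Fin 3} {j : Fin m} :
    (sharpGraph m).Adj (inl i) (inr (inl j)) ↔ i = 0 ∧ j = 0 := by
  simp [sharpGraph, SimpleGraph.edge_adj]

@[simp] lemma sharpGraph_adj_inl_right {i : Fin 3} {j : Fin m} :
    (sharpGraph m).Adj (inl i) (inr (inr j)) ↔ i = 0 ∧ j = 0 := by
  simp [sharpGraph, SimpleGraph.edge_adj]

@[simp] lemma sharpGraph_adj_left_inl {i : Fin 3} {j : Fin m} :
    (sharpGraph m).Adj (inr (inl j)) (inl i) ↔ i = 0 ∧ j = 0 := by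
  rw [SimpleGraph.adj_comm, sharpGraph_adj_inl_left]

@[simp] lemma sharpGraph_adj_right_inl {i : Fin 3} {j : Fin m} :
    (sharpGraph m).Adj (inr (inr j)) (inl i) ↔ i = 0 ∧ j = 0 := by
  rw [SimpleGraph.adj_comm, sharpGraph_adj_inl_right]

@[simp] lemma sharpGraph_adj_left_left {i j : Fin m} :
    (sharpGraph m).Adj (inr (inl i)) (inr (inl j)) ↔ i ≠ j := by
  simp [sharpGraph, SimpleGraph.edge_adj]

@[simp] lemma sharpGraph_adj_right_right {i j : Fin m} :
    (sharpGraph m).Adj (inr (inr i)) (inr (inr j)) ↔ i ≠ j := by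
  simp [sharpGraph, SimpleGraph.edge_adj]

@[simp] lemma sharpGraph_adj_left_right {i j : Fin m} :
    ¬ (sharpGraph m).Adj (inr (inl i)) (inr (inr j)) := by
  simp [sharpGraph, SimpleGraph.edge_adj]

@[simp] lemma sharpGraph_adj_right_left {i j : Fin m} :
    ¬ (sharpGraph m).Adj (inr (inr i)) (inr (inl j)) := by
  simp [sharpGraph, SimpleGraph.edge_adj]

lemma sharpGraph_ne_top : sharpGraph m ≠ ⊤ := by
  intro h
  have : ¬ (sharpGraph m).Adj (inl 1) (inr (inl 0)) := by simp
  rw [h] at this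
  simp at this

/-- With two colours, the edges from `v` to the two copies have different colours, so the edge from
one further triangle vertex to `v` agrees with one of them. Reaching that copy then requires the
detour, so the edges `s t` and `t v` differ. The edge `t v` now agrees with the edge to the other
copy, while `s t` and `s v` agree, so `t` has no proper path into that copy. -/
lemma three_le_of_isProperConnected {k : ℕ} {c : (sharpGraph m).EdgeLabeling (Fin k)}
    (hc : IsProperConnected c) : 3 ≤ k := by
  have h01 : (sharpGraph m).Adj (inl 1) (inl 0) := by simp
  have h02 : (sharpGraph m).Adj (inl 2) (inl 0) := by simp
  have h12 : (sharpGraph m).Adj (inl 1) (inl 2) := by simp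
  have h21 : (sharpGraph m).Adj (inl 2) (inl 1) := by simp
  have h0x : (sharpGraph m).Adj (inl 0) (inr (inl 0)) := by simp
  have h0y : (sharpGraph m).Adj (inl 0) (inr (inr 0)) := by simp
  have hs : ∀ z, (sharpGraph m).Adj (inl 1) z → z = inl 0 ∨ z = inl 2 := by
    rintro (i | i | i) h <;> simp at h ⊢
    omega
  have ht : ∀ z, (sharpGraph m).Adj (inl 2) z → z = inl 0 ∨ z = inl 1 := by
    rintro (i | i | i) h <;> simp at h ⊢
    omega
  have hv : ∀ z, (sharpGraph m).Adj (inl 0) z →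
      z = inl 1 ∨ z = inl 2 ∨ z = inr (inl 0) ∨ z = inr (inr 0) := by
    rintro (i | i | i) h <;> simp at h ⊢
    · omega
    · exact h
    · exact h
  have hv' : ∀ z, (sharpGraph m).Adj (inl 0) z →
      z = inl 1 ∨ z = inl 2 ∨ z = inr (inr 0) ∨ z = inr (inl 0) := fun z hz => by
    rw [or_comm (a := z = inr (inr 0))]; exact hv z hz
  have hvt : ∀ z, (sharpGraph m).Adj (inl 0) z →
      z = inl 2 ∨ z = inl 1 ∨ z = inr (inl 0) ∨ z = inr (inr 0) := fun z hz => by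
    rw [or_left_comm]; exact hv z hz
  have hvt' : ∀ z, (sharpGraph m).Adj (inl 0) z →
      z = inl 2 ∨ z = inl 1 ∨ z = inr (inr 0) ∨ z = inr (inl 0) := fun z hz => by
    rw [or_left_comm]; exact hv' z hz
  have hX : ∀ a ∈ Set.range (fun i : Fin m => (inr (inl i) : Fin 3 ⊕ (Fin m ⊕ Fin m))),
      ∀ b, (sharpGraph m).Adj a b →
        b ∈ Set.range (fun i : Fin m => (inr (inl i) : Fin 3 ⊕ (Fin m ⊕ Fin m))) ∨ b = inl 0 := by
    rintro _ ⟨i, rfl⟩ (j | j | j) h <;> simp at h ⊢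
    exact h.1
  have hY : ∀ a ∈ Set.range (fun i : Fin m => (inr (inr i) : Fin 3 ⊕ (Fin m ⊕ Fin m))),
      ∀ b, (sharpGraph m).Adj a b →
        b ∈ Set.range (fun i : Fin m => (inr (inr i) : Fin 3 ⊕ (Fin m ⊕ Fin m))) ∨ b = inl 0 := by
    rintro _ ⟨i, rfl⟩ (j | j | j) h <;> simp at h ⊢
    exact h.1
  have e1 := get_ne_of_triangle hc h01 h02 h12 h0x hs ht hv hY ⟨0, rfl⟩ (by simp) (by simp)
    (by simp)
  have e2 := get_ne_of_triangle hc h01 h02 h12 h0y hs ht hv' hX ⟨0, rfl⟩ (by simp) (by simp)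
    (by simp)
  have e3 := get_ne_of_triangle hc h02 h01 h21 h0x ht hs hvt hY ⟨0, rfl⟩ (by simp) (by simp)
    (by simp)
  have e4 := get_ne_of_triangle hc h02 h01 h21 h0y ht hs hvt' hX ⟨0, rfl⟩ (by simp) (by simp)
    (by simp)
  have e5 := get_ne_of_between hc h0x h0y hs ht hv
    (X := {z | ∃ i : Fin m, i ≠ 0 ∧ z = inr (inl i)})
    (by rintro (j | j | j) h <;> simp at h ⊢; exacts [h, Ne.symm h])
    (by
      rintro _ ⟨i, hi, rfl⟩ (j | j | j) h <;> simp at h ⊢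
      exacts [hi h.2, em' _])
    (by simp) (by simp) (by simp) (by simp)
  rw [SimpleGraph.EdgeLabeling.get_comm (x := inl 1) (y := inl 2)] at e3 e4
  generalize c.get (inl 1) (inl 0) h01 = c1 at *
  generalize c.get (inl 2) (inl 0) h02 = c2 at *
  generalize c.get (inl 1) (inl 2) _ = c3 at *
  generalize c.get (inl 0) (inr (inl 0)) h0x = c4 at *
  generalize c.get (inl 0) (inr (inr 0)) h0y = c5 at *
  by_contra! hk
  omega

/-- The colours of a proper connected colouring of the sharpness example. -/
def sharpColor : Fin 3 ⊕ (Fin m ⊕ Fin m) → Fin 3 ⊕ (Fin m ⊕ Fin m) → Fin 3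
  | inl _, inl _ => 2
  | inl _, inr (inl _) => 0
  | inr (inl _), inl _ => 0
  | inl _, inr (inr _) => 1
  | inr (inr _), inl _ => 1
  -- Pairs from different copies are not edges. Their value matters only for the symmetry of the
  -- function.
  | inr (inl _), inr _ => 1
  | inr (inr _), inr (inr _) => 0
  | inr (inr _), inr (inl _) => 1

omit [NeZero m] in
lemma sharpColor_comm (a b : Fin 3 ⊕ (Fin m ⊕ Fin m)) : sharpColor b a = sharpColor a b := by
  rcases a with a | a | a <;> rcases b with b | b | b <;> rfl

def sharpLabeling (m : ℕ) [NeZero m] : (sharpGraph m).EdgeLabeling (Fin 3) :=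
  .mk (fun a b _ => sharpColor a b) fun a b _ => sharpColor_comm a b

/-- A list of vertices that is a proper path of the coloured sharpness example. -/
lemma exists_isProperPath_of_list {a b : Fin 3 ⊕ (Fin m ⊕ Fin m)}
    (l : List (Fin 3 ⊕ (Fin m ⊕ Fin m))) (hadj : (a :: l).IsChain (sharpGraph m).Adj)
    (hn : (a :: l).Nodup) (hlast : (a :: l).getLast (by simp) = b)
    (hcol : ((a :: l).zip l).IsChain fun d e => sharpColor d.1 d.2 ≠ sharpColor e.1 e.2) :
    ∃ p : (sharpGraph m).Walk a b, IsProperPath (sharpLabeling m) p := by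
  -- The induction needs the support, to see that the path stays simple, and the list of darts, to
  -- transfer the colour condition.
  suffices h : ∃ p : (sharpGraph m).Walk a b, IsProperPath (sharpLabeling m) p ∧
      p.support = a :: l ∧ p.darts.map (fun d => d.toProd) = (a :: l).zip l by
    obtain ⟨p, hp, -⟩ := h
    exact ⟨p, hp⟩
  induction l generalizing a with
  | nil =>
    obtain rfl : a = b := by simpa using hlast
    exact ⟨.nil, by simp [IsProperPath]⟩
  | cons x l ih =>
    rw [List.isChain_cons_cons] at hadj
    obtain ⟨p, hp, hsupp, hd⟩ := ih hadj.2 (List.nodup_cons.1 hn).2 (by simpa using hlast)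
      hcol.of_cons
    refine ⟨.cons hadj.1 p, ⟨(SimpleGraph.Walk.cons_isPath_iff ..).2
      ⟨hp.1, by rw [hsupp]; exact (List.nodup_cons.1 hn).1⟩, ?_⟩, by simp [hsupp], by simp [hd]⟩
    have h1 : (SimpleGraph.Walk.cons hadj.1 p).darts.map (fun d => d.toProd) =
      (a :: x :: l).zip (x :: l) := by simp [hd]
    rw [← h1, List.isChain_map] at hcol
    exact hcol

lemma isProperConnected_sharpLabeling : IsProperConnected (sharpLabeling m) := by
  have hsymm : ∀ {a b : Fin 3 ⊕ (Fin m ⊕ Fin m)},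
      (∃ p : (sharpGraph m).Walk a b, IsProperPath (sharpLabeling m) p) →
      ∃ p : (sharpGraph m).Walk b a, IsProperPath (sharpLabeling m) p :=
    fun ⟨p, hp⟩ => ⟨p.reverse, hp.reverse⟩
  have hadj : ∀ {a b : Fin 3 ⊕ (Fin m ⊕ Fin m)}, (sharpGraph m).Adj a b →
      ∃ p : (sharpGraph m).Walk a b, IsProperPath (sharpLabeling m) p := fun {a b} h =>
    exists_isProperPath_of_list [b] (by simpa using h) (by simpa using h.ne) (by simp) (by simp)
  have hleft : ∀ (i : Fin 3) (j : Fin m),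
      ∃ p : (sharpGraph m).Walk (inl i) (inr (inl j)), IsProperPath (sharpLabeling m) p := by
    intro i j
    by_cases hi : i = 0 <;> by_cases hj : j = 0
    · exact hadj (by simp [hi, hj])
    · exact exists_isProperPath_of_list [inr (inl 0), inr (inl j)] (by simp [hi, Ne.symm hj])
        (by simp [Ne.symm hj]) (by simp) (by simp [sharpColor])
    · exact exists_isProperPath_of_list [inl 0, inr (inl j)] (by simp [hi, hj])
        (by simp [hi]) (by simp) (by simp [sharpColor])
    · exact exists_isProperPath_of_list [inl 0, inr (inl 0), inr (inl j)]
        (by simp [hi, Ne.symm hj]) (by simp [hi, Ne.symm hj]) (by simp) (by simp [sharpColor])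
  have hright : ∀ (i : Fin 3) (j : Fin m),
      ∃ p : (sharpGraph m).Walk (inl i) (inr (inr j)), IsProperPath (sharpLabeling m) p := by
    intro i j
    by_cases hi : i = 0 <;> by_cases hj : j = 0
    · exact hadj (by simp [hi, hj])
    · exact exists_isProperPath_of_list [inr (inr 0), inr (inr j)] (by simp [hi, Ne.symm hj])
        (by simp [Ne.symm hj]) (by simp) (by simp [sharpColor])
    · exact exists_isProperPath_of_list [inl 0, inr (inr j)] (by simp [hi, hj])
        (by simp [hi]) (by simp) (by simp [sharpColor])
    · exact exists_isProperPath_of_list [inl 0, inr (inr 0), inr (inr j)]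
        (by simp [hi, Ne.symm hj]) (by simp [hi, Ne.symm hj]) (by simp) (by simp [sharpColor])
  have hcross : ∀ i j : Fin m,
      ∃ p : (sharpGraph m).Walk (inr (inl i)) (inr (inr j)), IsProperPath (sharpLabeling m) p := by
    intro i j
    by_cases hi : i = 0 <;> by_cases hj : j = 0
    · exact exists_isProperPath_of_list [inl 0, inr (inr j)] (by simp [hi, hj])
        (by simp) (by simp) (by simp [sharpColor])
    · exact exists_isProperPath_of_list [inl 0, inr (inr 0), inr (inr j)]
        (by simp [hi, Ne.symm hj]) (by simp [Ne.symm hj]) (by simp) (by simp [sharpColor])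
    · exact exists_isProperPath_of_list [inr (inl 0), inl 0, inr (inr j)]
        (by simp [hi, hj]) (by simp [hi]) (by simp) (by simp [sharpColor])
    · exact exists_isProperPath_of_list [inr (inl 0), inl 0, inr (inr 0), inr (inr j)]
        (by simp [hi, Ne.symm hj]) (by simp [hi, Ne.symm hj]) (by simp) (by simp [sharpColor])
  rintro (i | i | i) (j | j | j) h
  · exact hadj (by simpa using h)
  · exact hleft i j
  · exact hright i j
  · exact hsymm (hleft j i)
  · exact hadj (by simpa using h)
  · exact hcross i j
  · exact hsymm (hright j i)
  · exact hsymm (hcross j i)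
  · exact hadj (by simpa using h)

lemma sharpGraph_connected : (sharpGraph m).Connected := by
  refine ⟨fun u v => ?_⟩
  by_cases h : u = v
  · exact h ▸ .refl u
  · obtain ⟨p, -⟩ := isProperConnected_sharpLabeling u v h
    exact p.reachable

lemma pc_sharpGraph : pc (sharpGraph m) = 3 :=
  pc_eq_of_forall ⟨_, isProperConnected_sharpLabeling⟩ fun _ _ => three_le_of_isProperConnected

variable [DecidableRel (sharpGraph m).Adj]

lemma two_le_degree_inl (i : Fin 3) : 2 ≤ (sharpGraph m).degree (inl i) := by
  rw [← SimpleGraph.card_neighborFinset_eq_degree]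
  have h : (univ.erase i).image inl ⊆ (sharpGraph m).neighborFinset (inl i) := by
    intro z hz
    simp only [mem_image, mem_erase, mem_univ, and_true] at hz
    obtain ⟨j, hj, rfl⟩ := hz
    simpa using Ne.symm hj
  refine le_trans ?_ (card_le_card h)
  rw [card_image_of_injective _ inl_injective, card_erase_of_mem (mem_univ i)]
  simp

lemma le_degree_inr (z : Fin m ⊕ Fin m) : m ≤ (sharpGraph m).degree (inr z) + 1 := by
  rw [← SimpleGraph.card_neighborFinset_eq_degree]
  have key : ∀ (i : Fin m) (f : Fin m → Fin 3 ⊕ (Fin m ⊕ Fin m)), Function.Injective f →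
      (∀ j, j ≠ i → (sharpGraph m).Adj (inr z) (f j)) →
      m ≤ #((sharpGraph m).neighborFinset (inr z)) + 1 := by
    intro i f hf h
    have h : (univ.erase i).image f ⊆ (sharpGraph m).neighborFinset (inr z) := by
      intro z hz
      simp only [mem_image, mem_erase, mem_univ, and_true] at hz
      obtain ⟨j, hj, rfl⟩ := hz
      simpa using h j hj
    have := card_le_card h
    rw [card_image_of_injective _ hf, card_erase_of_mem (mem_univ i), card_univ,
      Fintype.card_fin] at this
    omega
  rcases z with i | i
  · exact key i (fun j => inr (inl j)) (inr_injective.comp inl_injective)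
      fun j hj => by simpa using Ne.symm hj
  · exact key i (fun j => inr (inr j)) (inr_injective.comp inr_injective)
      fun j hj => by simpa using Ne.symm hj

/-- For vertices in different copies, both degrees are at least `m - 1` and at least 1, and `2 * (m
- 1) ≥ m + 1` once `m ≥ 3`. For `m = 1` the bound by 1 suffices, and for `m = 2` two vertices of
degree one violate the inequality. -/
lemma le_degree_add_degree (hm : m ≠ 2) (x y : Fin 3 ⊕ (Fin m ⊕ Fin m)) (hxy : x ≠ y)
    (hadj : ¬ (sharpGraph m).Adj x y) :
    m + 1 ≤ (sharpGraph m).degree x + (sharpGraph m).degree y := by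
  rcases x with i | z <;> rcases y with j | z'
  · exact absurd (by simpa using hxy) hadj
  · have := two_le_degree_inl (m := m) i
    have := le_degree_inr z'
    omega
  · have := two_le_degree_inl (m := m) j
    have := le_degree_inr z
    omega
  · have hpos : ∀ x, 1 ≤ (sharpGraph m).degree x := fun x =>
      have : Nontrivial (Fin 3 ⊕ (Fin m ⊕ Fin m)) := inl_injective.nontrivial
      sharpGraph_connected.preconnected.degree_pos_of_nontrivial x
    have := hpos (inr z)
    have := hpos (inr z')
    have := le_degree_inr z
    have := le_degree_inr z'
    have := NeZero.pos m
    omega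

end Sharp

end ProperConnection

open ProperConnection in
theorem theorem1 :
    (∀ (V : Type*) [Fintype V] (G : SimpleGraph V) [DecidableRel G.Adj],
      5 ≤ Fintype.card V → G.Connected → G ≠ ⊤ →
      IsEmpty (G ≃g exceptional₁) → IsEmpty (G ≃g exceptional₂) → IsEmpty (G ≃g exceptional₃) →
      (∀ x y : V, x ≠ y → ¬ G.Adj x y →
        (Fintype.card V : ℝ) / 2 ≤ (G.degree x : ℝ) + (G.degree y : ℝ)) →
      pc G = 2) ∧
    (∀ (m : ℕ) [NeZero m] [DecidableRel (sharpGraph m).Adj],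
      (sharpGraph m).Connected ∧ sharpGraph m ≠ ⊤ ∧ pc (sharpGraph m) = 3 ∧
      (m ≠ 2 → ∀ x y : Fin 3 ⊕ (Fin m ⊕ Fin m), x ≠ y → ¬ (sharpGraph m).Adj x y →
        (Fintype.card (Fin 3 ⊕ (Fin m ⊕ Fin m)) : ℝ) / 2 - 1 ≤
          ((sharpGraph m).degree x : ℝ) + ((sharpGraph m).degree y : ℝ))) := by
  refine ⟨?_, ?_⟩
  · intro V _ G _ h5 hG hne h₁ h₂ h₃ hdeg
    refine pc_eq_two h5 hG hne h₁ h₂ h₃ fun x y hxy hadj => ?_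
    have := hdeg x y hxy hadj
    rw [div_le_iff₀ two_pos, mul_comm] at this
    exact_mod_cast this
  · intro m _ _
    refine ⟨sharpGraph_connected, sharpGraph_ne_top, pc_sharpGraph, fun hm x y hxy hadj => ?_⟩
    -- With `n = 2 * m + 3` the required bound is `m + 1 / 2`, which the integer bound `m + 1`
    -- implies.
    have : ((m + 1 : ℕ) : ℝ) ≤
        ((sharpGraph m).degree x + (sharpGraph m).degree y : ℕ) := by
      exact_mod_cast le_degree_add_degree hm x y hxy hadj
    simp only [Fintype.card_sum, Fintype.card_fin]
    push_cast at this ⊢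
    linarith
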